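/- **Setting.** Let $T\ge 1$, $a(1),a(2),\dots\in\mathbb C$ with $\sum_j|a(j)|<\infty$, $s\ge 0$ and $N_1,K_1,\dots,N_s,K_s\in\{0,1,2,\dots\}$. Put $M_l=\sum_{k=1}^l(N_k+K_k)$, $\widetilde S=\bigcup_{l=1}^s\{-M_l,\dots,-M_{l-1}-N_l-1\}$, $\Gamma=\widetilde S\cup\{0,1,2,\dots\}$, $O=\{\dots,-2,-1\}\setminus\widetilde S$. Write $\vec a(j)=(a(jT+1),\dots,a(jT+T))^\top$ and $A(e^{i\lambda})=\sum_{j\ge0}\vec a(j)e^{ij\lambda}$. A spectral density is an integrable $T\times T$ matrix function on $(-\pi,\pi]$ that is positive semidefinite almost everywhere. For uncorrelated $T$-periodically correlated sequences $\zeta,\theta$ whose $T$-blockings $\vec\zeta(n)=(\zeta(nT+1),\dots,\zeta(nT+T))^\top$ and $\vec\theta(n)$ have spectral densities $f,g$, the functional $A\zeta=\sum_{j\ge1}a(j)\zeta(j)=\sum_{j\ge0}\vec a(j)^\top\vec\zeta(j)$ is estimated linearly from $\vec\zeta(n)+\vec\theta(n)$, $n\in O$. The spectral characteristic $h$ of an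 estimate is an element of $L_2^s(f+g)$, the closed subspace of $L_2(f+g)$ spanned by $e^{in\lambda}\delta_\nu$, $n\in O$, $1\le\nu\le T$. Its mean square error is $$\Delta(h;f,g)=\frac1{2\pi}\int_{-\pi}^{\pi}(A-h)^\top f\,\overline{(A-h)}\,d\lambda+\frac1{2\pi}\int_{-\pi}^{\pi}h^\top g\,\overline h\,d\lambda ,$$ and $\Delta(f,g)=\inf_{h\in L_2^s(f+g)}\Delta(h;f,g)$ is the error of the optimal estimate. The pair $(f,g)$ satisfies the *minimality condition* if $f+g$ is invertible a.e. and $\int_{-\pi}^{\pi}\mathrm{Tr}\,(f+g)^{-1}d\lambda<\infty$. In that case let $\mathbf B,\mathbf R,\mathbf D$ be the block matrices indexed by $\Gamma\times\Gamma$ whose $(m,n)$ blocks are the transposes of the Fourier coefficients $\frac1{2\pi}\int_{-\pi}^{\pi}F(\lambda)e^{-i(m-n)\lambda}d\lambda$ of $F=(f+g)^{-1}$, $F=f(f+g)^{-1}$ and $F=f(f+g)^{-1}g$ respectively. Let $\mathbf a=(\mathbf a(n))_{n\in\Gamma}$ with $\mathbf a(n)=\vec a(n)$ for $n\ge0$ and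 $\mathbf a(n)=0$ for $n\in\widetilde S$, and $\langle x,y\rangle=\sum_{n\in\Gamma}x(n)^\top\overline{y(n)}$. The inverse $\mathbf B^{-1}$ is taken in the energy space of $\mathbf B$: $c=\mathbf B^{-1}x$ means that there are finitely supported $u_k$ that are Cauchy in the norm $\langle\mathbf Bu,u\rangle^{1/2}$, with $u_k\to c$ and $\mathbf Bu_k\to x$ coordinatewise, and $\langle x,\mathbf B^{-1}x\rangle=\lim_k\langle x,u_k\rangle$. (If $\mathbf B$ is a bounded invertible operator on $\ell^2$ and $x\in\ell^2$, this is the usual inverse.) A function $h$ is *given by formula* $(*)$ for $(f,g)$ if, almost everywhere, $$h^\top=\bigl(A^\top f-C^\top\bigr)(f+g)^{-1},\qquad(*)$$ where $c=\mathbf B^{-1}\mathbf R\mathbf a$ and $C$ is the integrable function with Fourier series $\sum_{n\in\Gamma}c(n)e^{in\lambda}$. Let $D=D_f\times D_g$ with $D_f,D_g$ sets of spectral densities, and $H_D=\bigcap_{(f,g)\in D}L_2^s(f+g)$. A pair $(f^0,g^0)\in D$ is *least favorable* if $\Delta(f^0,g^0)=\max_{(f,g)\in D}\Delta(f,g)$.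 A function $h^0\in H_D$ is a *minimax spectral characteristic* if $\max_{(f,g)\in D}\Delta(h^0;f,g)$ exists and is at most $\sup_{(f,g)\in D}\Delta(h;f,g)$ for every $h\in H_D$. **Lemma.** Let $(f^0,g^0)\in D$ satisfy the minimality condition, and let it maximize $$\langle\mathbf R\mathbf a,\mathbf B^{-1}\mathbf R\mathbf a\rangle+\langle\mathbf D\mathbf a,\mathbf a\rangle$$ over all pairs $(f,g)\in D$ that satisfy the minimality condition (those for which the expression is defined). 1. If $D_f$ and $D_g$ are convex, or if every pair in $D$ satisfies the minimality condition, then $(f^0,g^0)$ is least favorable in $D$. 2. A function $h^0=h(f^0,g^0)$ given by formula $(*)$ for $(f^0,g^0)$ exists. Every such $h^0$ is the spectral characteristic of the optimal estimate for $(f^0,g^0)$, that is, $h^0\in L_2^s(f^0+g^0)$ and $\Delta(h^0;f^0,g^0)=\Delta(f^0,g^0)$. If $D_f$ and $D_g$ are convex and $h^0\in H_D$, then $h^0$ is a minimax spectral characteristic. -/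

import Mathlib

open MeasureTheory Filter Topology Matrix
open scoped ENNReal ComplexOrder

noncomputable section

namespace PCExtrapolation

/-- Functions of the frequency variable with values in the complex `T × T` matrices. -/
abbrev MatFun (T : ℕ) := ℝ → Matrix (Fin T) (Fin T) ℂ

/-- Functions of the frequency variable with values in `ℂ^T`. -/
abbrev VecFun (T : ℕ) := ℝ → Fin T → ℂ

/-- Lebesgue measure on the frequency interval `(-π, π]`. -/
def freq : Measure ℝ := volume.restrict (Set.Ioc (-Real.pi) Real.pi)

/-- A spectral density matrix: integrable entries, positive semidefinite (hence Hermitian)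
almost everywhere. -/
structure IsSpectralDensity {T : ℕ} (f : MatFun T) : Prop where
  integrable : ∀ i j, Integrable (fun x => f x i j) freq
  posSemidef : ∀ᵐ x ∂freq, (f x).PosSemidef

/-- The minimality condition `∫ Tr (f + g)⁻¹ < ∞`; the inverse has to exist almost everywhere. -/
def Minimality {T : ℕ} (f g : MatFun T) : Prop :=
  (∀ᵐ x ∂freq, IsUnit (f x + g x).det) ∧
    Integrable (fun x => ((f x + g x)⁻¹).trace) freq

/-! ### The observation pattern -/

/-- `M_l = ∑_{k=1}^l (N_k + K_k)`. -/
def patternSum (N K : ℕ → ℕ) (l : ℕ) : ℕ := ∑ k ∈ Finset.Icc 1 l, (N k + K k)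

/-- The missed (block) indices: the union over `l = 1, …, s` of the intervals
`{-M_l, …, -M_{l-1} - N_l - 1}`; the bound variable below is `l - 1`. -/
def missed (s : ℕ) (N K : ℕ → ℕ) : Set ℤ :=
  {n | ∃ l < s, -(patternSum N K (l + 1) : ℤ) ≤ n ∧
    n ≤ -(patternSum N K l : ℤ) - (N (l + 1) : ℤ) - 1}

/-- The (block) indices at which the sequence is observed. -/
def observed (s : ℕ) (N K : ℕ → ℕ) : Set ℤ := {n | n < 0} \ missed s N K

/-- The set `Γ`: missed indices together with `0, 1, 2, …`. -/
def unobserved (s : ℕ) (N K : ℕ → ℕ) : Set ℤ := missed s N K ∪ {n | 0 ≤ n}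

/-! ### The functional -/

/-- The blocked coefficients: the `ν`-th entry (`ν = 1, …, T`) of the vector number `j` is
`a (j T + ν)`. -/
def blockCoeff (T : ℕ) (a : ℕ → ℂ) (j : ℕ) : Fin T → ℂ := fun ν => a (j * T + ν + 1)

/-- `A(e^{ix}) = ∑_{j ≥ 0} a⃗(j) e^{ijx}`. -/
def symbolA (T : ℕ) (a : ℕ → ℂ) : VecFun T := fun x =>
  ∑' j : ℕ, Complex.exp (Complex.I * (j : ℂ) * (x : ℂ)) • blockCoeff T a j

/-- The sequence `(0, …, 0, a⃗(0), a⃗(1), …)` indexed by `Γ`: zero at the missed indices. -/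
def extCoeff (T : ℕ) (a : ℕ → ℂ) (G : Set ℤ) : G → Fin T → ℂ := fun n =>
  if 0 ≤ (n : ℤ) then blockCoeff T a (n : ℤ).toNat else 0

/-! ### Weighted spaces, mean square error, optimality -/

/-- `b^⊤ F b̄`. -/
def quad {T : ℕ} (F : Matrix (Fin T) (Fin T) ℂ) (b : Fin T → ℂ) : ℂ := b ⬝ᵥ (F *ᵥ star b)

/-- `∫ b(x)^⊤ F(x) b̄(x) dx` in `[0, ∞]`, for `F` positive semidefinite almost everywhere. -/
def weightedSq {T : ℕ} (F : MatFun T) (b : VecFun T) : ℝ≥0∞ :=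
  ∫⁻ x, ENNReal.ofReal (quad (F x) (b x)).re ∂freq

/-- The trigonometric polynomial `∑ p(n) e^{inx}`. -/
def trigPoly {T : ℕ} (p : ℤ →₀ (Fin T → ℂ)) : VecFun T := fun x =>
  p.sum fun n v => Complex.exp (Complex.I * (n : ℂ) * (x : ℂ)) • v

/-- The closed subspace of `L₂(F)` generated by `e^{inx} δ_ν`, `n ∈ O`, `ν = 1, …, T`. -/
def L2span {T : ℕ} (O : Set ℤ) (F : MatFun T) : Set (VecFun T) :=
  {h | AEStronglyMeasurable h freq ∧ weightedSq F h < ∞ ∧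
    ∀ ε : ℝ≥0∞, 0 < ε → ∃ p : ℤ →₀ (Fin T → ℂ), (∀ n ∈ p.support, n ∈ O) ∧
      weightedSq F (fun x => h x - trigPoly p x) < ε}

/-- The mean square error `Δ(h; f, g)` of the estimate with spectral characteristic `h`. -/
def mse {T : ℕ} (a : ℕ → ℂ) (h : VecFun T) (f g : MatFun T) : ℝ≥0∞ :=
  ENNReal.ofReal (1 / (2 * Real.pi)) * weightedSq f (fun x => symbolA T a x - h x) +
    ENNReal.ofReal (1 / (2 * Real.pi)) * weightedSq g h

/-- The error `Δ(f, g)` of the optimal linear estimate from the observations at `O`. -/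
def minError {T : ℕ} (a : ℕ → ℂ) (O : Set ℤ) (f g : MatFun T) : ℝ≥0∞ :=
  ⨅ h ∈ L2span O (f + g), mse a h f g

/-- `h` is the spectral characteristic of the optimal linear estimate. -/
def IsOptimal {T : ℕ} (a : ℕ → ℂ) (O : Set ℤ) (f g : MatFun T) (h : VecFun T) : Prop :=
  h ∈ L2span O (f + g) ∧ mse a h f g = minError a O f g

/-- `(f₀, g₀)` is least favorable in `Df × Dg`. -/
def IsLeastFavorable {T : ℕ} (a : ℕ → ℂ) (O : Set ℤ) (Df Dg : Set (MatFun T))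
    (f₀ g₀ : MatFun T) : Prop :=
  f₀ ∈ Df ∧ g₀ ∈ Dg ∧ ∀ f ∈ Df, ∀ g ∈ Dg, minError a O f g ≤ minError a O f₀ g₀

/-- `H_D`, the intersection of the spaces `L₂ˢ(f + g)` over `(f, g) ∈ Df × Dg`. -/
def commonSpace {T : ℕ} (O : Set ℤ) (Df Dg : Set (MatFun T)) : Set (VecFun T) :=
  {h | ∀ f ∈ Df, ∀ g ∈ Dg, h ∈ L2span O (f + g)}

/-- `h₀` is a minimax (robust) spectral characteristic for `Df × Dg`: it lies in `H_D`, its error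
attains a maximum on `Df × Dg`, and no `h ∈ H_D` has a smaller worst-case error. -/
def IsMinimax {T : ℕ} (a : ℕ → ℂ) (O : Set ℤ) (Df Dg : Set (MatFun T)) (h₀ : VecFun T) : Prop :=
  h₀ ∈ commonSpace O Df Dg ∧
    ∃ m : ℝ≥0∞, IsGreatest {e | ∃ f ∈ Df, ∃ g ∈ Dg, e = mse a h₀ f g} m ∧
      ∀ h ∈ commonSpace O Df Dg, m ≤ ⨆ f ∈ Df, ⨆ g ∈ Dg, mse a h f g

/-! ### The matrices `B`, `R`, `D` -/

/-- The Fourier coefficient `(1/2π) ∫ F(x) e^{-ikx} dx`, entry by entry. -/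
def matCoeff {T : ℕ} (F : MatFun T) (k : ℤ) : Matrix (Fin T) (Fin T) ℂ :=
  Matrix.of fun i j => (1 / (2 * Real.pi) : ℂ) *
    ∫ x, F x i j * Complex.exp (-(Complex.I * (k : ℂ) * (x : ℂ))) ∂freq

/-- The block matrix indexed by `G` whose `(m, n)` block is the transposed Fourier coefficient of
`F` with number `m - n`; the transpose makes it act on column vectors. -/
def blockMatrix {T : ℕ} (G : Set ℤ) (F : MatFun T) (m n : G) : Matrix (Fin T) (Fin T) ℂ :=
  (matCoeff F ((m : ℤ) - (n : ℤ)))ᵀ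

/-- `B`, from the Fourier coefficients of `(f + g)⁻¹`. -/
def matB {T : ℕ} (G : Set ℤ) (f g : MatFun T) : G → G → Matrix (Fin T) (Fin T) ℂ :=
  blockMatrix G fun x => (f x + g x)⁻¹

/-- `R`, from the Fourier coefficients of `f (f + g)⁻¹`. -/
def matR {T : ℕ} (G : Set ℤ) (f g : MatFun T) : G → G → Matrix (Fin T) (Fin T) ℂ :=
  blockMatrix G fun x => f x * (f x + g x)⁻¹

/-- `D`, from the Fourier coefficients of `f (f + g)⁻¹ g`. -/
def matD {T : ℕ} (G : Set ℤ) (f g : MatFun T) : G → G → Matrix (Fin T) (Fin T) ℂ :=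
  blockMatrix G fun x => f x * (f x + g x)⁻¹ * g x

/-- The product of a block matrix and a sequence, used for absolutely summable sequences. -/
def applySeq {T : ℕ} {G : Set ℤ} (P : G → G → Matrix (Fin T) (Fin T) ℂ)
    (c : G → Fin T → ℂ) (m : G) : Fin T → ℂ := ∑' n : G, P m n *ᵥ c n

/-- The scalar product `⟨x, y⟩ = ∑ x(n)^⊤ ȳ(n)`, used where it converges absolutely. -/
def pairSeq {T : ℕ} {G : Set ℤ} (x y : G → Fin T → ℂ) : ℂ := ∑' n : G, x n ⬝ᵥ star (y n)

/-- The product of a block matrix and a finitely supported sequence. -/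
def applyFin {T : ℕ} {G : Set ℤ} (P : G → G → Matrix (Fin T) (Fin T) ℂ)
    (c : G →₀ (Fin T → ℂ)) (m : G) : Fin T → ℂ := c.sum fun n v => P m n *ᵥ v

/-- The scalar product `⟨x, c⟩` with a finitely supported sequence `c`. -/
def pairFin {T : ℕ} {G : Set ℤ} (x : G → Fin T → ℂ) (c : G →₀ (Fin T → ℂ)) : ℂ :=
  c.sum fun n v => x n ⬝ᵥ star v

/-- The finitely supported sequences `u k` converge to the solution `c` of `P c = x` in the energy
norm `⟨P c, c⟩^{1/2}` of the positive matrix `P`: they are Cauchy in this norm, and `P (u k)`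
converges to `x` in each coordinate. When `P` is a bounded invertible operator on `ℓ²`, the
truncations of the usual `P⁻¹ x` are such a sequence. The Fourier coefficients of a matrix function
that is merely integrable need not define a bounded operator on `ℓ²`. -/
def EnergySolution {T : ℕ} {G : Set ℤ} (P : G → G → Matrix (Fin T) (Fin T) ℂ)
    (x : G → Fin T → ℂ) (u : ℕ → G →₀ (Fin T → ℂ)) : Prop :=
  Tendsto (fun kl : ℕ × ℕ => pairFin (applyFin P (u kl.1 - u kl.2)) (u kl.1 - u kl.2))
      atTop (𝓝 0) ∧
    ∀ m : G, Tendsto (fun k => applyFin P (u k) m) atTop (𝓝 (x m))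

/-- `c = P⁻¹ x`. -/
def IsInverseApply {T : ℕ} {G : Set ℤ} (P : G → G → Matrix (Fin T) (Fin T) ℂ)
    (x c : G → Fin T → ℂ) : Prop :=
  ∃ u, EnergySolution P x u ∧ ∀ n : G, Tendsto (fun k => u k n) atTop (𝓝 (c n))

/-- `r = ⟨x, P⁻¹ x⟩`. -/
def IsInverseForm {T : ℕ} {G : Set ℤ} (P : G → G → Matrix (Fin T) (Fin T) ℂ)
    (x : G → Fin T → ℂ) (r : ℂ) : Prop :=
  ∃ u, EnergySolution P x u ∧ Tendsto (fun k => pairFin x (u k)) atTop (𝓝 r)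

/-- `q = ⟨R a, B⁻¹ R a⟩ + ⟨D a, a⟩`. -/
def IsObjective {T : ℕ} (a : ℕ → ℂ) (G : Set ℤ) (f g : MatFun T) (q : ℝ) : Prop :=
  ∃ r : ℂ, IsInverseForm (matB G f g) (applySeq (matR G f g) (extCoeff T a G)) r ∧
    (q : ℂ) = r + pairSeq (applySeq (matD G f g) (extCoeff T a G)) (extCoeff T a G)

/-- `(f₀, g₀)` maximizes `⟨R a, B⁻¹ R a⟩ + ⟨D a, a⟩` over the pairs of `Df × Dg` for which the
matrices are defined, that is, the pairs that satisfy the minimality condition. -/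
def SolvesMaxProblem {T : ℕ} (a : ℕ → ℂ) (G : Set ℤ) (Df Dg : Set (MatFun T))
    (f₀ g₀ : MatFun T) : Prop :=
  ∃ q₀ : ℝ, IsObjective a G f₀ g₀ q₀ ∧
    ∀ f ∈ Df, ∀ g ∈ Dg, Minimality f g → ∀ q : ℝ, IsObjective a G f g q → q ≤ q₀

/-! ### The explicit spectral characteristic -/

/-- `C` is the integrable function with Fourier series `∑_{n ∈ G} c(n) e^{inx}`. -/
def HasFourierSeries {T : ℕ} {G : Set ℤ} (C : VecFun T) (c : G → Fin T → ℂ) : Prop :=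
  (∀ ν, Integrable (fun x => C x ν) freq) ∧
    ∀ (n : ℤ) (ν : Fin T), (1 / (2 * Real.pi) : ℂ) *
        ∫ x, C x ν * Complex.exp (-(Complex.I * (n : ℂ) * (x : ℂ))) ∂freq =
      open Classical in if hn : n ∈ G then c ⟨n, hn⟩ ν else 0

/-- `h^⊤ = (A^⊤ f - C^⊤) (f + g)⁻¹` with `C = ∑_{n ∈ G} c(n) e^{inx}` and `c = B⁻¹ R a`. -/
def IsSpectralFormula {T : ℕ} (a : ℕ → ℂ) (G : Set ℤ) (f g : MatFun T) (h : VecFun T) : Prop :=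
  ∃ (c : G → Fin T → ℂ) (C : VecFun T),
    IsInverseApply (matB G f g) (applySeq (matR G f g) (extCoeff T a G)) c ∧
    HasFourierSeries C c ∧
    ∀ᵐ x ∂freq, h x = (symbolA T a x ᵥ* f x - C x) ᵥ* (f x + g x)⁻¹

end PCExtrapolation

end

open PCExtrapolation

/-!
The estimation problem is a projection problem in the weighted space `L₂(f + g)`. Completing the
square, the mean square error of `h` is the integral of `A^⊤ f (f + g)⁻¹ g Ā`, which does not
depend on `h`, plus the squared distance of `h^⊤` to `A^⊤ f (f + g)⁻¹`. With a measurable Hermitian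
square root `S` of `f + g`, the weights `f + g` and `(f + g)⁻¹` are both carried into the unweighted
space of square integrable functions with values in `ℂ^T`, by `b ↦ b ᵥ* S` and `b ↦ b ᵥ* S⁻¹`
(`IsRoot`, `polyEmb`). There `B` is the Gram matrix of the exponentials with frequencies in `Γ` for
the weight `(f + g)⁻¹`, `R a` lists their inner products with the target, and `B⁻¹ R a` is the
orthogonal projection of the target onto their closed span (`EnergySolution.tendsto_residual`).

For this projection to be the part of the target that the observations cannot reach, the closed
span for `(f + g)⁻¹` over `Γ` has to be the full orthogonal complement of the closed span for
`f + g` over the observed frequencies (`polySpace_inv_orthogonal`). Membership in the complements of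
these spans is a condition on the Fourier coefficients of integrable functions, and what has to be
shown is a theorem of Smirnov type: if the `u i` and `v i` are integrable and of analytic type, the
`v i` have mean zero, and `∑ i, u i * v i` is integrable, then its integral is zero
(`integral_sum_mul_eq_zero_of_analytic`). The proof multiplies by Szegő's extremal functions
(`exists_multiplier`): for the weight `1 + ε w`, subtract from the constant `1` its projection onto
the closed span of the exponentials with positive frequencies. The result `ψ` is of analytic type,
and `|ψ|² (1 + ε w)` is constant, since all its other Fourier coefficients vanish. For
`w = ∑ i, (|u i| + |v i|)` this makes `ψ u i` and `ψ v i` square integrable, and `ψ → 1` as `ε → 0`.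
The finitely many missed frequencies are split off as a trigonometric polynomial.

It follows that, under the minimality condition, the objective equals the minimal error
(`isObjective_iff_minError`), and that the explicit spectral characteristic represents the target
minus its projection (`IsSpectralFormula.toLp_eq`). The minimal error is an infimum over
trigonometric polynomials, hence concave in the pair of densities (`minError_concave`), and the
midpoint of any pair with one that satisfies the minimality condition satisfies it as well
(`Minimality.combo`); this gives the least favorable pair. For the minimax property, near-optimal
polynomials for the pairs `(1 - t) (f₀, g₀) + t (f, g)` converge to `h₀` almost everywhere along a
sequence `t → 0`, and Fatou's lemma bounds the error of `h₀` at `(f, g)`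
(`mse_le_minError_of_convex`).
-/

noncomputable section

namespace PCExtrapolation

/-! ### Fourier analysis on the frequency interval -/

/-- The character `x ↦ e^{inx}`. -/
def expI (n : ℤ) (x : ℝ) : ℂ := Complex.exp (Complex.I * (n : ℂ) * (x : ℂ))

instance : IsFiniteMeasure freq := by unfold freq; infer_instance

theorem continuous_expI (n : ℤ) : Continuous (expI n) := by unfold expI; fun_prop

theorem norm_expI (n : ℤ) (x : ℝ) : ‖expI n x‖ = 1 := by
  unfold expI
  rw [show Complex.I * (n : ℂ) * (x : ℂ) = ((n * x : ℝ) : ℂ) * Complex.I by push_cast; ring]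
  exact Complex.norm_exp_ofReal_mul_I _

theorem expI_add (m n : ℤ) (x : ℝ) : expI (m + n) x = expI m x * expI n x := by
  unfold expI
  rw [← Complex.exp_add]; congr 1; push_cast; ring

theorem expI_zero (x : ℝ) : expI 0 x = 1 := by simp [expI]

theorem star_expI (n : ℤ) (x : ℝ) : star (expI n x) = expI (-n) x := by
  unfold expI
  rw [← starRingEnd_apply, ← Complex.exp_conj]
  congr 1
  simp

theorem expI_neg_eq (n : ℤ) (x : ℝ) :
    Complex.exp (-(Complex.I * (n : ℂ) * (x : ℂ))) = expI (-n) x := by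
  unfold expI; congr 1; push_cast; ring

theorem aesm_expI (n : ℤ) : AEStronglyMeasurable (expI n) freq :=
  (continuous_expI n).aestronglyMeasurable

theorem integral_freq_eq {E : Type*} [NormedAddCommGroup E] [NormedSpace ℝ E] (u : ℝ → E) :
    ∫ x, u x ∂freq = ∫ x in (-Real.pi)..Real.pi, u x := by
  rw [intervalIntegral.integral_of_le (by linarith [Real.pi_pos])]; rfl

theorem integral_expI (n : ℤ) :
    ∫ x, expI n x ∂freq = if n = 0 then (2 * Real.pi : ℂ) else 0 := by
  rw [integral_freq_eq]
  split_ifs with h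
  · subst h
    simp only [expI_zero, intervalIntegral.integral_const]
    rw [Complex.real_smul]; push_cast; ring
  · unfold expI
    have hn : (Complex.I * (n : ℂ)) ≠ 0 := by simp [h]
    rw [integral_exp_mul_complex hn]
    have : Complex.exp (Complex.I * n * ((Real.pi : ℝ) : ℂ)) =
        Complex.exp (Complex.I * n * ((-Real.pi : ℝ) : ℂ)) := by
      rw [Complex.exp_eq_exp_iff_exists_int]
      exact ⟨n, by push_cast; ring⟩
    rw [this]; simp

theorem Integrable.mul_expI {u : ℝ → ℂ} (hu : Integrable u freq) (n : ℤ) :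
    Integrable (fun x => u x * expI n x) freq :=
  hu.mul_bdd (c := 1) (aesm_expI n) (Eventually.of_forall fun x => (norm_expI n x).le)

/-- An integrable function all of whose Fourier coefficients vanish is zero almost everywhere. By
Stone–Weierstrass, it annihilates every smooth function supported inside `(-π, π)`. -/
theorem ae_eq_zero_of_fourier_eq_zero {u : ℝ → ℂ} (hu : Integrable u freq)
    (h : ∀ n : ℤ, ∫ x, u x * expI n x ∂freq = 0) : u =ᵐ[freq] 0 := by
  have hpi := Real.pi_pos
  have : Fact (0 < 2 * Real.pi) := ⟨by positivity⟩
  have hspan : ∀ G ∈ Submodule.span ℂ (Set.range (@fourier (2 * Real.pi))),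
      ∫ x, u x * G (x : AddCircle (2 * Real.pi)) ∂freq = 0 := by
    have hint (G : C(AddCircle (2 * Real.pi), ℂ)) :
        Integrable (fun x => u x * G (x : AddCircle (2 * Real.pi))) freq :=
      hu.mul_bdd (c := ‖G‖)
        (G.continuous.comp (AddCircle.continuous_mk' _)).aestronglyMeasurable
        (Eventually.of_forall fun x => G.norm_coe_le_norm _)
    intro G hG
    induction hG using Submodule.span_induction with
    | mem G hG =>
      obtain ⟨n, rfl⟩ := hG
      rw [← h n]
      congr 1; ext x
      rw [fourier_coe_apply, expI]
      congr 2
      have : (Real.pi : ℂ) ≠ 0 := by exact_mod_cast hpi.ne'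
      push_cast
      field_simp
    | zero => simp
    | add G G' _ _ h1 h2 =>
      simp only [ContinuousMap.add_apply, mul_add]
      rw [integral_add (hint G) (hint G'), h1, h2, add_zero]
    | smul c G _ h1 =>
      simp only [ContinuousMap.smul_apply, smul_eq_mul]
      simp_rw [mul_left_comm _ c]
      rw [integral_const_mul, h1, mul_zero]
  have hall : ∀ G : C(AddCircle (2 * Real.pi), ℂ),
      ∫ x, u x * G (x : AddCircle (2 * Real.pi)) ∂freq = 0 := by
    intro G
    have hG : G ∈ closure
        (Submodule.span ℂ (Set.range (@fourier (2 * Real.pi))) :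
          Set C(AddCircle (2 * Real.pi), ℂ)) := by
      rw [← Submodule.topologicalClosure_coe, span_fourier_closure_eq_top]; trivial
    have hint (G : C(AddCircle (2 * Real.pi), ℂ)) :
        Integrable (fun x => u x * G (x : AddCircle (2 * Real.pi))) freq :=
      hu.mul_bdd (c := ‖G‖)
        (G.continuous.comp (AddCircle.continuous_mk' _)).aestronglyMeasurable
        (Eventually.of_forall fun x => G.norm_coe_le_norm _)
    rw [← norm_le_zero_iff]
    refine le_of_forall_pos_le_add fun ε hε => ?_
    have hM : 0 ≤ ∫ x, ‖u x‖ ∂freq := integral_nonneg fun _ => norm_nonneg _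
    obtain ⟨G', hG', hd⟩ := Metric.mem_closure_iff.1 hG (ε / (∫ x, ‖u x‖ ∂freq + 1))
      (by positivity)
    have h0 := hspan G' hG'
    rw [← sub_zero (∫ x, u x * G (x : AddCircle (2 * Real.pi)) ∂freq), ← h0,
      ← integral_sub (hint G) (hint G')]
    calc ‖∫ x, (u x * G x - u x * G' x) ∂freq‖
        ≤ ∫ x, ‖u x‖ * (ε / (∫ x, ‖u x‖ ∂freq + 1)) ∂freq := by
          refine norm_integral_le_of_norm_le (hu.norm.mul_const _)
            (Eventually.of_forall fun x => ?_)
          rw [← mul_sub, norm_mul]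
          gcongr
          rw [← ContinuousMap.sub_apply]
          refine (ContinuousMap.norm_coe_le_norm _ _).trans ?_
          rw [← dist_eq_norm]; exact hd.le
      _ = (∫ x, ‖u x‖ ∂freq) * (ε / (∫ x, ‖u x‖ ∂freq + 1)) := integral_mul_const _ _
      _ ≤ 0 + ε := by
          rw [zero_add, mul_div_assoc', div_le_iff₀ (by positivity)]
          nlinarith
  have key : ∀ᵐ x ∂freq, x ∈ Set.Ioo (-Real.pi) Real.pi → u x = 0 := by
    refine IsOpen.ae_eq_zero_of_integral_contDiff_smul_eq_zero isOpen_Ioo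
      (hu.locallyIntegrable.locallyIntegrableOn _) fun g hg _ hsupp => ?_
    have hz : ∀ x, x ∉ Set.Ioo (-Real.pi) Real.pi → g x = 0 := fun x hx =>
      image_eq_zero_of_notMem_tsupport fun h => hx (hsupp h)
    let G : C(AddCircle (2 * Real.pi), ℂ) :=
      ⟨AddCircle.liftIco (2 * Real.pi) (-Real.pi) fun x => (g x : ℂ),
        AddCircle.liftIco_continuous
          (by rw [hz _ (by simp), hz _ (by simp; intro; linarith)])
          (Complex.continuous_ofReal.comp hg.continuous).continuousOn⟩
    rw [← hall G]
    unfold freq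
    rw [← integral_Ico_eq_integral_Ioc, ← integral_Ico_eq_integral_Ioc]
    refine setIntegral_congr_fun measurableSet_Ico fun x hx => ?_
    have : G (x : AddCircle (2 * Real.pi)) = (g x : ℂ) :=
      AddCircle.liftIco_coe_apply (f := fun x => (g x : ℂ)) (by
        rwa [show -Real.pi + 2 * Real.pi = Real.pi by ring])
    simp only [this, Complex.real_smul]
    ring
  have hne : ∀ᵐ x ∂freq, x ∈ Set.Ioo (-Real.pi) Real.pi := by
    have h1 : ∀ᵐ x ∂freq, x ∈ Set.Ioc (-Real.pi) Real.pi := ae_restrict_mem measurableSet_Ioc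
    have h2 : ∀ᵐ x ∂freq, x ≠ Real.pi :=
      ae_restrict_of_ae (Measure.ae_ne volume Real.pi)
    filter_upwards [h1, h2] with x hx hx'
    exact ⟨hx.1, lt_of_le_of_ne hx.2 hx'⟩
  filter_upwards [key, hne] with x hx hx' using hx hx'

/-! ### Smirnov's theorem for sums of products -/

theorem inner_toLp_toLp {f g : ℝ → ℂ} (hf : MemLp f 2 freq) (hg : MemLp g 2 freq) :
    inner ℂ (hf.toLp f) (hg.toLp g) = ∫ x, star (f x) * g x ∂freq := by
  rw [L2.inner_def]
  refine integral_congr_ae ?_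
  filter_upwards [hf.coeFn_toLp, hg.coeFn_toLp] with x h1 h2
  rw [h1, h2, RCLike.inner_apply, mul_comm]; rfl

theorem MemLp.mul_expI {u : ℝ → ℂ} (hu : MemLp u 2 freq) (n : ℤ) :
    MemLp (fun x => u x * expI n x) 2 freq :=
  hu.of_le (hu.1.mul (aesm_expI n)) (Eventually.of_forall fun x => by
    rw [norm_mul, norm_expI, mul_one])

theorem MemLp.integrable_mul' {u v : ℝ → ℂ} (hu : MemLp u 2 freq) (hv : MemLp v 2 freq) :
    Integrable (fun x => u x * v x) freq :=
  hu.integrable_mul hv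

/-- Orthogonal projection onto the closed span of a family in `L²`, in terms of functions. -/
theorem exists_projection {ι : Type*} (φ : ι → ℝ → ℂ) (hφ : ∀ i, MemLp (φ i) 2 freq)
    {f : ℝ → ℂ} (hf : MemLp f 2 freq) :
    ∃ p : ℝ → ℂ, MemLp p 2 freq ∧ (∀ i, ∫ x, (f x - p x) * star (φ i x) ∂freq = 0) ∧
      ∀ g : ℝ → ℂ, MemLp g 2 freq → (∀ i, ∫ x, g x * φ i x ∂freq = 0) →
        ∫ x, g x * p x ∂freq = 0 := by
  set X := (Submodule.span ℂ (Set.range fun i => (hφ i).toLp (φ i))).topologicalClosure with hX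
  have : CompleteSpace X := (Submodule.isClosed_topologicalClosure _).completeSpace_coe
  have hmem (i : ι) : (hφ i).toLp (φ i) ∈ X :=
    Submodule.le_topologicalClosure _ (Submodule.subset_span ⟨i, rfl⟩)
  set P := X.starProjection (hf.toLp f)
  have hP : MemLp (P : ℝ → ℂ) 2 freq := Lp.memLp P
  have hPt : hP.toLp _ = P := Lp.toLp_coeFn P hP
  refine ⟨P, hP, fun i => ?_, fun g hg h => ?_⟩
  · have h := (Submodule.mem_orthogonal X _).1
      (Submodule.sub_starProjection_mem_orthogonal (K := X) (hf.toLp f)) _ (hmem i)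
    rw [show X.starProjection (hf.toLp f) = hP.toLp _ from hPt.symm, ← MemLp.toLp_sub,
      inner_toLp_toLp] at h
    rw [← h]
    congr 1; ext x; simp [mul_comm]
  · have hg' : MemLp (fun x => star (g x)) 2 freq := hg.star
    have h1 : hg'.toLp _ ∈ Xᗮ := by
      rw [hX, Submodule.orthogonal_closure, Submodule.mem_orthogonal']
      intro y hy
      induction hy using Submodule.span_induction with
      | mem y hy =>
        obtain ⟨i, rfl⟩ := hy
        rw [inner_toLp_toLp]
        simpa using h i
      | zero => simp
      | add a b _ _ ha hb => rw [inner_add_right, ha, hb, add_zero]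
      | smul c a _ ha => rw [inner_smul_right, ha, mul_zero]
    have h2 := (Submodule.mem_orthogonal' X _).1 h1 P (Submodule.starProjection_apply_mem X _)
    rw [← hPt, inner_toLp_toLp] at h2
    simpa using h2

theorem integral_star {u : ℝ → ℂ} : ∫ x, star (u x) ∂freq = star (∫ x, u x ∂freq) :=
  integral_conj

/-- The integral of a product of two square integrable functions of analytic type, the second of
mean zero, vanishes. -/
theorem integral_mul_eq_zero_of_analytic {U V : ℝ → ℂ} (hU : MemLp U 2 freq)
    (hV : MemLp V 2 freq) (hUm : ∀ m : ℕ, 1 ≤ m → ∫ x, U x * expI m x ∂freq = 0)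
    (hVm : ∀ m : ℕ, ∫ x, V x * expI m x ∂freq = 0) : ∫ x, V x * U x ∂freq = 0 := by
  have hφ (m : ℕ) : MemLp (expI m) 2 freq :=
    MemLp.of_bound (aesm_expI m) 1 (Eventually.of_forall fun x => (norm_expI _ x).le)
  obtain ⟨p, hp, h1, h2⟩ := exists_projection (fun m : ℕ => expI m) hφ hU
  have h3 : (fun x => U x - p x) =ᵐ[freq] 0 := by
    refine ae_eq_zero_of_fourier_eq_zero ((hU.sub hp).integrable (by norm_num)) fun n => ?_
    rcases le_or_gt n 0 with hn | hn
    · obtain ⟨m, rfl⟩ := Int.exists_eq_neg_ofNat hn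
      simpa [star_expI] using h1 m
    · obtain ⟨m, rfl⟩ := Int.eq_ofNat_of_zero_le hn.le
      have hm : 1 ≤ m := by omega
      have hpm : ∫ x, expI m x * p x ∂freq = 0 := by
        refine h2 _ (hφ m) fun l => ?_
        simp_rw [← expI_add]
        rw [integral_expI, if_neg (by omega)]
      simp_rw [sub_mul]
      rw [integral_sub (MemLp.integrable_mul' hU (hφ m)) (MemLp.integrable_mul' hp (hφ m)),
        hUm m hm, zero_sub, neg_eq_zero, ← hpm]
      simp_rw [mul_comm]
  rw [← h2 V hV hVm]
  refine integral_congr_ae ?_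
  filter_upwards [h3] with x hx
  rw [sub_eq_zero.1 hx]

/-- Szegő's extremal function for the weight `1 + ε w`: a function `ψ` of analytic type and mean
one with `|ψ|² (1 + ε w)` constant. It is bounded, close to `1` for small `ε`, and multiplication by
`ψ` preserves the analytic functions dominated by `w`. -/
theorem exists_multiplier {w : ℝ → ℝ} (hw : Integrable w freq) (hw0 : ∀ x, 0 ≤ w x)
    {ε : ℝ} (hε : 0 < ε) :
    ∃ (ψ : ℝ → ℂ) (c : ℝ), AEStronglyMeasurable ψ freq ∧
      (∀ᵐ x ∂freq, ‖ψ x‖ ^ 2 * (1 + ε * w x) = c) ∧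
      2 * Real.pi * c ≤ 2 * Real.pi + ε * ∫ x, w x ∂freq ∧
      ∫ x, ‖ψ x - 1‖ ^ 2 ∂freq ≤ ε * ∫ x, w x ∂freq ∧
      ∀ u : ℝ → ℂ, Integrable u freq → (∀ x, ‖u x‖ ≤ w x) → ∀ k : ℕ,
        (∀ m : ℕ, k ≤ m → ∫ x, u x * expI m x ∂freq = 0) →
        MemLp (fun x => ψ x * u x) 2 freq ∧
        ∀ m : ℕ, k ≤ m → ∫ x, ψ x * u x * expI m x ∂freq = 0 := by
  set σ : ℝ → ℝ := fun x => Real.sqrt (1 + ε * w x) with hσ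
  have hpos (x : ℝ) : 1 ≤ 1 + ε * w x := by have := mul_nonneg hε.le (hw0 x); linarith
  have hσsq (x : ℝ) : σ x ^ 2 = 1 + ε * w x := Real.sq_sqrt (by linarith [hpos x])
  have hσ1 (x : ℝ) : 1 ≤ σ x := Real.one_le_sqrt.2 (hpos x)
  have hσ0 (x : ℝ) : (σ x : ℂ) ≠ 0 := by
    have := hσ1 x
    exact_mod_cast (by linarith : σ x ≠ 0)
  have hσmeas : AEStronglyMeasurable σ freq :=
    Real.continuous_sqrt.comp_aestronglyMeasurable
      (aestronglyMeasurable_const.add (hw.1.const_mul ε))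
  have hσC : AEStronglyMeasurable (fun x => (σ x : ℂ)) freq :=
    Complex.continuous_ofReal.comp_aestronglyMeasurable hσmeas
  have hσi : Integrable (fun x => σ x ^ 2) freq := by
    simp_rw [hσsq]; exact (integrable_const _).add (hw.const_mul ε)
  have hσL : MemLp (fun x => (σ x : ℂ)) 2 freq := by
    rw [memLp_two_iff_integrable_sq_norm hσC]
    simpa [sq_abs] using hσi
  obtain ⟨p, hp, h1, h2⟩ := exists_projection (fun (m : ℕ) x => (σ x : ℂ) * expI (m + 1 : ℕ) x)
    (fun m => MemLp.mul_expI hσL _) hσL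
  set y : ℝ → ℂ := fun x => (σ x : ℂ) - p x with hy
  have hyL : MemLp y 2 freq := hσL.sub hp
  have hysL : MemLp (fun x => star (y x)) 2 freq := hyL.star
  -- a functional that kills the generators takes the same value on `y` and on `σ`
  have h2' : ∀ g : ℝ → ℂ, MemLp g 2 freq →
      (∀ m : ℕ, 1 ≤ m → ∫ x, g x * ((σ x : ℂ) * expI m x) ∂freq = 0) →
      ∫ x, g x * y x ∂freq = ∫ x, g x * (σ x : ℂ) ∂freq := by
    intro g hg h
    simp_rw [hy, mul_sub]
    rw [integral_sub (MemLp.integrable_mul' hg hσL) (MemLp.integrable_mul' hg hp),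
      h2 g hg (fun m => h (m + 1) (by omega)), sub_zero]
  have horth : ∀ m : ℕ, 1 ≤ m → ∫ x, star (y x) * ((σ x : ℂ) * expI m x) ∂freq = 0 := by
    intro m hm
    obtain ⟨l, rfl⟩ : ∃ l, m = l + 1 := ⟨m - 1, by omega⟩
    have := congrArg star (h1 l)
    rw [← integral_star, star_zero] at this
    rw [← this]
    congr 1; ext x; simp [hy]
  have hsq (x : ℝ) : star (y x) * y x = ((‖y x‖ ^ 2 : ℝ) : ℂ) := by
    rw [← starRingEnd_apply, Complex.conj_mul']; push_cast; rfl
  have hyi : Integrable (fun x => ‖y x‖ ^ 2) freq := (memLp_two_iff_integrable_sq_norm hyL.1).1 hyL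
  have hyσ : ∫ x, star (y x) * (σ x : ℂ) ∂freq = ((∫ x, ‖y x‖ ^ 2 ∂freq : ℝ) : ℂ) := by
    rw [← h2' _ hysL horth]
    simp_rw [hsq]
    exact integral_ofReal
  -- all nonzero Fourier coefficients of `|y|²` vanish
  have hcoef : ∀ m : ℕ, 1 ≤ m → ∫ x, ((‖y x‖ ^ 2 : ℝ) : ℂ) * expI m x ∂freq = 0 := by
    intro m hm
    have h := h2' (fun x => star (y x) * expI m x) (MemLp.mul_expI hysL m) (fun l hl => by
      rw [← horth (m + l) (by omega)]
      congr 1; ext x; push_cast; rw [expI_add]; ring)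
    rw [show (∫ x, (fun x => star (y x) * expI m x) x * (σ x : ℂ) ∂freq) = 0 by
      rw [← horth m hm]; congr 1; ext x; ring] at h
    rw [← h]
    congr 1; ext x; rw [← hsq]; ring
  set c : ℝ := (∫ x, ‖y x‖ ^ 2 ∂freq) / (2 * Real.pi) with hc
  have hpi := Real.pi_pos
  have hc' : 2 * Real.pi * c = ∫ x, ‖y x‖ ^ 2 ∂freq := by rw [hc]; field_simp
  have hconst : ∀ᵐ x ∂freq, ‖y x‖ ^ 2 = c := by
    have h0 : (fun x => ((‖y x‖ ^ 2 : ℝ) : ℂ) - (c : ℂ)) =ᵐ[freq] 0 := by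
      refine ae_eq_zero_of_fourier_eq_zero (hyi.ofReal.sub (integrable_const _)) fun n => ?_
      have hi1 := Integrable.mul_expI hyi.ofReal n (u := fun x => ((‖y x‖ ^ 2 : ℝ) : ℂ))
      have hi2 := Integrable.mul_expI (integrable_const (c : ℂ)) n
      simp_rw [sub_mul]
      rw [integral_sub hi1 hi2, integral_const_mul, integral_expI]
      rcases lt_trichotomy n 0 with hn | hn | hn
      · obtain ⟨m, rfl⟩ := Int.exists_eq_neg_ofNat hn.le
        rw [if_neg hn.ne, mul_zero, sub_zero]
        have := congrArg star (hcoef m (by omega))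
        rw [← integral_star, star_zero] at this
        rw [← this]
        congr 1; ext x
        rw [star_mul', star_expI]
        congr 1
        exact (Complex.conj_ofReal _).symm
      · subst hn
        simp only [expI_zero, mul_one, if_true]
        rw [integral_complex_ofReal, ← hc']
        push_cast; ring
      · obtain ⟨m, rfl⟩ := Int.eq_ofNat_of_zero_le hn.le
        rw [if_neg hn.ne', mul_zero, sub_zero, hcoef m (by omega)]
    filter_upwards [h0] with x hx
    exact_mod_cast sub_eq_zero.1 hx
  have hσint : ∫ x, σ x ^ 2 ∂freq = 2 * Real.pi + ε * ∫ x, w x ∂freq := by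
    simp_rw [hσsq]
    rw [integral_add (integrable_const _) (hw.const_mul ε), integral_const_mul, integral_const]
    simp [freq, Measure.real]
    rw [ENNReal.toReal_ofReal (by linarith)]; ring
  have hcle : 2 * Real.pi * c ≤ 2 * Real.pi + ε * ∫ x, w x ∂freq := by
    rw [← hσint, hc']
    have hnn : 0 ≤ ∫ x, ‖y x - (σ x : ℂ)‖ ^ 2 ∂freq := integral_nonneg fun _ => sq_nonneg _
    have hexp (x : ℝ) : ‖y x - (σ x : ℂ)‖ ^ 2 =
        ‖y x‖ ^ 2 + σ x ^ 2 - 2 * (star (y x) * (σ x : ℂ)).re := by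
      simp only [Complex.sq_norm, Complex.normSq_apply, Complex.mul_re, Complex.sub_re,
        Complex.sub_im, Complex.ofReal_re, Complex.ofReal_im, Complex.star_def, Complex.conj_re,
        Complex.conj_im]
      ring
    have hire : Integrable (fun x => (star (y x) * (σ x : ℂ)).re) freq :=
      (MemLp.integrable_mul' hysL hσL).re
    have hadd : Integrable (fun x => ‖y x‖ ^ 2 + σ x ^ 2) freq := hyi.add hσi
    simp_rw [hexp] at hnn
    rw [integral_sub hadd (hire.const_mul 2), integral_add hyi hσi, integral_const_mul] at hnn
    have : ∫ x, (star (y x) * (σ x : ℂ)).re ∂freq = ∫ x, ‖y x‖ ^ 2 ∂freq := by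
      have := integral_re (MemLp.integrable_mul' hysL hσL)
      rw [hyσ] at this
      simpa using this
    linarith
  set ψ : ℝ → ℂ := fun x => y x / (σ x : ℂ) with hψ
  have hψm : AEStronglyMeasurable ψ freq := hyL.1.div₀ hσC
  have hψy (x : ℝ) : ‖ψ x‖ ^ 2 * σ x ^ 2 = ‖y x‖ ^ 2 := by
    rw [hψ]
    simp only [norm_div, div_pow, Complex.norm_real, Real.norm_eq_abs, sq_abs]
    rw [div_mul_cancel₀]
    have := hσ1 x; positivity
  have hinv : MemLp (fun x => (σ x : ℂ)⁻¹) 2 freq :=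
    MemLp.of_bound hσC.inv₀ 1 (Eventually.of_forall fun x => by
      rw [norm_inv, Complex.norm_real, Real.norm_eq_abs, abs_of_pos (by linarith [hσ1 x])]
      exact inv_le_one_of_one_le₀ (hσ1 x))
  have hψL : MemLp ψ 2 freq := hyL.of_le hψm (Eventually.of_forall fun x => by
    rw [hψ, norm_div, Complex.norm_real, Real.norm_eq_abs, abs_of_pos (by linarith [hσ1 x])]
    exact div_le_self (norm_nonneg _) (hσ1 x))
  have hmean : ∫ x, ψ x ∂freq = 2 * Real.pi := by
    have h := h2' _ hinv (fun m hm => by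
      simp_rw [← mul_assoc, inv_mul_cancel₀ (hσ0 _), one_mul]
      rw [integral_expI, if_neg (by omega)])
    simp_rw [inv_mul_cancel₀ (hσ0 _)] at h
    rw [show (∫ x, ψ x ∂freq) = ∫ x, (σ x : ℂ)⁻¹ * y x ∂freq by
      congr 1; ext x; rw [hψ]; simp only; ring, h]
    have := integral_expI 0
    simpa [expI_zero] using this
  refine ⟨ψ, c, hψm, ?_, hcle, ?_, ?_⟩
  · filter_upwards [hconst] with x hx
    rw [← hσsq, hψy, hx]
  · have hψi : Integrable (fun x => ‖ψ x‖ ^ 2) freq :=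
      (memLp_two_iff_integrable_sq_norm hψm).1 hψL
    have hexp (x : ℝ) : ‖ψ x - 1‖ ^ 2 = ‖ψ x‖ ^ 2 + 1 - 2 * (ψ x).re := by
      simp only [Complex.sq_norm, Complex.normSq_apply, Complex.sub_re, Complex.sub_im,
        Complex.one_re, Complex.one_im]
      ring
    have hψ1 : Integrable ψ freq := hψL.integrable (by norm_num)
    simp_rw [hexp]
    have hre : ∫ x, (ψ x).re ∂freq = 2 * Real.pi := by
      have := integral_re hψ1
      rw [hmean] at this
      simpa using this
    have hone : ∫ _x : ℝ, (1 : ℝ) ∂freq = 2 * Real.pi := by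
      simp [freq, Measure.real]
      rw [ENNReal.toReal_ofReal (by linarith)]; ring
    have hle : ∫ x, ‖ψ x‖ ^ 2 ∂freq ≤ ∫ x, ‖y x‖ ^ 2 ∂freq :=
      integral_mono hψi hyi fun x => by
        simp only
        rw [← hψy x]
        exact le_mul_of_one_le_right (sq_nonneg _) (by nlinarith [hσ1 x])
    have hadd : Integrable (fun x => ‖ψ x‖ ^ 2 + 1) freq := hψi.add (integrable_const _)
    have hre' : Integrable (fun x => (ψ x).re) freq := hψ1.re
    rw [integral_sub hadd (hre'.const_mul 2), integral_add hψi (integrable_const _),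
      integral_const_mul, hone, hre]
    linarith
  · intro u hu huw k huk
    -- `|u|² / σ² ≤ |u| w / (1 + ε w) ≤ |u| / ε`
    have hbd (x : ℝ) : ‖u x / (σ x : ℂ)‖ ^ 2 ≤ ε⁻¹ * ‖u x‖ := by
      rw [norm_div, div_pow, Complex.norm_real, Real.norm_eq_abs, sq_abs, hσsq,
        div_le_iff₀ (by linarith [hpos x]), mul_assoc, ← div_eq_inv_mul, le_div_iff₀ hε]
      have h3 := huw x
      have h4 := norm_nonneg (u x)
      nlinarith [mul_le_mul_of_nonneg_left h3 (mul_nonneg hε.le h4)]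
    have hgL : MemLp (fun x => u x / (σ x : ℂ)) 2 freq := by
      have hm : AEStronglyMeasurable (fun x => u x / (σ x : ℂ)) freq := hu.1.div₀ hσC
      rw [memLp_two_iff_integrable_sq_norm hm]
      exact (hu.norm.const_mul ε⁻¹).mono' (hm.norm.pow 2) (Eventually.of_forall fun x => by
        rw [Real.norm_eq_abs, abs_of_nonneg (sq_nonneg _)]; exact hbd x)
    refine ⟨?_, fun m hm => ?_⟩
    · refine (hgL.const_mul (Real.sqrt c : ℂ)).of_le (hψm.mul hu.1) ?_
      filter_upwards [hconst] with x hx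
      rw [norm_mul, norm_mul, Complex.norm_real, Real.norm_of_nonneg (Real.sqrt_nonneg _), ← hx,
        Real.sqrt_sq (norm_nonneg _), hψ]
      simp only [norm_div]
      apply le_of_eq; ring
    · have hg2 := MemLp.mul_expI hgL m
      have h := h2' _ hg2 (fun l _ => by
        rw [← huk (m + l) (by omega)]
        congr 1; ext x; push_cast; rw [expI_add]; field_simp [hσ0 x])
      rw [show (∫ x, ψ x * u x * expI m x ∂freq) =
        ∫ x, u x / (σ x : ℂ) * expI m x * y x ∂freq by
          congr 1; ext x; rw [hψ]; simp only; ring, h, ← huk m hm]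
      congr 1; ext x; field_simp [hσ0 x]

/-- Smirnov's theorem for a sum of products: if `u i` and `v i` are integrable and of analytic type,
the `v i` of mean zero, and `∑ i, u i * v i` is integrable, then its integral is zero, although the
single products need not be integrable. Multiplication by the square of Szegő's extremal function
makes every product integrable, and these squares tend boundedly to `1`. -/
theorem integral_sum_mul_eq_zero_of_analytic {ι : Type*} [Fintype ι] {u v : ι → ℝ → ℂ}
    (hu : ∀ i, Integrable (u i) freq) (hv : ∀ i, Integrable (v i) freq)
    (hum : ∀ i, ∀ m : ℕ, 1 ≤ m → ∫ x, u i x * expI m x ∂freq = 0)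
    (hvm : ∀ i, ∀ m : ℕ, ∫ x, v i x * expI m x ∂freq = 0)
    (huv : Integrable (fun x => ∑ i, u i x * v i x) freq) :
    ∫ x, ∑ i, u i x * v i x ∂freq = 0 := by
  set w : ℝ → ℝ := fun x => ∑ i, (‖u i x‖ + ‖v i x‖) with hw
  have hwi : Integrable w freq := integrable_finsetSum _ fun i _ => (hu i).norm.add (hv i).norm
  have hw0 (x : ℝ) : 0 ≤ w x := Finset.sum_nonneg fun i _ => by positivity
  have huw (i : ι) (x : ℝ) : ‖u i x‖ ≤ w x :=
    (le_add_of_nonneg_right (norm_nonneg _)).trans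
      (Finset.single_le_sum (f := fun i => ‖u i x‖ + ‖v i x‖) (fun i _ => by positivity)
        (Finset.mem_univ i))
  have hvw (i : ι) (x : ℝ) : ‖v i x‖ ≤ w x :=
    (le_add_of_nonneg_left (norm_nonneg _)).trans
      (Finset.single_le_sum (f := fun i => ‖u i x‖ + ‖v i x‖) (fun i _ => by positivity)
        (Finset.mem_univ i))
  have hW : 0 ≤ ∫ x, w x ∂freq := integral_nonneg hw0
  have hε (n : ℕ) : (0 : ℝ) < 1 / ((n : ℝ) + 1) := by positivity
  choose ψ c hψm hψc hc hψ1 hψu using fun n : ℕ => exists_multiplier hwi hw0 (hε n)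
  have hpi := Real.pi_gt_three
  have hcb (n : ℕ) : c n ≤ 1 + ∫ x, w x ∂freq := by
    have h1 : 1 / ((n : ℝ) + 1) * ∫ x, w x ∂freq ≤ ∫ x, w x ∂freq :=
      mul_le_of_le_one_left hW (by
        rw [div_le_one (by positivity)]; linarith [n.cast_nonneg (α := ℝ)])
    have h2 := hc n
    nlinarith
  have hψb (n : ℕ) : ∀ᵐ x ∂freq, ‖ψ n x‖ ^ 2 ≤ 1 + ∫ x, w x ∂freq := by
    filter_upwards [hψc n] with x hx
    refine le_trans ?_ (hcb n)
    rw [← hx]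
    have := mul_nonneg (hε n).le (hw0 x)
    exact le_mul_of_one_le_right (sq_nonneg _) (by linarith)
  have hψL (n : ℕ) : MemLp (fun x => ψ n x - 1) 2 freq := by
    refine MemLp.sub ?_ (memLp_const _)
    refine MemLp.of_bound (hψm n) (Real.sqrt (1 + ∫ x, w x ∂freq)) ?_
    filter_upwards [hψb n] with x hx
    exact Real.le_sqrt_of_sq_le hx
  have hzero (n : ℕ) : ∫ x, ψ n x ^ 2 * ∑ i, u i x * v i x ∂freq = 0 := by
    have hi (i : ι) := hψu n (u i) (hu i) (huw i) 1 (hum i)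
    have hj (i : ι) := hψu n (v i) (hv i) (hvw i) 0 (fun m _ => hvm i m)
    rw [show (∫ x, ψ n x ^ 2 * ∑ i, u i x * v i x ∂freq) =
        ∫ x, ∑ i, (ψ n x * v i x) * (ψ n x * u i x) ∂freq by
      congr 1; ext x; rw [Finset.mul_sum]; exact Finset.sum_congr rfl fun i _ => by ring]
    rw [integral_finsetSum _ fun i _ => MemLp.integrable_mul' (hj i).1 (hi i).1]
    exact Finset.sum_eq_zero fun i _ => integral_mul_eq_zero_of_analytic (hi i).1 (hj i).1
      (hi i).2 (fun m => (hj i).2 m (Nat.zero_le _))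
  have hmeas : TendstoInMeasure freq (fun n x => ‖ψ n x - 1‖ ^ 2) atTop (fun _ => 0) := by
    refine tendstoInMeasure_of_tendsto_eLpNorm (p := 1) one_ne_zero
      (fun n => (hψL n).1.norm.pow 2) aestronglyMeasurable_const ?_
    have hle : ∀ n : ℕ, eLpNorm ((fun x => ‖ψ n x - 1‖ ^ 2) - fun _ => 0) 1 freq ≤
        ENNReal.ofReal (1 / ((n : ℝ) + 1) * ∫ x, w x ∂freq) := by
      intro n
      have hin := (memLp_two_iff_integrable_sq_norm (hψL n).1).1 (hψL n)
      rw [eLpNorm_one_eq_lintegral_enorm]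
      simp only [Pi.sub_apply, sub_zero]
      rw [← ofReal_integral_norm_eq_lintegral_enorm hin]
      refine ENNReal.ofReal_le_ofReal ?_
      simpa [abs_of_nonneg] using hψ1 n
    have hlim : Tendsto (fun n : ℕ => ENNReal.ofReal (1 / ((n : ℝ) + 1) * ∫ x, w x ∂freq))
        atTop (𝓝 0) := by
      have := ENNReal.tendsto_ofReal
        ((tendsto_one_div_add_atTop_nhds_zero_nat (𝕜 := ℝ)).mul_const (∫ x, w x ∂freq))
      simpa using this
    exact tendsto_of_tendsto_of_tendsto_of_le_of_le tendsto_const_nhds hlim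
      (fun _ => zero_le) hle
  obtain ⟨ns, -, hns⟩ := hmeas.exists_seq_tendsto_ae
  have hlim : Tendsto (fun k => ∫ x, ψ (ns k) x ^ 2 * ∑ i, u i x * v i x ∂freq) atTop
      (𝓝 (∫ x, ∑ i, u i x * v i x ∂freq)) := by
    refine tendsto_integral_of_dominated_convergence
      (fun x => (1 + ∫ x, w x ∂freq) * ‖∑ i, u i x * v i x‖)
      (fun k => ((hψm _).pow 2).mul huv.1) (huv.norm.const_mul _) (fun k => ?_) ?_
    · filter_upwards [hψb (ns k)] with x hx
      rw [norm_mul, norm_pow]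
      gcongr
    · filter_upwards [hns] with x hx
      have h1 : Tendsto (fun k => ψ (ns k) x - 1) atTop (𝓝 0) := by
        rw [tendsto_zero_iff_norm_tendsto_zero]
        have := (Real.continuous_sqrt.tendsto 0).comp hx
        simpa [Function.comp_def, Real.sqrt_sq] using this
      have h2 : Tendsto (fun k => ψ (ns k) x) atTop (𝓝 1) := by
        simpa using h1.add_const 1
      simpa using (h2.pow 2).mul_const (∑ i, u i x * v i x)
  simp_rw [hzero] at hlim
  exact (tendsto_nhds_unique hlim tendsto_const_nhds)

theorem integral_mul_star_expI {u : ℝ → ℂ} (n : ℤ) :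
    ∫ x, star (u x) * expI n x ∂freq = star (∫ x, u x * expI (-n) x ∂freq) := by
  rw [← integral_star]
  congr 1; ext x; rw [star_mul', star_expI, neg_neg]

theorem integrable_star {u : ℝ → ℂ} (hu : Integrable u freq) :
    Integrable (fun x => star (u x)) freq :=
  (integrable_norm_iff hu.1.star).1 (by simpa using hu.norm)

theorem integrable_expI (n : ℤ) : Integrable (expI n) freq := by
  simpa using Integrable.mul_expI (integrable_const (1 : ℂ)) n

/-- If `h` has no Fourier coefficients in `G` and `C` has none outside `G`, where `G` consists of
the nonnegative integers and finitely many negative ones, then `h` and `C` are orthogonal as soon as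
`h ⬝ᵥ star C` is integrable. -/
theorem integral_dotProduct_star_eq_zero {T : ℕ} {G : Set ℤ} (hG : ∀ n : ℤ, 0 ≤ n → n ∈ G)
    (hfin : (G ∩ {n | n < 0}).Finite) {h C : VecFun T}
    (hh : ∀ ν, Integrable (fun x => h x ν) freq) (hC : ∀ ν, Integrable (fun x => C x ν) freq)
    (hhG : ∀ n ∈ G, ∀ ν, ∫ x, h x ν * expI (-n) x ∂freq = 0)
    (hCG : ∀ n ∉ G, ∀ ν, ∫ x, C x ν * expI (-n) x ∂freq = 0)
    (hint : Integrable (fun x => h x ⬝ᵥ star (C x)) freq) :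
    ∫ x, h x ⬝ᵥ star (C x) ∂freq = 0 := by
  set s : Finset ℤ := hfin.toFinset with hs
  have hmem (n : ℤ) : n ∈ s ↔ n ∈ G ∧ n < 0 := by simp [hs]
  set d : Fin T → ℤ → ℂ := fun ν k => (∫ x, C x ν * expI (-k) x ∂freq) / (2 * Real.pi) with hd
  -- `Q` is the part of `C` with negative frequencies
  set Q : Fin T → ℝ → ℂ := fun ν x => ∑ k ∈ s, d ν k * expI k x with hQ
  have hQi (ν : Fin T) : Integrable (Q ν) freq :=
    integrable_finsetSum _ fun k _ => (integrable_expI k).const_mul _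
  have hpi : (Real.pi : ℂ) ≠ 0 := by exact_mod_cast Real.pi_ne_zero
  have hstar (ν : Fin T) (m : ℤ) (hm : m ∈ G) : ∫ x, star (h x ν) * expI m x ∂freq = 0 := by
    rw [integral_mul_star_expI, hhG m hm, star_zero]
  have hQb (ν : Fin T) (x : ℝ) : ‖Q ν x‖ ≤ ∑ k ∈ s, ‖d ν k‖ := by
    refine (norm_sum_le _ _).trans (Finset.sum_le_sum fun k _ => ?_)
    rw [norm_mul, norm_expI, mul_one]
  have hprod (ν : Fin T) : Integrable (fun x => Q ν x * star (h x ν)) freq := by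
    simpa [mul_comm] using (integrable_star (hh ν)).mul_bdd (c := ∑ k ∈ s, ‖d ν k‖) (hQi ν).1
      (Eventually.of_forall (hQb ν))
  have hQh (ν : Fin T) : ∫ x, Q ν x * star (h x ν) ∂freq = 0 := by
    simp_rw [hQ, Finset.sum_mul]
    have he (k : ℤ) : (fun x => d ν k * expI k x * star (h x ν)) =
        fun x => d ν k * (star (h x ν) * expI k x) := by ext x; ring
    rw [integral_finsetSum _ fun k _ => by
      rw [he]; exact (Integrable.mul_expI (integrable_star (hh ν)) k).const_mul _]
    refine Finset.sum_eq_zero fun k hk => ?_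
    rw [he, integral_const_mul, hstar ν k ((hmem k).1 hk).1, mul_zero]
  have hsplit (x : ℝ) : ∑ ν, (C x ν - Q ν x) * star (h x ν) =
      star (h x ⬝ᵥ star (C x)) - ∑ ν, Q ν x * star (h x ν) := by
    simp only [dotProduct, sub_mul, Finset.sum_sub_distrib, star_sum, star_mul', Pi.star_apply,
      star_star]
    congr 1
    exact Finset.sum_congr rfl fun ν _ => mul_comm _ _
  have hsumi : Integrable (fun x => ∑ ν, Q ν x * star (h x ν)) freq :=
    integrable_finsetSum _ fun ν _ => hprod ν
  have hkey : ∫ x, ∑ ν, (C x ν - Q ν x) * star (h x ν) ∂freq = 0 := by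
    refine integral_sum_mul_eq_zero_of_analytic (fun ν => (hC ν).sub (hQi ν))
      (fun ν => integrable_star (hh ν)) (fun ν m hm => ?_)
      (fun ν m => hstar ν m (hG _ (by omega))) ?_
    · simp_rw [sub_mul]
      rw [integral_sub (Integrable.mul_expI (hC ν) m) (Integrable.mul_expI (hQi ν) m)]
      have hterm : ∫ x, Q ν x * expI m x ∂freq =
          ∑ k ∈ s, if k = -(m : ℤ) then ∫ x, C x ν * expI m x ∂freq else 0 := by
        simp_rw [hQ, Finset.sum_mul, mul_assoc, ← expI_add]
        rw [integral_finsetSum _ fun k _ => (integrable_expI _).const_mul _]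
        refine Finset.sum_congr rfl fun k _ => ?_
        rw [integral_const_mul, integral_expI]
        by_cases hk : k = -(m : ℤ)
        · rw [if_pos (by omega), if_pos hk, hd]
          simp only [hk, neg_neg]
          field_simp
        · rw [if_neg (by omega), if_neg hk, mul_zero]
      rw [hterm, Finset.sum_ite_eq' s]
      split_ifs with hms
      · exact sub_self _
      · rw [sub_zero]
        have : -(m : ℤ) ∉ G := fun hmG => hms ((hmem _).2 ⟨hmG, by omega⟩)
        simpa using hCG _ this ν
    · simp_rw [hsplit]
      exact (integrable_star hint).sub hsumi
  simp_rw [hsplit] at hkey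
  rw [integral_sub (integrable_star hint) hsumi, integral_finsetSum _ fun ν _ => hprod ν,
    Finset.sum_eq_zero fun ν _ => hQh ν, sub_zero, integral_star] at hkey
  simpa using hkey

/-! ### The observation pattern -/

theorem unobserved_of_nonneg {s : ℕ} {N K : ℕ → ℕ} {n : ℤ} (hn : 0 ≤ n) :
    n ∈ unobserved s N K := Or.inr hn

theorem finite_unobserved_neg (s : ℕ) (N K : ℕ → ℕ) :
    (unobserved s N K ∩ {n | n < 0}).Finite := by
  refine Set.Finite.subset ((Set.finite_lt_nat s).biUnion fun l _ =>
    Set.finite_Icc (-(patternSum N K (l + 1) : ℤ))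
      (-(patternSum N K l : ℤ) - (N (l + 1) : ℤ) - 1)) ?_
  rintro n ⟨h | h, hn⟩
  · obtain ⟨l, hl, h1, h2⟩ := h
    exact Set.mem_biUnion (show l ∈ {i | i < s} from hl) ⟨h1, h2⟩
  · exact absurd (show n < 0 from hn) (not_lt.2 h)

theorem observed_eq_compl (s : ℕ) (N K : ℕ → ℕ) : observed s N K = (unobserved s N K)ᶜ := by
  ext n
  simp only [observed, unobserved, Set.mem_sdiff, Set.mem_ofPred_eq, Set.mem_compl_iff,
    Set.mem_union, not_or, not_le]
  tauto

/-! ### Positive semidefinite matrices and the pointwise quadratic forms -/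

section Pointwise

variable {T : ℕ}

theorem quad_eq_of_mul_self {S F : Matrix (Fin T) (Fin T) ℂ} (hS : S.IsHermitian)
    (h : S * S = F) (b : Fin T → ℂ) : quad F b = (b ᵥ* S) ⬝ᵥ star (b ᵥ* S) := by
  rw [quad, star_vecMul, hS.eq, ← h, ← mulVec_mulVec, dotProduct_mulVec]

theorem dotProduct_star_self (v : Fin T → ℂ) :
    v ⬝ᵥ star v = ((‖WithLp.toLp 2 v‖ ^ 2 : ℝ) : ℂ) := by
  rw [EuclideanSpace.norm_sq_eq, dotProduct]
  push_cast
  refine Finset.sum_congr rfl fun i _ => ?_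
  exact Complex.mul_conj' _

theorem quad_re_eq_norm {S F : Matrix (Fin T) (Fin T) ℂ} (hS : S.IsHermitian)
    (h : S * S = F) (b : Fin T → ℂ) : (quad F b).re = ‖WithLp.toLp 2 (b ᵥ* S)‖ ^ 2 := by
  rw [quad_eq_of_mul_self hS h, dotProduct_star_self, Complex.ofReal_re]

theorem quad_nonneg {F : Matrix (Fin T) (Fin T) ℂ} (hF : F.PosSemidef) (b : Fin T → ℂ) :
    0 ≤ quad F b := by
  have := hF.dotProduct_mulVec_nonneg (star b)
  simpa [quad] using this

theorem quad_re_nonneg {F : Matrix (Fin T) (Fin T) ℂ} (hF : F.PosSemidef) (b : Fin T → ℂ) :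
    0 ≤ (quad F b).re := (Complex.nonneg_iff.1 (quad_nonneg hF b)).1

theorem quad_add_left (F G : Matrix (Fin T) (Fin T) ℂ) (b : Fin T → ℂ) :
    quad (F + G) b = quad F b + quad G b := by
  simp [quad, add_mulVec, dotProduct_add]

theorem quad_smul_left (t : ℝ) (F : Matrix (Fin T) (Fin T) ℂ) (b : Fin T → ℂ) :
    quad (t • F) b = t • quad F b := by
  simp [quad, smul_mulVec, dotProduct_smul]

theorem quad_re_add_le {F : Matrix (Fin T) (Fin T) ℂ} (hF : F.PosSemidef) (b c : Fin T → ℂ)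
    {t : ℝ} (ht : 0 < t) :
    (quad F (b + c)).re ≤ (1 + t) * (quad F b).re + (1 + t⁻¹) * (quad F c).re := by
  -- the difference of the two sides is the form at `√t b - √t⁻¹ c`
  have h := quad_re_nonneg hF (((Real.sqrt t : ℝ) : ℂ) • b - (((Real.sqrt t)⁻¹ : ℝ) : ℂ) • c)
  have hs : Real.sqrt t ≠ 0 := (Real.sqrt_pos.2 ht).ne'
  have hsq : Real.sqrt t * Real.sqrt t = t := Real.mul_self_sqrt ht.le
  have hsi : (Real.sqrt t)⁻¹ * (Real.sqrt t)⁻¹ = t⁻¹ := by rw [← mul_inv, hsq]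
  have h1 : Real.sqrt t * (Real.sqrt t)⁻¹ = 1 := mul_inv_cancel₀ hs
  simp only [quad, star_sub, star_add, star_smul, mulVec_sub, mulVec_add, mulVec_smul,
    sub_dotProduct, add_dotProduct, dotProduct_sub, dotProduct_add, smul_dotProduct,
    dotProduct_smul, Complex.star_def, Complex.conj_ofReal, smul_eq_mul, Complex.sub_re,
    Complex.add_re, Complex.re_ofReal_mul] at h ⊢
  set p := (b ⬝ᵥ F *ᵥ star b).re
  set q := (c ⬝ᵥ F *ᵥ star c).re
  set r := (b ⬝ᵥ F *ᵥ star c).re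
  set r' := (c ⬝ᵥ F *ᵥ star b).re
  rw [show Real.sqrt t * (Real.sqrt t * p - (Real.sqrt t)⁻¹ * r') -
      (Real.sqrt t)⁻¹ * (Real.sqrt t * r - (Real.sqrt t)⁻¹ * q) = t * p + t⁻¹ * q - r - r' by
    linear_combination p * hsq + q * hsi - (r + r') * h1] at h
  linarith

/-- Completing the square in the pointwise mean square error. -/
theorem quad_sub_add_quad {f g : Matrix (Fin T) (Fin T) ℂ} (hf : f.IsHermitian)
    (hg : g.IsHermitian) (hu : IsUnit (f + g).det) (A h : Fin T → ℂ) :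
    quad f (A - h) + quad g h =
      quad (f * (f + g)⁻¹ * g) A + quad (f + g) (h - A ᵥ* (f * (f + g)⁻¹)) := by
  set F := f + g with hF
  have hFh : F.IsHermitian := hf.add hg
  set b := A ᵥ* (f * F⁻¹) with hb
  have hstar : star b = (F⁻¹ * f) *ᵥ star A := by
    rw [hb, star_vecMul, conjTranspose_mul, hf.eq, hFh.inv.eq]
  have h1 (c : Fin T → ℂ) : b ⬝ᵥ F *ᵥ star c = A ⬝ᵥ f *ᵥ star c := by
    rw [dotProduct_mulVec, hb, vecMul_vecMul, mul_assoc, nonsing_inv_mul _ hu, mul_one,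
      ← dotProduct_mulVec]
  have h2 (c : Fin T → ℂ) : c ⬝ᵥ F *ᵥ star b = c ⬝ᵥ f *ᵥ star A := by
    rw [hstar, mulVec_mulVec, ← mul_assoc, mul_nonsing_inv _ hu, one_mul]
  have h3 : A ⬝ᵥ (f * F⁻¹ * g) *ᵥ star A + A ⬝ᵥ f *ᵥ star b = A ⬝ᵥ f *ᵥ star A := by
    rw [hstar, mulVec_mulVec, ← dotProduct_add, ← add_mulVec]
    congr 2
    rw [← mul_assoc, ← mul_add, add_comm g f, ← hF, mul_assoc, nonsing_inv_mul _ hu, mul_one]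
  have h4 : h ⬝ᵥ F *ᵥ star h = h ⬝ᵥ f *ᵥ star h + h ⬝ᵥ g *ᵥ star h := by
    rw [hF, add_mulVec, dotProduct_add]
  simp only [quad, star_sub, mulVec_sub, sub_dotProduct, dotProduct_sub, h1, h2]
  have h5 : A ⬝ᵥ f *ᵥ star b = b ⬝ᵥ f *ᵥ star A := by rw [← h1, h2]
  rw [h4]
  linear_combination -h3 + h5

end Pointwise

/-! ### Measurable square roots of spectral densities -/

section Root

variable {T : ℕ}

theorem aestronglyMeasurable_matrix_iff {M : MatFun T} :
    AEStronglyMeasurable (fun x => (M x : Fin T → Fin T → ℂ)) freq ↔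
      ∀ i j, AEStronglyMeasurable (fun x => M x i j) freq := by
  refine ⟨fun h i j => ?_, fun h => ?_⟩
  · exact ((continuous_apply j).comp (continuous_apply i)).comp_aestronglyMeasurable h
  · exact (aemeasurable_pi_iff.2 fun i => aemeasurable_pi_iff.2 fun j =>
      (h i j).aemeasurable).aestronglyMeasurable

theorem aestronglyMeasurable_mul_apply {M N : MatFun T}
    (hM : ∀ i j, AEStronglyMeasurable (fun x => M x i j) freq)
    (hN : ∀ i j, AEStronglyMeasurable (fun x => N x i j) freq) (i j : Fin T) :
    AEStronglyMeasurable (fun x => (M x * N x) i j) freq := by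
  simp only [mul_apply]
  exact Finset.aestronglyMeasurable_fun_sum _ fun k _ => (hM i k).mul (hN k j)

theorem aestronglyMeasurable_vecMul_apply {b : VecFun T} {M : MatFun T}
    (hb : ∀ i, AEStronglyMeasurable (fun x => b x i) freq)
    (hM : ∀ i j, AEStronglyMeasurable (fun x => M x i j) freq) (j : Fin T) :
    AEStronglyMeasurable (fun x => (b x ᵥ* M x) j) freq := by
  simp only [vecMul, dotProduct]
  exact Finset.aestronglyMeasurable_fun_sum _ fun k _ => (hb k).mul (hM k j)

theorem aestronglyMeasurable_inv_apply {M : MatFun T}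
    (hM : ∀ i j, AEStronglyMeasurable (fun x => M x i j) freq) (i j : Fin T) :
    AEStronglyMeasurable (fun x => (M x)⁻¹ i j) freq := by
  have h := aestronglyMeasurable_matrix_iff.2 hM
  have hdet : AEStronglyMeasurable (fun x => (M x).det) freq :=
    (Continuous.matrix_det (A := fun A : Fin T → Fin T → ℂ => A)
      continuous_id).comp_aestronglyMeasurable h
  have hadj : AEStronglyMeasurable (fun x => (M x).adjugate i j) freq :=
    ((Continuous.matrix_adjugate (A := fun A : Fin T → Fin T → ℂ => A)
      continuous_id).matrix_elem i j).comp_aestronglyMeasurable h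
  simp only [inv_def, Matrix.smul_apply, Ring.inverse_eq_inv', smul_eq_mul]
  exact hdet.inv₀.mul hadj

open scoped MatrixOrder Matrix.Norms.L2Operator in
/-- A measurable positive semidefinite matrix function has a measurable Hermitian square root. -/
theorem exists_measurable_sqrt {F : MatFun T}
    (hF : ∀ i j, AEStronglyMeasurable (fun x => F x i j) freq)
    (hpos : ∀ᵐ x ∂freq, (F x).PosSemidef) :
    ∃ S : MatFun T, (∀ i j, AEStronglyMeasurable (fun x => S x i j) freq) ∧
      ∀ᵐ x ∂freq, (S x).IsHermitian ∧ S x * S x = F x := by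
  classical
  refine ⟨fun x => CFC.sqrt (F x), ?_, ?_⟩
  · let _ : MeasurableSpace (Matrix (Fin T) (Fin T) ℂ) := borel _
    have : BorelSpace (Matrix (Fin T) (Fin T) ℂ) := ⟨rfl⟩
    have : TopologicalSpace.PseudoMetrizableSpace (Matrix (Fin T) (Fin T) ℂ) :=
      inferInstanceAs (TopologicalSpace.PseudoMetrizableSpace (Fin T → Fin T → ℂ))
    have : SecondCountableTopology (Matrix (Fin T) (Fin T) ℂ) :=
      inferInstanceAs (SecondCountableTopology (Fin T → Fin T → ℂ))
    have hm : AEStronglyMeasurable F freq := aestronglyMeasurable_matrix_iff.2 hF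
    have hcl : IsClosed {A : Matrix (Fin T) (Fin T) ℂ | 0 ≤ A} := isClosed_Ici
    have hmeas : Measurable ({A : Matrix (Fin T) (Fin T) ℂ | 0 ≤ A}.piecewise CFC.sqrt 0) :=
      CFC.continuousOn_sqrt.measurable_piecewise continuousOn_const hcl.measurableSet
    have h1 : AEMeasurable (fun x =>
        {A : Matrix (Fin T) (Fin T) ℂ | 0 ≤ A}.piecewise CFC.sqrt 0 (F x)) freq :=
      hmeas.comp_aemeasurable hm.aemeasurable
    have h2 : AEStronglyMeasurable (fun x => CFC.sqrt (F x)) freq := by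
      refine h1.aestronglyMeasurable.congr ?_
      filter_upwards [hpos] with x hx
      exact Set.piecewise_eq_of_mem _ _ _ (show 0 ≤ F x from hx.nonneg)
    exact aestronglyMeasurable_matrix_iff.1 h2
  · filter_upwards [hpos] with x hx
    exact ⟨(CFC.sqrt_nonneg (F x)).posSemidef.isHermitian, CFC.sqrt_mul_sqrt_self _ hx.nonneg⟩

theorem memLp_of_row_norm_le {M : MatFun T}
    (hM : ∀ i j, AEStronglyMeasurable (fun x => M x i j) freq) {ρ : ℝ → ℝ}
    (hρ : Integrable ρ freq)
    (h : ∀ᵐ x ∂freq, ∀ i, ‖WithLp.toLp 2 (M x i)‖ ^ 2 ≤ ρ x) (i j : Fin T) :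
    MemLp (fun x => M x i j) 2 freq := by
  rw [memLp_two_iff_integrable_sq_norm (hM i j)]
  refine hρ.mono' ((hM i j).norm.pow 2) ?_
  filter_upwards [h] with x hx
  rw [Real.norm_of_nonneg (sq_nonneg _)]
  refine le_trans ?_ (hx i)
  rw [EuclideanSpace.norm_sq_eq]
  exact Finset.single_le_sum (f := fun j => ‖M x i j‖ ^ 2) (fun _ _ => sq_nonneg _)
    (Finset.mem_univ j)

/-- `S` is a Hermitian square root of `f + g`, almost everywhere invertible, together with the
square integrability of the matrix functions built from it that occur below. -/
structure IsRoot (f g S : MatFun T) : Prop where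
  memLp : ∀ i j, MemLp (fun x => S x i j) 2 freq
  memLp_inv : ∀ i j, MemLp (fun x => (S x)⁻¹ i j) 2 freq
  memLp_left : ∀ i j, MemLp (fun x => (f x * (S x)⁻¹) i j) 2 freq
  memLp_right : ∀ i j, MemLp (fun x => ((S x)⁻¹ * g x) i j) 2 freq
  posSemidef_left : ∀ᵐ x ∂freq, (f x).PosSemidef
  posSemidef_right : ∀ᵐ x ∂freq, (g x).PosSemidef
  isHermitian : ∀ᵐ x ∂freq, (S x).IsHermitian
  mul_self : ∀ᵐ x ∂freq, S x * S x = f x + g x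
  isUnit : ∀ᵐ x ∂freq, IsUnit (S x).det

theorem quad_single (F : Matrix (Fin T) (Fin T) ℂ) (i : Fin T) :
    quad F (Pi.single i 1) = F i i := by
  have h : star (Pi.single i (1 : ℂ)) = (Pi.single i 1 : Fin T → ℂ) := by
    ext j; by_cases hj : j = i
    · subst hj; simp
    · simp [hj]
  rw [quad, h]
  simp

/-- The parallel sum `f (f + g)⁻¹ g` has a nonnegative quadratic form: it is the minimum of the
pointwise mean square error. -/
theorem quad_parallel_nonneg {f g : Matrix (Fin T) (Fin T) ℂ} (hf : f.PosSemidef)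
    (hg : g.PosSemidef) (hu : IsUnit (f + g).det) (A : Fin T → ℂ) :
    0 ≤ quad (f * (f + g)⁻¹ * g) A := by
  have h := quad_sub_add_quad hf.isHermitian hg.isHermitian hu A (A ᵥ* (f * (f + g)⁻¹))
  have h0 : quad (f + g) (0 : Fin T → ℂ) = 0 := by simp [quad]
  rw [sub_self, h0, add_zero] at h
  rw [← h]
  exact add_nonneg (quad_nonneg hf _) (quad_nonneg hg _)

theorem norm_vecMul_mul_inv_sq_le {f g S : Matrix (Fin T) (Fin T) ℂ} (hf : f.PosSemidef)
    (hg : g.PosSemidef) (hS : S.IsHermitian) (hSS : S * S = f + g) (hu : IsUnit S.det)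
    (A : Fin T → ℂ) : ‖WithLp.toLp 2 (A ᵥ* (f * S⁻¹))‖ ^ 2 ≤ (quad f A).re := by
  have hu' : IsUnit (f + g).det := by rw [← hSS, det_mul]; exact hu.mul hu
  have h := congrArg Complex.re (quad_sub_add_quad hf.isHermitian hg.isHermitian hu' A 0)
  have h0 : quad g (0 : Fin T → ℂ) = 0 := by simp [quad]
  have hm : f * (f + g)⁻¹ * S = f * S⁻¹ := by
    rw [← hSS, Matrix.mul_inv_rev, mul_assoc, mul_assoc, nonsing_inv_mul _ hu, mul_one]
  rw [sub_zero, h0, add_zero, Complex.add_re, quad_re_eq_norm hS hSS, zero_sub, neg_vecMul,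
    vecMul_vecMul, hm, WithLp.toLp_neg, norm_neg] at h
  linarith [(Complex.nonneg_iff.1 (quad_parallel_nonneg hf hg hu' A)).1]

/-- Under the minimality condition the square root of `f + g` has all the required integrability:
the rows of `S`, `S⁻¹` and `f S⁻¹` have squared norms bounded by the traces of `f + g`, `(f + g)⁻¹`
and `f`. -/
theorem exists_isRoot {f g : MatFun T} (hf : IsSpectralDensity f) (hg : IsSpectralDensity g)
    (hmin : Minimality f g) : ∃ S, IsRoot f g S := by
  have hFm : ∀ i j, AEStronglyMeasurable (fun x => (f x + g x) i j) freq := fun i j =>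
    (hf.integrable i j).1.add (hg.integrable i j).1
  have hpos : ∀ᵐ x ∂freq, (f x + g x).PosSemidef := by
    filter_upwards [hf.posSemidef, hg.posSemidef] with x h1 h2 using h1.add h2
  obtain ⟨S, hSm, hS⟩ := exists_measurable_sqrt (F := fun x => f x + g x) hFm hpos
  have hunit : ∀ᵐ x ∂freq, IsUnit (S x).det := by
    filter_upwards [hS, hmin.1] with x h1 h2
    rw [← h1.2, det_mul] at h2
    exact isUnit_of_mul_isUnit_left h2
  have hSim := aestronglyMeasurable_inv_apply hSm
  have hdiag (i : Fin T) {φ : MatFun T} (hφ : IsSpectralDensity φ) :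
      Integrable (fun x => (φ x i i).re) freq := (hφ.integrable i i).re
  have hL : ∀ i j, MemLp (fun x => S x i j) 2 freq := by
    refine memLp_of_row_norm_le hSm (ρ := fun x => ∑ i, ((f x i i).re + (g x i i).re))
      (integrable_finsetSum _ fun i _ => (hdiag i hf).add (hdiag i hg)) ?_
    filter_upwards [hS, hf.posSemidef, hg.posSemidef] with x h1 h2 h3 i
    have h4 := quad_re_eq_norm h1.1 h1.2 (Pi.single i 1)
    rw [single_one_vecMul, quad_single] at h4
    rw [show (S x).row i = S x i from rfl] at h4
    rw [← h4]
    refine Finset.single_le_sum (f := fun i => (f x i i).re + (g x i i).re)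
      (fun i _ => ?_) (Finset.mem_univ i)
    rw [← quad_single (f x), ← quad_single (g x)]
    exact add_nonneg (quad_re_nonneg h2 _) (quad_re_nonneg h3 _)
  have hLi : ∀ i j, MemLp (fun x => (S x)⁻¹ i j) 2 freq := by
    refine memLp_of_row_norm_le hSim (ρ := fun x => ((f x + g x)⁻¹).trace.re) hmin.2.re ?_
    filter_upwards [hS, hunit] with x h1 h2 i
    have hSS : (S x)⁻¹ * (S x)⁻¹ = (f x + g x)⁻¹ := by rw [← Matrix.mul_inv_rev, h1.2]
    have h4 (i : Fin T) : ((f x + g x)⁻¹ i i).re = ‖WithLp.toLp 2 ((S x)⁻¹ i)‖ ^ 2 := by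
      have h4 := quad_re_eq_norm h1.1.inv hSS (Pi.single i 1)
      rwa [single_one_vecMul, quad_single] at h4
    rw [trace, Complex.re_sum]
    simp only [diag_apply, h4]
    exact Finset.single_le_sum (f := fun i => ‖WithLp.toLp 2 ((S x)⁻¹ i)‖ ^ 2)
      (fun i _ => sq_nonneg _) (Finset.mem_univ i)
  have hLl : ∀ i j, MemLp (fun x => (f x * (S x)⁻¹) i j) 2 freq := by
    refine memLp_of_row_norm_le (aestronglyMeasurable_mul_apply
      (fun i j => (hf.integrable i j).1) hSim) (ρ := fun x => ∑ i, (f x i i).re)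
      (integrable_finsetSum _ fun i _ => hdiag i hf) ?_
    filter_upwards [hS, hf.posSemidef, hg.posSemidef, hunit] with x h1 h2 h3 h4 i
    have h5 := norm_vecMul_mul_inv_sq_le h2 h3 h1.1 h1.2 h4 (Pi.single i 1)
    rw [single_one_vecMul, quad_single] at h5
    refine h5.trans ?_
    refine Finset.single_le_sum (f := fun i => (f x i i).re) (fun i _ => ?_) (Finset.mem_univ i)
    rw [← quad_single (f x)]
    exact quad_re_nonneg h2 _
  refine ⟨S, hL, hLi, hLl, fun i j => ?_, hf.posSemidef, hg.posSemidef, hS.mono fun _ h => h.1,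
    hS.mono fun _ h => h.2, hunit⟩
  -- `S⁻¹ g = S - (f S⁻¹)ᴴ`
  refine MemLp.ae_eq ?_ ((hL i j).sub (hLl j i).star)
  filter_upwards [hS, hf.posSemidef, hunit] with x h1 h2 h3
  have h4 : (S x)⁻¹ * g x = S x - (f x * (S x)⁻¹)ᴴ := by
    rw [conjTranspose_mul, h2.isHermitian.eq, h1.1.inv.eq, eq_sub_iff_add_eq, ← mul_add,
      add_comm, ← h1.2, ← mul_assoc, nonsing_inv_mul _ h3, one_mul]
  rw [h4]
  rfl

end Root

/-! ### The Hilbert space of square integrable vector functions -/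

section Hilbert

variable {T : ℕ}

/-- The Hilbert space of square integrable functions with values in `ℂ^T`. The weighted space
`L₂(F)` is mapped into it by `b ↦ b ᵥ* S`, where `S` is a Hermitian square root of `F`. -/
abbrev VecL2 (T : ℕ) := Lp (EuclideanSpace ℂ (Fin T)) 2 freq

/-- All entries are square integrable. -/
def IsL2 (b : VecFun T) : Prop := ∀ ν, MemLp (fun x => b x ν) 2 freq

theorem IsL2.memLp {b : VecFun T} (hb : IsL2 b) :
    MemLp (fun x => WithLp.toLp 2 (b x)) 2 freq := memLp_piLp_iff.2 hb

/-- The class of a square integrable vector function. -/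
def IsL2.toLp {b : VecFun T} (hb : IsL2 b) : VecL2 T := hb.memLp.toLp _

theorem IsL2.add {b c : VecFun T} (hb : IsL2 b) (hc : IsL2 c) : IsL2 (fun x => b x + c x) :=
  fun ν => (hb ν).add (hc ν)

theorem IsL2.sub {b c : VecFun T} (hb : IsL2 b) (hc : IsL2 c) : IsL2 (fun x => b x - c x) :=
  fun ν => (hb ν).sub (hc ν)

theorem IsL2.toLp_add {b c : VecFun T} (hb : IsL2 b) (hc : IsL2 c) :
    (hb.add hc).toLp = hb.toLp + hc.toLp := MemLp.toLp_add hb.memLp hc.memLp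

theorem IsL2.toLp_sub {b c : VecFun T} (hb : IsL2 b) (hc : IsL2 c) :
    (hb.sub hc).toLp = hb.toLp - hc.toLp := MemLp.toLp_sub hb.memLp hc.memLp

theorem IsL2.toLp_congr {b c : VecFun T} (hb : IsL2 b) (hc : IsL2 c)
    (h : ∀ᵐ x ∂freq, b x = c x) : hb.toLp = hc.toLp :=
  MemLp.toLp_congr hb.memLp hc.memLp (h.mono fun _ hx => congrArg (WithLp.toLp 2) hx)

theorem exists_isL2_toLp_eq (y : VecL2 T) : ∃ (b : VecFun T) (hb : IsL2 b), hb.toLp = y := by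
  have hb : IsL2 (fun x => WithLp.ofLp (y x)) := memLp_piLp_iff.1 (Lp.memLp y)
  exact ⟨_, hb, Lp.toLp_coeFn y (Lp.memLp y)⟩

theorem IsL2.inner_toLp {b c : VecFun T} (hb : IsL2 b) (hc : IsL2 c) :
    inner ℂ hb.toLp hc.toLp = ∫ x, c x ⬝ᵥ star (b x) ∂freq := by
  rw [L2.inner_def]
  refine integral_congr_ae ?_
  filter_upwards [hb.memLp.coeFn_toLp, hc.memLp.coeFn_toLp] with x h1 h2
  rw [IsL2.toLp, IsL2.toLp, h1, h2, EuclideanSpace.inner_eq_star_dotProduct]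

theorem IsL2.integrable_dotProduct_star {b c : VecFun T} (hb : IsL2 b) (hc : IsL2 c) :
    Integrable (fun x => b x ⬝ᵥ star (c x)) freq :=
  integrable_finsetSum _ fun ν _ => MemLp.integrable_mul' (hb ν) (hc ν).star

theorem IsL2.integrable_vecMul {b : VecFun T} (hb : IsL2 b) {M : MatFun T}
    (hM : ∀ i j, MemLp (fun x => M x i j) 2 freq) (ν : Fin T) :
    Integrable (fun x => (b x ᵥ* M x) ν) freq :=
  integrable_finsetSum Finset.univ fun i _ => MemLp.integrable_mul' (hb i) (hM i ν)

theorem isL2_vecMul {b : VecFun T} (hb : ∀ ν, AEStronglyMeasurable (fun x => b x ν) freq)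
    {c : ℝ} (hc : ∀ x ν, ‖b x ν‖ ≤ c) {M : MatFun T}
    (hM : ∀ i j, MemLp (fun x => M x i j) 2 freq) : IsL2 fun x => b x ᵥ* M x := by
  intro ν
  refine memLp_finsetSum (f := fun i x => b x i * M x i ν) Finset.univ fun i _ => ?_
  refine ((hM i ν).const_mul (c : ℂ)).of_le ((hb i).mul (hM i ν).1)
    (Eventually.of_forall fun x => ?_)
  rw [norm_mul, norm_mul, Complex.norm_real]
  gcongr
  exact (hc x i).trans (le_abs_self c)

theorem IsL2.lintegral_norm_sq {b : VecFun T} (hb : IsL2 b) :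
    ∫⁻ x, ENNReal.ofReal (‖WithLp.toLp 2 (b x)‖ ^ 2) ∂freq = ENNReal.ofReal (‖hb.toLp‖ ^ 2) := by
  have hi := (memLp_two_iff_integrable_sq_norm hb.memLp.1).1 hb.memLp
  rw [← ofReal_integral_eq_lintegral_ofReal hi (Eventually.of_forall fun _ => sq_nonneg _)]
  congr 1
  have h := hb.inner_toLp hb
  rw [inner_self_eq_norm_sq_to_K] at h
  simp_rw [dotProduct_star_self] at h
  rw [integral_complex_ofReal] at h
  rw [← RCLike.ofReal_pow] at h
  exact (Complex.ofReal_injective h).symm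

theorem isL2_of_lintegral_lt_top {b : VecFun T}
    (hb : ∀ ν, AEStronglyMeasurable (fun x => b x ν) freq)
    (h : ∫⁻ x, ENNReal.ofReal (‖WithLp.toLp 2 (b x)‖ ^ 2) ∂freq < ∞) : IsL2 b := by
  intro ν
  rw [memLp_two_iff_integrable_sq_norm (hb ν)]
  refine ⟨(hb ν).norm.pow 2, ?_⟩
  refine lt_of_le_of_lt (lintegral_mono fun x => ?_) h
  rw [Real.enorm_of_nonneg (sq_nonneg _)]
  refine ENNReal.ofReal_le_ofReal ?_
  rw [EuclideanSpace.norm_sq_eq]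
  exact Finset.single_le_sum (f := fun j => ‖b x j‖ ^ 2) (fun _ _ => sq_nonneg _)
    (Finset.mem_univ ν)

/-! ### Trigonometric polynomials -/

theorem trigPoly_apply (p : ℤ →₀ (Fin T → ℂ)) (x : ℝ) (ν : Fin T) :
    trigPoly p x ν = ∑ n ∈ p.support, expI n x * p n ν := by
  simp [trigPoly, Finsupp.sum, Finset.sum_apply, expI]

theorem trigPoly_single (n : ℤ) (v : Fin T → ℂ) (x : ℝ) :
    trigPoly (Finsupp.single n v) x = expI n x • v := by
  simp [trigPoly, expI]

theorem trigPoly_add (p q : ℤ →₀ (Fin T → ℂ)) (x : ℝ) :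
    trigPoly (p + q) x = trigPoly p x + trigPoly q x :=
  Finsupp.sum_add_index' (by simp) (by simp)

theorem trigPoly_smul (c : ℂ) (p : ℤ →₀ (Fin T → ℂ)) (x : ℝ) :
    trigPoly (c • p) x = c • trigPoly p x := by
  rw [trigPoly, trigPoly, Finsupp.sum_smul_index' (by simp), Finsupp.smul_sum]
  exact Finsupp.sum_congr fun n _ => smul_comm _ _ _

theorem continuous_trigPoly (p : ℤ →₀ (Fin T → ℂ)) : Continuous (trigPoly p) := by
  refine continuous_pi fun ν => ?_
  simp_rw [trigPoly_apply]
  exact continuous_finsetSum _ fun n _ => (continuous_expI n).mul continuous_const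

theorem aestronglyMeasurable_trigPoly (p : ℤ →₀ (Fin T → ℂ)) (ν : Fin T) :
    AEStronglyMeasurable (fun x => trigPoly p x ν) freq :=
  ((continuous_apply ν).comp (continuous_trigPoly p)).aestronglyMeasurable

theorem norm_trigPoly_le (p : ℤ →₀ (Fin T → ℂ)) (x : ℝ) (ν : Fin T) :
    ‖trigPoly p x ν‖ ≤ ∑ n ∈ p.support, ‖p n‖ := by
  rw [trigPoly_apply]
  refine (norm_sum_le _ _).trans (Finset.sum_le_sum fun n _ => ?_)
  rw [norm_mul, norm_expI, one_mul]
  exact norm_le_pi_norm _ _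

theorem isL2_trigPoly {S : MatFun T} (hS : ∀ i j, MemLp (fun x => S x i j) 2 freq)
    (p : ℤ →₀ (Fin T → ℂ)) : IsL2 fun x => trigPoly p x ᵥ* S x :=
  isL2_vecMul (aestronglyMeasurable_trigPoly p) (norm_trigPoly_le p) hS

/-- The trigonometric polynomial with coefficients `p`, as an element of the weighted `L²` space
with square root `S`. -/
def polyEmb {S : MatFun T} (hS : ∀ i j, MemLp (fun x => S x i j) 2 freq) :
    (ℤ →₀ (Fin T → ℂ)) →ₗ[ℂ] VecL2 T where
  toFun p := (isL2_trigPoly hS p).toLp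
  map_add' p q := by
    rw [← IsL2.toLp_add]
    exact IsL2.toLp_congr _ _ (Eventually.of_forall fun x => by
      simp only [trigPoly_add, add_vecMul])
  map_smul' c p := by
    rw [RingHom.id_apply, IsL2.toLp, IsL2.toLp, ← MemLp.toLp_const_smul]
    exact MemLp.toLp_congr _ _ (Eventually.of_forall fun x => by
      simp only [trigPoly_smul, smul_vecMul]; rfl)

theorem polyEmb_apply {S : MatFun T} (hS : ∀ i j, MemLp (fun x => S x i j) 2 freq)
    (p : ℤ →₀ (Fin T → ℂ)) : polyEmb hS p = (isL2_trigPoly hS p).toLp := rfl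

/-- The closed span of the exponentials with frequencies in `G` in the weighted `L²` space with
square root `S`. -/
def polySpace {S : MatFun T} (hS : ∀ i j, MemLp (fun x => S x i j) 2 freq) (G : Set ℤ) :
    Submodule ℂ (VecL2 T) :=
  ((Finsupp.supported (Fin T → ℂ) ℂ G).map (polyEmb hS)).topologicalClosure

theorem polyEmb_mem {S : MatFun T} (hS : ∀ i j, MemLp (fun x => S x i j) 2 freq) {G : Set ℤ}
    {p : ℤ →₀ (Fin T → ℂ)} (hp : p ∈ Finsupp.supported (Fin T → ℂ) ℂ G) :
    polyEmb hS p ∈ polySpace hS G :=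
  Submodule.le_topologicalClosure _ (Submodule.mem_map_of_mem hp)

instance {S : MatFun T} (hS : ∀ i j, MemLp (fun x => S x i j) 2 freq) (G : Set ℤ) :
    CompleteSpace (polySpace hS G) :=
  (Submodule.isClosed_topologicalClosure _).completeSpace_coe

/-- The inner products with the exponentials are the Fourier coefficients of `y ᵥ* S`. -/
theorem inner_polyEmb_single {S : MatFun T} (hS : ∀ i j, MemLp (fun x => S x i j) 2 freq)
    (hSh : ∀ᵐ x ∂freq, (S x).IsHermitian) (n : ℤ) (v : Fin T → ℂ) {y : VecFun T} (hy : IsL2 y) :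
    inner ℂ (polyEmb hS (Finsupp.single n v)) hy.toLp =
      ∑ ν, star (v ν) * ∫ x, (y x ᵥ* S x) ν * expI (-n) x ∂freq := by
  rw [polyEmb_apply, IsL2.inner_toLp]
  simp_rw [← integral_const_mul]
  rw [← integral_finsetSum _ fun ν _ =>
    (Integrable.mul_expI (hy.integrable_vecMul hS ν) (-n)).const_mul _]
  refine integral_congr_ae ?_
  filter_upwards [hSh] with x hx
  rw [star_vecMul, hx.eq, dotProduct_mulVec, trigPoly_single, dotProduct]
  refine Finset.sum_congr rfl fun ν _ => ?_
  simp only [Pi.star_apply, Pi.smul_apply, smul_eq_mul, star_mul', star_expI]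
  ring

theorem inner_polyEmb_single_one {S : MatFun T} (hS : ∀ i j, MemLp (fun x => S x i j) 2 freq)
    (hSh : ∀ᵐ x ∂freq, (S x).IsHermitian) (n : ℤ) (ν : Fin T) {y : VecFun T} (hy : IsL2 y) :
    inner ℂ (polyEmb hS (Finsupp.single n (Pi.single ν 1))) hy.toLp =
      ∫ x, (y x ᵥ* S x) ν * expI (-n) x ∂freq := by
  rw [inner_polyEmb_single hS hSh, Finset.sum_eq_single ν]
  · simp
  · intro i _ hi; simp [hi]
  · simp

theorem mem_polySpace_orthogonal {S : MatFun T} (hS : ∀ i j, MemLp (fun x => S x i j) 2 freq)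
    (hSh : ∀ᵐ x ∂freq, (S x).IsHermitian) {G : Set ℤ} {y : VecFun T} (hy : IsL2 y) :
    hy.toLp ∈ (polySpace hS G)ᗮ ↔
      ∀ n ∈ G, ∀ ν, ∫ x, (y x ᵥ* S x) ν * expI (-n) x ∂freq = 0 := by
  rw [polySpace, Submodule.orthogonal_closure, Submodule.mem_orthogonal]
  constructor
  · intro h n hn ν
    rw [← inner_polyEmb_single_one hS hSh]
    exact h _ (Submodule.mem_map_of_mem (Finsupp.single_mem_supported ℂ _ hn))
  · rintro h _ ⟨p, hp, rfl⟩
    rw [← Finsupp.sum_single p, Finsupp.sum, map_sum, sum_inner]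
    refine Finset.sum_eq_zero fun n hn => ?_
    rw [inner_polyEmb_single hS hSh]
    exact Finset.sum_eq_zero fun ν _ => by rw [h n (hp hn), mul_zero]

/-- The duality between the weights `f + g` and `(f + g)⁻¹`: if `G` consists of the nonnegative
integers and finitely many negative ones, the orthogonal complement of the exponentials with
frequencies in `G` for the weight `(f + g)⁻¹` is spanned by the exponentials with frequencies
outside `G` for the weight `f + g`. -/
theorem polySpace_inv_orthogonal {f g S : MatFun T} (h : IsRoot f g S) {G : Set ℤ}
    (hG : ∀ n : ℤ, 0 ≤ n → n ∈ G) (hfin : (G ∩ {n | n < 0}).Finite) :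
    (polySpace h.memLp_inv G)ᗮ = polySpace h.memLp Gᶜ := by
  have hinv : ∀ᵐ x ∂freq, ((S x)⁻¹).IsHermitian := h.isHermitian.mono fun x hx => hx.inv
  apply le_antisymm
  · intro z hz
    rw [← Submodule.orthogonal_orthogonal (polySpace h.memLp Gᶜ), Submodule.mem_orthogonal]
    intro w hw
    obtain ⟨b, hb, rfl⟩ := exists_isL2_toLp_eq z
    obtain ⟨c, hc, rfl⟩ := exists_isL2_toLp_eq w
    rw [mem_polySpace_orthogonal h.memLp_inv hinv] at hz
    rw [mem_polySpace_orthogonal h.memLp h.isHermitian] at hw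
    rw [IsL2.inner_toLp]
    have hae : ∀ᵐ x ∂freq, (b x ᵥ* (S x)⁻¹) ⬝ᵥ star (c x ᵥ* S x) = b x ⬝ᵥ star (c x) := by
      filter_upwards [h.isHermitian, h.isUnit] with x h1 h2
      rw [star_vecMul, h1.eq, dotProduct_mulVec, vecMul_vecMul, nonsing_inv_mul _ h2, vecMul_one]
    rw [← integral_congr_ae hae]
    exact integral_dotProduct_star_eq_zero hG hfin (hb.integrable_vecMul h.memLp_inv)
      (hc.integrable_vecMul h.memLp) hz (fun n hn => hw n hn)
      ((hb.integrable_dotProduct_star hc).congr (hae.mono fun _ h => h.symm))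
  · refine Submodule.topologicalClosure_minimal _ ?_ (Submodule.isClosed_orthogonal _)
    rintro _ ⟨p, hp, rfl⟩
    rw [polyEmb_apply, mem_polySpace_orthogonal h.memLp_inv hinv]
    intro n hn ν
    have hae : ∀ᵐ x ∂freq, ((trigPoly p x ᵥ* S x) ᵥ* (S x)⁻¹) ν * expI (-n) x =
        ∑ k ∈ p.support, p k ν * expI (k - n) x := by
      filter_upwards [h.isUnit] with x h2
      rw [vecMul_vecMul, mul_nonsing_inv _ h2, vecMul_one, trigPoly_apply, Finset.sum_mul]
      refine Finset.sum_congr rfl fun k _ => ?_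
      rw [sub_eq_add_neg, expI_add]; ring
    rw [integral_congr_ae hae, integral_finsetSum _ fun k _ => (integrable_expI _).const_mul _]
    refine Finset.sum_eq_zero fun k hk => ?_
    have : k ≠ n := fun hkn => hp hk (hkn ▸ hn)
    rw [integral_const_mul, integral_expI, if_neg (sub_ne_zero.2 this), mul_zero]

end Hilbert

/-! ### The functional and the block matrices as inner products -/

section Blocks

variable {T : ℕ} {a : ℕ → ℂ}

theorem hasSum_of_eq {φ ψ : ℕ → ℂ} {r t : ℂ} (h : HasSum φ r) (hf : ∀ j, ψ j = φ j)
    (hr : t = r) : HasSum ψ t := by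
  rw [hr, funext hf]; exact h

theorem summable_norm_blockCoeff (ha : Summable fun j => ‖a j‖) :
    Summable fun j => ‖blockCoeff T a j‖ := by
  refine Summable.of_nonneg_of_le (fun _ => norm_nonneg _) (fun j => ?_)
    (summable_sum (s := Finset.univ) (f := fun (ν : Fin T) j => ‖blockCoeff T a j ν‖)
      fun ν _ => ?_)
  · exact (pi_norm_le_iff_of_nonneg (Finset.sum_nonneg fun _ _ => norm_nonneg _)).2 fun ν =>
      Finset.single_le_sum (f := fun ν => ‖blockCoeff T a j ν‖) (fun _ _ => norm_nonneg _)
        (Finset.mem_univ ν)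
  · have hT : 0 < T := ν.pos
    refine ha.comp_injective (i := fun j : ℕ => j * T + ν + 1) fun j k hjk => ?_
    exact Nat.eq_of_mul_eq_mul_right hT (by simp only at hjk; omega)

theorem hasSum_symbolA (ha : Summable fun j => ‖a j‖) (x : ℝ) (ν : Fin T) :
    HasSum (fun j : ℕ => expI j x * blockCoeff T a j ν) (symbolA T a x ν) := by
  have hs : Summable fun j : ℕ =>
      Complex.exp (Complex.I * (j : ℂ) * (x : ℂ)) • blockCoeff T a j := by
    refine Summable.of_norm ((summable_norm_blockCoeff (T := T) ha).congr fun j => ?_)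
    have := norm_expI j x
    rw [expI] at this
    push_cast at this
    rw [norm_smul, this, one_mul]
  have := Pi.hasSum.1 hs.hasSum ν
  simpa [expI, symbolA] using this

theorem norm_symbolA_le (ha : Summable fun j => ‖a j‖) (x : ℝ) (ν : Fin T) :
    ‖symbolA T a x ν‖ ≤ ∑' j, ‖blockCoeff T a j‖ := by
  refine (hasSum_symbolA ha x ν).norm_le_of_bounded (summable_norm_blockCoeff ha).hasSum fun j => ?_
  rw [norm_mul, norm_expI, one_mul]
  exact norm_le_pi_norm _ _

theorem aestronglyMeasurable_symbolA (ha : Summable fun j => ‖a j‖) (ν : Fin T) :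
    AEStronglyMeasurable (fun x => symbolA T a x ν) freq := by
  have : Continuous fun x => ∑' j : ℕ, expI j x * blockCoeff T a j ν := by
    refine continuous_tsum (fun j => (continuous_expI j).mul continuous_const)
      (summable_norm_blockCoeff (T := T) ha) fun j x => ?_
    rw [norm_mul, norm_expI, one_mul]
    exact norm_le_pi_norm _ _
  refine this.aestronglyMeasurable.congr (Eventually.of_forall fun x => ?_)
  exact (hasSum_symbolA ha x ν).tsum_eq

/-- Integration against the symbol `A`, term by term. -/
theorem hasSum_integral_symbolA (ha : Summable fun j => ‖a j‖) {u : VecFun T}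
    (hu : ∀ ν, Integrable (fun x => u x ν) freq) :
    HasSum (fun j : ℕ => ∑ ν, blockCoeff T a j ν * ∫ x, u x ν * expI j x ∂freq)
      (∫ x, symbolA T a x ⬝ᵥ u x ∂freq) := by
  have hterm (ν : Fin T) : HasSum
      (fun j : ℕ => blockCoeff T a j ν * ∫ x, u x ν * expI j x ∂freq)
      (∫ x, symbolA T a x ν * u x ν ∂freq) := by
    have h := hasSum_integral_of_summable_integral_norm (μ := freq)
      (F := fun (j : ℕ) x => blockCoeff T a j ν * (u x ν * expI j x))
      (fun j => (Integrable.mul_expI (hu ν) j).const_mul _) (by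
        refine Summable.of_nonneg_of_le (fun j => integral_nonneg fun _ => norm_nonneg _)
          (fun j => ?_) ((summable_norm_blockCoeff (T := T) ha).mul_right (∫ x, ‖u x ν‖ ∂freq))
        simp_rw [norm_mul, norm_expI, mul_one]
        rw [integral_const_mul]
        exact mul_le_mul_of_nonneg_right (norm_le_pi_norm _ _)
          (integral_nonneg fun _ => norm_nonneg _))
    simp_rw [integral_const_mul] at h
    refine hasSum_of_eq h (fun _ => rfl) ?_
    congr 1; ext x
    rw [← (hasSum_symbolA ha x ν).tsum_eq, ← tsum_mul_right]
    exact tsum_congr fun j => by ring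
  have hint (ν : Fin T) : Integrable (fun x => symbolA T a x ν * u x ν) freq := by
    simpa [mul_comm] using (hu ν).mul_bdd (aestronglyMeasurable_symbolA ha ν)
      (Eventually.of_forall fun x => norm_symbolA_le ha x ν)
  simp only [dotProduct]
  rw [integral_finsetSum _ fun ν _ => hint ν]
  exact hasSum_sum fun ν _ => hterm ν

theorem matCoeff_apply (M : MatFun T) (k : ℤ) (i j : Fin T) :
    matCoeff M k i j = (1 / (2 * Real.pi) : ℂ) * ∫ x, M x i j * expI (-k) x ∂freq := by
  simp only [matCoeff, of_apply, expI_neg_eq]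

theorem blockMatrix_mulVec_apply {G : Set ℤ} (M : MatFun T) (m n : G) (v : Fin T → ℂ)
    (ν : Fin T) :
    (blockMatrix G M m n *ᵥ v) ν =
      (1 / (2 * Real.pi) : ℂ) * ∑ i, v i * ∫ x, M x i ν * expI (n - m : ℤ) x ∂freq := by
  simp only [mulVec, dotProduct, blockMatrix, transpose_apply, matCoeff_apply, Finset.mul_sum,
    neg_sub]
  exact Finset.sum_congr rfl fun i _ => by ring

/-- A sum over `G` against the coefficients of the functional reduces to a sum over `ℕ`. -/
theorem hasSum_extCoeff_iff {G : Set ℤ} (hG : ∀ n : ℤ, 0 ≤ n → n ∈ G) {E : Type*}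
    [AddCommMonoid E] [TopologicalSpace E] (φ : G → (Fin T → ℂ) → E) (hφ : ∀ n, φ n 0 = 0)
    (s : E) :
    HasSum (fun n : G => φ n (extCoeff T a G n)) s ↔
      HasSum (fun j : ℕ => φ ⟨j, hG j (by omega)⟩ (blockCoeff T a j)) s := by
  have hinj : Function.Injective fun j : ℕ => (⟨j, hG j (by omega)⟩ : G) := fun j k h => by
    simpa using h
  rw [← hinj.hasSum_iff]
  · simp [extCoeff, Function.comp_def]
  · intro n hn
    have : ¬ (0 : ℤ) ≤ n := fun h => hn ⟨(n : ℤ).toNat, Subtype.ext (by simpa using h)⟩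
    rw [extCoeff, if_neg this, hφ]

theorem applySeq_blockMatrix (ha : Summable fun j => ‖a j‖) {G : Set ℤ}
    (hG : ∀ n : ℤ, 0 ≤ n → n ∈ G) {M : MatFun T}
    (hM : ∀ i j, Integrable (fun x => M x i j) freq) (m : G) (ν : Fin T) :
    applySeq (blockMatrix G M) (extCoeff T a G) m ν =
      (1 / (2 * Real.pi) : ℂ) * ∫ x, (symbolA T a x ᵥ* M x) ν * expI (-(m : ℤ)) x ∂freq := by
  have h : HasSum (fun n : G => blockMatrix G M m n *ᵥ extCoeff T a G n) fun ν =>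
      (1 / (2 * Real.pi) : ℂ) * ∫ x, (symbolA T a x ᵥ* M x) ν * expI (-(m : ℤ)) x ∂freq := by
    rw [hasSum_extCoeff_iff hG (fun n v => blockMatrix G M m n *ᵥ v)
      (fun n => mulVec_zero (blockMatrix G M m n))]
    refine Pi.hasSum.2 fun ν => ?_
    simp_rw [blockMatrix_mulVec_apply]
    refine HasSum.mul_left _ ?_
    have h := hasSum_integral_symbolA ha (u := fun x i => M x i ν * expI (-(m : ℤ)) x)
      fun i => Integrable.mul_expI (hM i ν) _
    refine hasSum_of_eq h (fun j => ?_) ?_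
    · refine Finset.sum_congr rfl fun i _ => ?_
      congr 2; ext x
      rw [sub_eq_add_neg, expI_add]; ring
    · congr 1; ext x
      simp only [vecMul, dotProduct, Finset.sum_mul, mul_assoc]
  rw [applySeq, h.tsum_eq]

theorem pairSeq_blockMatrix (ha : Summable fun j => ‖a j‖) {G : Set ℤ}
    (hG : ∀ n : ℤ, 0 ≤ n → n ∈ G) {M : MatFun T}
    (hM : ∀ i j, Integrable (fun x => M x i j) freq) :
    pairSeq (applySeq (blockMatrix G M) (extCoeff T a G)) (extCoeff T a G) =
      (1 / (2 * Real.pi) : ℂ) * ∫ x, quad (M x) (symbolA T a x) ∂freq := by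
  have hAM (ν : Fin T) : Integrable (fun x => (symbolA T a x ᵥ* M x) ν) freq := by
    refine integrable_finsetSum (f := fun i x => symbolA T a x i * M x i ν) Finset.univ
      fun i _ => ?_
    simpa [mul_comm] using (hM i ν).mul_bdd (aestronglyMeasurable_symbolA ha i)
      (Eventually.of_forall fun x => norm_symbolA_le ha x i)
  have h : HasSum (fun n : G => applySeq (blockMatrix G M) (extCoeff T a G) n ⬝ᵥ
      star (extCoeff T a G n))
      ((1 / (2 * Real.pi) : ℂ) * ∫ x, quad (M x) (symbolA T a x) ∂freq) := by
    rw [hasSum_extCoeff_iff hG (fun n v =>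
      applySeq (blockMatrix G M) (extCoeff T a G) n ⬝ᵥ star v)
      (fun n => by rw [star_zero, dotProduct_zero])]
    have h := hasSum_integral_symbolA ha (u := fun x ν => star ((symbolA T a x ᵥ* M x) ν))
      fun ν => integrable_star (hAM ν)
    have h' := (h.star).mul_left (1 / (2 * Real.pi) : ℂ)
    refine hasSum_of_eq h' (fun j => ?_) ?_
    · rw [star_sum, Finset.mul_sum, dotProduct]
      refine Finset.sum_congr rfl fun ν _ => ?_
      rw [applySeq_blockMatrix ha hG hM, integral_mul_star_expI, star_mul', star_star,
        Pi.star_apply]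
      ring
    · rw [← integral_star]
      congr 2; ext x
      rw [quad, dotProduct_mulVec, dotProduct, dotProduct, star_sum]
      refine Finset.sum_congr rfl fun ν _ => ?_
      rw [star_mul', star_star, Pi.star_apply, mul_comm]
  rw [pairSeq, h.tsum_eq]

/-- A finitely supported sequence on `G` as one on `ℤ`. -/
def extendFin {G : Set ℤ} (w : G →₀ (Fin T → ℂ)) : ℤ →₀ (Fin T → ℂ) :=
  w.mapDomain Subtype.val

theorem extendFin_apply_mem {G : Set ℤ} (w : G →₀ (Fin T → ℂ)) (n : G) :
    extendFin w n = w n := Finsupp.mapDomain_apply Subtype.val_injective _ _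

theorem extendFin_apply_notMem {G : Set ℤ} (w : G →₀ (Fin T → ℂ)) {n : ℤ} (hn : n ∉ G) :
    extendFin w n = 0 := Finsupp.mapDomain_of_notMem_range _ _ (by simpa using hn)

theorem extendFin_sub {G : Set ℤ} (w w' : G →₀ (Fin T → ℂ)) :
    extendFin (w - w') = extendFin w - extendFin w' := by
  ext n i
  by_cases hn : n ∈ G
  · have h1 (w : G →₀ (Fin T → ℂ)) := extendFin_apply_mem w ⟨n, hn⟩
    simp only at h1
    rw [h1, Finsupp.sub_apply, Finsupp.sub_apply, h1, h1]
  · rw [extendFin_apply_notMem _ hn, Finsupp.sub_apply, extendFin_apply_notMem _ hn,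
      extendFin_apply_notMem _ hn, sub_zero]

theorem extendFin_mem_supported {G : Set ℤ} (w : G →₀ (Fin T → ℂ)) :
    extendFin w ∈ Finsupp.supported (Fin T → ℂ) ℂ G := by
  rw [Finsupp.mem_supported']
  exact fun n hn => extendFin_apply_notMem w hn

theorem exists_extendFin_eq {G : Set ℤ} {p : ℤ →₀ (Fin T → ℂ)}
    (hp : p ∈ Finsupp.supported (Fin T → ℂ) ℂ G) : ∃ w : G →₀ (Fin T → ℂ), extendFin w = p := by
  rw [Finsupp.mem_supported'] at hp
  refine ⟨p.comapDomain Subtype.val Subtype.val_injective.injOn, ?_⟩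
  ext1 n
  by_cases hn : n ∈ G
  · have := extendFin_apply_mem (p.comapDomain Subtype.val Subtype.val_injective.injOn) ⟨n, hn⟩
    simpa using this
  · rw [extendFin_apply_notMem _ hn, hp n hn]

theorem extendFin_eq_sum {G : Set ℤ} (w : G →₀ (Fin T → ℂ)) :
    extendFin w = ∑ n ∈ w.support, Finsupp.single (n : ℤ) (w n) := rfl

variable {f g S : MatFun T}

theorem IsRoot.isHermitian_inv (h : IsRoot f g S) : ∀ᵐ x ∂freq, ((S x)⁻¹).IsHermitian :=
  h.isHermitian.mono fun _ hx => hx.inv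

theorem IsRoot.inv_mul_inv (h : IsRoot f g S) :
    ∀ᵐ x ∂freq, (f x + g x)⁻¹ = (S x)⁻¹ * (S x)⁻¹ :=
  h.mul_self.mono fun x hx => by rw [← hx, Matrix.mul_inv_rev]

theorem polyEmb_extendFin {M : MatFun T} (hM : ∀ i j, MemLp (fun x => M x i j) 2 freq) {G : Set ℤ}
    (w : G →₀ (Fin T → ℂ)) :
    polyEmb hM (extendFin w) = ∑ n ∈ w.support, ∑ ν,
      w n ν • polyEmb hM (Finsupp.single (n : ℤ) (Pi.single ν 1)) := by
  rw [extendFin_eq_sum, map_sum]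
  refine Finset.sum_congr rfl fun n _ => ?_
  simp_rw [← map_smul, ← map_sum]
  congr 1
  simp_rw [Finsupp.smul_single, ← Finsupp.single_finsetSum]
  congr 1
  ext i
  simp [Finset.sum_apply, Pi.single_apply]

/-- `B` is the Gram matrix, up to the factor `1 / 2π`, of the exponentials for the weight
`(f + g)⁻¹`. -/
theorem applyFin_matB (h : IsRoot f g S) {G : Set ℤ} (w : G →₀ (Fin T → ℂ)) (m : G) (ν : Fin T) :
    applyFin (matB G f g) w m ν = (1 / (2 * Real.pi) : ℂ) *
      inner ℂ (polyEmb h.memLp_inv (Finsupp.single (m : ℤ) (Pi.single ν 1)))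
        (polyEmb h.memLp_inv (extendFin w)) := by
  rw [polyEmb_extendFin, inner_sum, applyFin, Finsupp.sum, Finset.sum_apply, Finset.mul_sum]
  refine Finset.sum_congr rfl fun n _ => ?_
  rw [matB, blockMatrix_mulVec_apply, inner_sum]
  congr 1
  refine Finset.sum_congr rfl fun i _ => ?_
  rw [inner_smul_right, polyEmb_apply _ (Finsupp.single (n : ℤ) _),
    inner_polyEmb_single_one h.memLp_inv h.isHermitian_inv]
  congr 1
  refine integral_congr_ae ?_
  filter_upwards [h.inv_mul_inv] with x hx
  rw [vecMul_vecMul, ← hx, trigPoly_single, smul_vecMul, single_one_vecMul, Pi.smul_apply,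
    smul_eq_mul, sub_eq_add_neg, expI_add]
  simp only [row_apply]
  ring

theorem isL2_target (ha : Summable fun j => ‖a j‖) (h : IsRoot f g S) :
    IsL2 fun x => symbolA T a x ᵥ* (f x * (S x)⁻¹) :=
  isL2_vecMul (aestronglyMeasurable_symbolA ha) (norm_symbolA_le ha) h.memLp_left

theorem applySeq_matR (ha : Summable fun j => ‖a j‖) (h : IsRoot f g S) {G : Set ℤ}
    (hG : ∀ n : ℤ, 0 ≤ n → n ∈ G) (m : G) (ν : Fin T) :
    applySeq (matR G f g) (extCoeff T a G) m ν = (1 / (2 * Real.pi) : ℂ) *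
      inner ℂ (polyEmb h.memLp_inv (Finsupp.single (m : ℤ) (Pi.single ν 1)))
        (isL2_target ha h).toLp := by
  have hae : ∀ᵐ x ∂freq, f x * (f x + g x)⁻¹ = f x * (S x)⁻¹ * (S x)⁻¹ := by
    filter_upwards [h.inv_mul_inv] with x hx
    rw [hx, mul_assoc]
  have hint (i j : Fin T) : Integrable (fun x => (f x * (f x + g x)⁻¹) i j) freq := by
    have h1 : Integrable (fun x => (f x * (S x)⁻¹ * (S x)⁻¹) i j) freq :=
      integrable_finsetSum Finset.univ fun k _ =>
        MemLp.integrable_mul' (h.memLp_left i k) (h.memLp_inv k j)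
    exact h1.congr (hae.mono fun x hx => by simp only [hx])
  rw [matR, applySeq_blockMatrix ha hG hint, inner_polyEmb_single_one h.memLp_inv h.isHermitian_inv]
  congr 1
  refine integral_congr_ae ?_
  filter_upwards [hae] with x hx
  rw [hx, vecMul_vecMul]

theorem integrable_parallel (h : IsRoot f g S) (i j : Fin T) :
    Integrable (fun x => (f x * (f x + g x)⁻¹ * g x) i j) freq := by
  have h1 : Integrable (fun x => (f x * (S x)⁻¹ * ((S x)⁻¹ * g x)) i j) freq :=
    integrable_finsetSum Finset.univ fun k _ =>
      MemLp.integrable_mul' (h.memLp_left i k) (h.memLp_right k j)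
  refine h1.congr ?_
  filter_upwards [h.inv_mul_inv] with x hx
  rw [hx]
  simp only [mul_assoc]

theorem pairFin_eq_inner {M : MatFun T} (hM : ∀ i j, MemLp (fun x => M x i j) 2 freq) {G : Set ℤ}
    {X : G → Fin T → ℂ} {z : VecL2 T}
    (hX : ∀ (m : G) (ν : Fin T), X m ν = (1 / (2 * Real.pi) : ℂ) *
      inner ℂ (polyEmb hM (Finsupp.single (m : ℤ) (Pi.single ν 1))) z)
    (w : G →₀ (Fin T → ℂ)) :
    pairFin X w = (1 / (2 * Real.pi) : ℂ) * inner ℂ (polyEmb hM (extendFin w)) z := by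
  rw [polyEmb_extendFin, sum_inner, pairFin, Finsupp.sum, Finset.mul_sum]
  refine Finset.sum_congr rfl fun n _ => ?_
  rw [sum_inner, Finset.mul_sum, dotProduct]
  refine Finset.sum_congr rfl fun ν _ => ?_
  rw [hX, inner_smul_left, Pi.star_apply, Complex.star_def]
  ring

/-- The Fourier coefficients of a trigonometric polynomial as inner products between the weights
`f + g` and `(f + g)⁻¹`. -/
theorem inner_polyEmb_polyEmb_inv (h : IsRoot f g S) (n : ℤ) (ν : Fin T)
    (p : ℤ →₀ (Fin T → ℂ)) :
    inner ℂ (polyEmb h.memLp (Finsupp.single n (Pi.single ν 1))) (polyEmb h.memLp_inv p) =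
      2 * Real.pi * p n ν := by
  rw [polyEmb_apply h.memLp_inv, inner_polyEmb_single_one h.memLp h.isHermitian]
  have hae : ∀ᵐ x ∂freq, ((trigPoly p x ᵥ* (S x)⁻¹) ᵥ* S x) ν * expI (-n) x =
      ∑ k ∈ p.support, p k ν * expI (k - n) x := by
    filter_upwards [h.isUnit] with x h2
    rw [vecMul_vecMul, nonsing_inv_mul _ h2, vecMul_one, trigPoly_apply, Finset.sum_mul]
    refine Finset.sum_congr rfl fun k _ => ?_
    rw [sub_eq_add_neg, expI_add]; ring
  rw [integral_congr_ae hae, integral_finsetSum _ fun k _ => (integrable_expI _).const_mul _]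
  simp_rw [integral_const_mul, integral_expI, sub_eq_zero]
  simp only [mul_ite, mul_zero, Finset.sum_ite_eq', Finsupp.mem_support_iff]
  split_ifs with hn
  · ring
  · rw [not_not.1 hn]; simp

end Blocks

/-! ### Energy solutions as orthogonal projections -/

section Energy

variable {T : ℕ} {a : ℕ → ℂ} {f g S : MatFun T} {G : Set ℤ}

/-- The class of `A ᵥ* (f S⁻¹)`. It represents `A ᵥ* (f (f + g)⁻¹)` for the weight `f + g` and
`A ᵥ* f` for the weight `(f + g)⁻¹`. -/
def IsRoot.target (ha : Summable fun j => ‖a j‖) (h : IsRoot f g S) : VecL2 T :=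
  (isL2_target ha h).toLp

/-- The part of the target not explained by the observations: its projection onto the span of
the exponentials with frequencies in `G` for the weight `(f + g)⁻¹`. -/
def IsRoot.residual (ha : Summable fun j => ‖a j‖) (h : IsRoot f g S) (G : Set ℤ) : VecL2 T :=
  (polySpace h.memLp_inv G).starProjection (h.target ha)

theorem IsRoot.residual_mem (ha : Summable fun j => ‖a j‖) (h : IsRoot f g S) :
    h.residual ha G ∈ polySpace h.memLp_inv G := Submodule.starProjection_apply_mem _ _

theorem IsRoot.target_sub_residual_mem (ha : Summable fun j => ‖a j‖) (h : IsRoot f g S) :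
    h.target ha - h.residual ha G ∈ (polySpace h.memLp_inv G)ᗮ :=
  Submodule.sub_starProjection_mem_orthogonal _

theorem IsRoot.inner_residual_target (ha : Summable fun j => ‖a j‖) (h : IsRoot f g S) :
    inner ℂ (h.residual ha G) (h.target ha) = ((‖h.residual ha G‖ ^ 2 : ℝ) : ℂ) := by
  have h0 := (Submodule.mem_orthogonal _ _).1 (h.target_sub_residual_mem ha (G := G)) _
    (h.residual_mem ha)
  rw [inner_sub_right, sub_eq_zero, inner_self_eq_norm_sq_to_K] at h0
  rw [h0]
  push_cast
  rfl

theorem pi_factor_ne_zero : (1 / (2 * Real.pi) : ℂ) ≠ 0 := by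
  have : (Real.pi : ℂ) ≠ 0 := by exact_mod_cast Real.pi_ne_zero
  positivity

theorem pairFin_energy (h : IsRoot f g S) (w : G →₀ (Fin T → ℂ)) :
    pairFin (applyFin (matB G f g) w) w =
      (1 / (2 * Real.pi) : ℂ) * ((‖polyEmb h.memLp_inv (extendFin w)‖ ^ 2 : ℝ) : ℂ) := by
  rw [pairFin_eq_inner h.memLp_inv (applyFin_matB h w), inner_self_eq_norm_sq_to_K]
  push_cast
  rfl

/-- Any energy solution converges to the projection of the target: its limit lies in the closed
span, and convergence of the coordinates of `B (u k)` says that it differs from the target by an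
element of the orthogonal complement. -/
theorem EnergySolution.tendsto_residual (ha : Summable fun j => ‖a j‖) (h : IsRoot f g S)
    (hG : ∀ n : ℤ, 0 ≤ n → n ∈ G) {u : ℕ → G →₀ (Fin T → ℂ)}
    (hu : EnergySolution (matB G f g) (applySeq (matR G f g) (extCoeff T a G)) u) :
    Tendsto (fun k => polyEmb h.memLp_inv (extendFin (u k))) atTop (𝓝 (h.residual ha G)) := by
  obtain ⟨h1, h2⟩ := hu
  set v : ℕ → VecL2 T := fun k => polyEmb h.memLp_inv (extendFin (u k)) with hv
  have hcauchy : CauchySeq v := by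
    rw [cauchySeq_iff_tendsto_dist_atTop_0]
    have h3 : Tendsto (fun n : ℕ × ℕ => ‖v n.1 - v n.2‖ ^ 2) atTop (𝓝 0) := by
      have h4 := (h1.const_mul (1 / (2 * Real.pi) : ℂ)⁻¹).norm
      simp_rw [pairFin_energy h, ← mul_assoc, inv_mul_cancel₀ pi_factor_ne_zero, one_mul,
        mul_zero, norm_zero, Complex.norm_real, extendFin_sub, map_sub] at h4
      simpa using h4
    have h5 := (Real.continuous_sqrt.tendsto 0).comp h3
    simpa [Function.comp_def, Real.sqrt_sq, dist_eq_norm] using h5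
  obtain ⟨y, hy⟩ := cauchySeq_tendsto_of_complete hcauchy
  have hyN : y ∈ polySpace h.memLp_inv G :=
    (Submodule.isClosed_topologicalClosure _).mem_of_tendsto hy
      (Eventually.of_forall fun k => polyEmb_mem _ (extendFin_mem_supported _))
  have horth : h.target ha - y ∈ (polySpace h.memLp_inv G)ᗮ := by
    obtain ⟨b, hb, hby⟩ := exists_isL2_toLp_eq (h.target ha - y)
    rw [← hby, mem_polySpace_orthogonal h.memLp_inv h.isHermitian_inv]
    intro n hn ν
    rw [← inner_polyEmb_single_one h.memLp_inv h.isHermitian_inv n ν hb, hby,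
      inner_sub_right, sub_eq_zero]
    have h3 := (tendsto_pi_nhds.1 (h2 ⟨n, hn⟩) ν).const_mul (1 / (2 * Real.pi) : ℂ)⁻¹
    simp_rw [applyFin_matB h, applySeq_matR ha h hG, ← mul_assoc,
      inv_mul_cancel₀ pi_factor_ne_zero, one_mul] at h3
    have h4 : Tendsto (fun k => inner ℂ
        (polyEmb h.memLp_inv (Finsupp.single n (Pi.single ν 1))) (v k)) atTop
        (𝓝 (inner ℂ (polyEmb h.memLp_inv (Finsupp.single n (Pi.single ν 1))) y)) :=
      tendsto_const_nhds.inner hy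
    exact tendsto_nhds_unique h3 h4
  rw [IsRoot.residual, Submodule.eq_starProjection_of_mem_orthogonal hyN horth]
  exact hy

theorem exists_energySolution (ha : Summable fun j => ‖a j‖) (h : IsRoot f g S)
    (hG : ∀ n : ℤ, 0 ≤ n → n ∈ G) :
    ∃ u, EnergySolution (matB G f g) (applySeq (matR G f g) (extCoeff T a G)) u := by
  have hcl : h.residual ha G ∈ closure
      (((Finsupp.supported (Fin T → ℂ) ℂ G).map (polyEmb h.memLp_inv) : Submodule ℂ (VecL2 T)) :
        Set (VecL2 T)) := h.residual_mem ha
  obtain ⟨v, hv, hlim⟩ := mem_closure_iff_seq_limit.1 hcl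
  choose p hp hpv using hv
  choose u hu using fun k => exists_extendFin_eq (hp k)
  have huv (k : ℕ) : polyEmb h.memLp_inv (extendFin (u k)) = v k := by rw [hu, hpv]
  refine ⟨u, ?_, fun m => tendsto_pi_nhds.2 fun ν => ?_⟩
  · simp_rw [pairFin_energy h, extendFin_sub, map_sub, huv]
    have h1 := (cauchySeq_iff_tendsto_dist_atTop_0.1 hlim.cauchySeq)
    simp_rw [dist_eq_norm] at h1
    have h2 := ((Complex.continuous_ofReal.tendsto _).comp (h1.pow 2)).const_mul
      (1 / (2 * Real.pi) : ℂ)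
    simpa [Function.comp_def] using h2
  · simp_rw [applyFin_matB h, applySeq_matR ha h hG, huv]
    refine Tendsto.const_mul _ ?_
    have h1 : Tendsto (fun k => inner ℂ
        (polyEmb h.memLp_inv (Finsupp.single (m : ℤ) (Pi.single ν 1))) (v k)) atTop
        (𝓝 (inner ℂ (polyEmb h.memLp_inv (Finsupp.single (m : ℤ) (Pi.single ν 1)))
          (h.residual ha G))) := tendsto_const_nhds.inner hlim
    have h2 := (Submodule.mem_orthogonal _ _).1 (h.target_sub_residual_mem ha (G := G)) _
      (polyEmb_mem h.memLp_inv
        (Finsupp.single_mem_supported ℂ (Pi.single ν 1 : Fin T → ℂ) m.2))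
    rw [inner_sub_right, sub_eq_zero] at h2
    rw [← h2] at h1
    exact h1

/-- `⟨R a, B⁻¹ R a⟩` is the squared norm of the residual, up to the factor `1 / 2π`. -/
theorem isInverseForm_iff (ha : Summable fun j => ‖a j‖) (h : IsRoot f g S)
    (hG : ∀ n : ℤ, 0 ≤ n → n ∈ G) (r : ℂ) :
    IsInverseForm (matB G f g) (applySeq (matR G f g) (extCoeff T a G)) r ↔
      r = (1 / (2 * Real.pi) : ℂ) * ((‖h.residual ha G‖ ^ 2 : ℝ) : ℂ) := by
  have key : ∀ u, EnergySolution (matB G f g) (applySeq (matR G f g) (extCoeff T a G)) u →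
      Tendsto (fun k => pairFin (applySeq (matR G f g) (extCoeff T a G)) (u k)) atTop
        (𝓝 ((1 / (2 * Real.pi) : ℂ) * ((‖h.residual ha G‖ ^ 2 : ℝ) : ℂ))) := by
    intro u hu
    simp_rw [pairFin_eq_inner h.memLp_inv (applySeq_matR ha h hG)]
    rw [← h.inner_residual_target ha]
    exact ((hu.tendsto_residual ha h hG).inner tendsto_const_nhds).const_mul _
  constructor
  · rintro ⟨u, hu, hr⟩
    exact tendsto_nhds_unique hr (key u hu)
  · rintro rfl
    obtain ⟨u, hu⟩ := exists_energySolution ha h hG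
    exact ⟨u, hu, key u hu⟩

/-- The error coming from the noise at a known signal, `∫ A^⊤ f (f + g)⁻¹ g Ā`. -/
def noiseTerm (a : ℕ → ℂ) (f g : MatFun T) : ℝ :=
  ∫ x, (quad (f x * (f x + g x)⁻¹ * g x) (symbolA T a x)).re ∂freq

theorem IsRoot.quad_parallel_nonneg (h : IsRoot f g S) :
    ∀ᵐ x ∂freq, 0 ≤ quad (f x * (f x + g x)⁻¹ * g x) (symbolA T a x) := by
  filter_upwards [h.posSemidef_left, h.posSemidef_right, h.mul_self, h.isUnit] with x h1 h2 h3 h4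
  refine PCExtrapolation.quad_parallel_nonneg h1 h2 ?_ _
  rw [← h3, det_mul]; exact h4.mul h4

theorem IsRoot.noiseTerm_nonneg (h : IsRoot f g S) : 0 ≤ noiseTerm a f g :=
  integral_nonneg_of_ae
    ((h.quad_parallel_nonneg (a := a)).mono fun _ hx => (Complex.nonneg_iff.1 hx).1)

theorem integrable_quad (ha : Summable fun j => ‖a j‖) {M : MatFun T}
    (hM : ∀ i j, Integrable (fun x => M x i j) freq) :
    Integrable (fun x => quad (M x) (symbolA T a x)) freq := by
  have hA (x : ℝ) (ν : Fin T) : ‖star (symbolA T a x ν)‖ ≤ ∑' j, ‖blockCoeff T a j‖ := by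
    rw [norm_star]; exact norm_symbolA_le ha x ν
  refine integrable_finsetSum (f := fun i x => symbolA T a x i * (M x *ᵥ star (symbolA T a x)) i)
    Finset.univ fun i _ => ?_
  have hi : Integrable (fun x => (M x *ᵥ star (symbolA T a x)) i) freq :=
    integrable_finsetSum (f := fun j x => M x i j * star (symbolA T a x j)) Finset.univ fun j _ =>
      (hM i j).mul_bdd (aestronglyMeasurable_symbolA ha j).star
        (Eventually.of_forall fun x => hA x j)
  simpa [mul_comm] using hi.mul_bdd (aestronglyMeasurable_symbolA ha i)
    (Eventually.of_forall fun x => norm_symbolA_le ha x i)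

theorem integral_quad_parallel (h : IsRoot f g S) :
    ∫ x, quad (f x * (f x + g x)⁻¹ * g x) (symbolA T a x) ∂freq = (noiseTerm a f g : ℂ) := by
  rw [noiseTerm, ← integral_complex_ofReal]
  refine integral_congr_ae ?_
  filter_upwards [h.quad_parallel_nonneg (a := a)] with x hx
  obtain ⟨_, h2⟩ := Complex.nonneg_iff.1 hx
  exact Complex.ext rfl h2.symm

/-- The objective is well defined for a pair that satisfies the minimality condition. -/
theorem isObjective_iff (ha : Summable fun j => ‖a j‖) (h : IsRoot f g S)
    (hG : ∀ n : ℤ, 0 ≤ n → n ∈ G) (q : ℝ) :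
    IsObjective a G f g q ↔
      q = 1 / (2 * Real.pi) * (noiseTerm a f g + ‖h.residual ha G‖ ^ 2) := by
  have hpair := pairSeq_blockMatrix ha hG (integrable_parallel h)
  rw [integral_quad_parallel h] at hpair
  have : (1 / (2 * Real.pi) : ℂ) = ((1 / (2 * Real.pi) : ℝ) : ℂ) := by push_cast; rfl
  unfold IsObjective
  simp_rw [isInverseForm_iff ha h hG, matD, hpair, this]
  constructor
  · rintro ⟨r, rfl, hq⟩
    have hq' : (q : ℂ) =
        ((1 / (2 * Real.pi) * (noiseTerm a f g + ‖h.residual ha G‖ ^ 2) : ℝ) : ℂ) := by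
      rw [hq]; push_cast; ring
    exact_mod_cast hq'
  · rintro rfl
    exact ⟨_, rfl, by push_cast; ring⟩

/-! ### The mean square error in the Hilbert space -/

theorem weightedSq_eq (h : IsRoot f g S) (b : VecFun T) :
    weightedSq (f + g) b =
      ∫⁻ x, ENNReal.ofReal (‖WithLp.toLp 2 (b x ᵥ* S x)‖ ^ 2) ∂freq := by
  refine lintegral_congr_ae ?_
  filter_upwards [h.isHermitian, h.mul_self] with x h1 h2
  rw [Pi.add_apply, quad_re_eq_norm h1 h2]

theorem aestronglyMeasurable_pi {b : VecFun T} :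
    AEStronglyMeasurable b freq ↔ ∀ ν, AEStronglyMeasurable (fun x => b x ν) freq :=
  ⟨fun hb ν => (continuous_apply ν).comp_aestronglyMeasurable hb, fun hb =>
    (aemeasurable_pi_iff.2 fun ν => (hb ν).aemeasurable).aestronglyMeasurable⟩

/-- Membership in `L₂ˢ(f + g)` in terms of the square root. -/
theorem mem_L2span_iff (h : IsRoot f g S) {O : Set ℤ} {b : VecFun T}
    (hb : AEStronglyMeasurable b freq) :
    b ∈ L2span O (f + g) ↔
      ∃ hL : IsL2 (fun x => b x ᵥ* S x), hL.toLp ∈ polySpace h.memLp O := by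
  have hbm := aestronglyMeasurable_pi.1 hb
  have hm := aestronglyMeasurable_vecMul_apply hbm fun i j => (h.memLp i j).1
  have hdist (hL : IsL2 (fun x => b x ᵥ* S x)) (p : ℤ →₀ (Fin T → ℂ)) :
      weightedSq (f + g) (fun x => b x - trigPoly p x) =
        ENNReal.ofReal (‖hL.toLp - polyEmb h.memLp p‖ ^ 2) := by
    rw [weightedSq_eq h, polyEmb_apply, ← IsL2.toLp_sub, ← IsL2.lintegral_norm_sq]
    simp_rw [sub_vecMul]
  constructor
  · rintro ⟨-, hfin, happ⟩
    rw [weightedSq_eq h] at hfin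
    have hL := isL2_of_lintegral_lt_top hm hfin
    refine ⟨hL, Metric.mem_closure_iff.2 fun ε hε => ?_⟩
    obtain ⟨p, hp, hlt⟩ := happ (ENNReal.ofReal (ε ^ 2)) (by positivity)
    refine ⟨polyEmb h.memLp p, Submodule.mem_map_of_mem (fun n hn => hp n hn), ?_⟩
    rw [hdist hL, ENNReal.ofReal_lt_ofReal_iff (by positivity)] at hlt
    rw [dist_eq_norm]
    exact lt_of_pow_lt_pow_left₀ 2 hε.le hlt
  · rintro ⟨hL, hmem⟩
    refine ⟨hb, ?_, fun ε hε => ?_⟩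
    · rw [weightedSq_eq h, hL.lintegral_norm_sq]
      exact ENNReal.ofReal_lt_top
    · obtain ⟨δ, hδ, hδε⟩ : ∃ δ : ℝ, 0 < δ ∧ ENNReal.ofReal (δ ^ 2) ≤ ε := by
        rcases eq_or_ne ε ∞ with rfl | hε'
        · exact ⟨1, one_pos, le_top⟩
        · have := ENNReal.toReal_pos hε.ne' hε'
          refine ⟨Real.sqrt ε.toReal, Real.sqrt_pos.2 this, ?_⟩
          rw [Real.sq_sqrt this.le, ENNReal.ofReal_toReal hε']
      obtain ⟨_, ⟨p, hp, rfl⟩, hlt⟩ := Metric.mem_closure_iff.1 hmem δ hδ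
      refine ⟨p, fun n hn => hp hn, lt_of_lt_of_le ?_ hδε⟩
      rw [hdist hL, ENNReal.ofReal_lt_ofReal_iff (by positivity)]
      rw [dist_eq_norm] at hlt
      exact pow_lt_pow_left₀ hlt (norm_nonneg _) two_ne_zero

theorem aemeasurable_quad {M : MatFun T}
    (hM : ∀ i j, AEStronglyMeasurable (fun x => M x i j) freq) {b : VecFun T}
    (hb : ∀ ν, AEStronglyMeasurable (fun x => b x ν) freq) :
    AEMeasurable (fun x => ENNReal.ofReal (quad (M x) (b x)).re) freq := by
  refine AEMeasurable.ennreal_ofReal ?_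
  have : AEStronglyMeasurable (fun x => quad (M x) (b x)) freq := by
    simp only [quad, dotProduct_mulVec]
    simp only [dotProduct]
    exact Finset.aestronglyMeasurable_fun_sum _ fun ν _ =>
      (aestronglyMeasurable_vecMul_apply hb hM ν).mul (hb ν).star
  exact (Complex.continuous_re.comp_aestronglyMeasurable this).aemeasurable

/-- The mean square error splits into the noise term and a squared distance. -/
theorem mse_eq (ha : Summable fun j => ‖a j‖) (hf : IsSpectralDensity f)
    (hg : IsSpectralDensity g) (h : IsRoot f g S) {b : VecFun T}
    (hb : AEStronglyMeasurable b freq) (hL : IsL2 (fun x => b x ᵥ* S x)) :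
    mse a b f g = ENNReal.ofReal
      (1 / (2 * Real.pi) * (noiseTerm a f g + ‖hL.toLp - h.target ha‖ ^ 2)) := by
  have hbm := aestronglyMeasurable_pi.1 hb
  have hAm := aestronglyMeasurable_symbolA (T := T) ha
  have hfm (i j : Fin T) := (hf.integrable i j).1
  have hgm (i j : Fin T) := (hg.integrable i j).1
  have hpar (i j : Fin T) := (integrable_parallel h i j).1
  have hnn : 0 ≤ noiseTerm a f g := h.noiseTerm_nonneg
  have hpi : (0 : ℝ) ≤ 1 / (2 * Real.pi) := by have := Real.pi_pos; positivity
  have hnoise : ENNReal.ofReal (noiseTerm a f g) =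
      ∫⁻ x, ENNReal.ofReal (quad (f x * (f x + g x)⁻¹ * g x) (symbolA T a x)).re ∂freq := by
    rw [noiseTerm]
    exact ofReal_integral_eq_lintegral_ofReal (integrable_quad ha (integrable_parallel h)).re
      ((h.quad_parallel_nonneg (a := a)).mono fun x hx => (Complex.nonneg_iff.1 hx).1)
  rw [mse, ← mul_add, ENNReal.ofReal_mul hpi, ENNReal.ofReal_add hnn (sq_nonneg _), hnoise,
    IsRoot.target, ← IsL2.toLp_sub, ← IsL2.lintegral_norm_sq, weightedSq, weightedSq,
    ← lintegral_add_right' _ (aemeasurable_quad hgm hbm),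
    ← lintegral_add_left' (aemeasurable_quad hpar hAm)]
  congr 1
  refine lintegral_congr_ae ?_
  filter_upwards [h.posSemidef_left, h.posSemidef_right, h.isHermitian, h.mul_self, h.isUnit,
    h.quad_parallel_nonneg (a := a)] with x h1 h2 h3 h4 h5 h6
  have hu : IsUnit (f x + g x).det := by rw [← h4, det_mul]; exact h5.mul h5
  rw [← ENNReal.ofReal_add (quad_re_nonneg h1 _) (quad_re_nonneg h2 _),
    ← ENNReal.ofReal_add (Complex.nonneg_iff.1 h6).1 (sq_nonneg _), ← Complex.add_re,
    quad_sub_add_quad h1.isHermitian h2.isHermitian hu, Complex.add_re,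
    quad_re_eq_norm h3 h4, sub_vecMul, vecMul_vecMul]
  have hm : f x * (f x + g x)⁻¹ * S x = f x * (S x)⁻¹ := by
    rw [← h4, Matrix.mul_inv_rev, mul_assoc, mul_assoc, nonsing_inv_mul _ h5, mul_one]
  rw [hm]

/-- An estimate whose image is the target minus the residual is optimal, and this gives the
value of the minimal error. -/
theorem isOptimal_of_toLp_eq (ha : Summable fun j => ‖a j‖) (hf : IsSpectralDensity f)
    (hg : IsSpectralDensity g) (h : IsRoot f g S) (hG : ∀ n : ℤ, 0 ≤ n → n ∈ G)
    (hfin : (G ∩ {n | n < 0}).Finite) {b : VecFun T} (hb : AEStronglyMeasurable b freq)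
    (hL : IsL2 (fun x => b x ᵥ* S x)) (heq : hL.toLp = h.target ha - h.residual ha G) :
    IsOptimal a Gᶜ f g b ∧ minError a Gᶜ f g = ENNReal.ofReal
      (1 / (2 * Real.pi) * (noiseTerm a f g + ‖h.residual ha G‖ ^ 2)) := by
  have hmem : b ∈ L2span Gᶜ (f + g) := by
    rw [mem_L2span_iff h hb]
    refine ⟨hL, ?_⟩
    rw [heq, ← polySpace_inv_orthogonal h hG hfin]
    exact h.target_sub_residual_mem ha
  have hmse : mse a b f g = ENNReal.ofReal
      (1 / (2 * Real.pi) * (noiseTerm a f g + ‖h.residual ha G‖ ^ 2)) := by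
    rw [mse_eq ha hf hg h hb hL, heq, sub_sub_cancel_left, norm_neg]
  have hmin : minError a Gᶜ f g = ENNReal.ofReal
      (1 / (2 * Real.pi) * (noiseTerm a f g + ‖h.residual ha G‖ ^ 2)) := by
    refine le_antisymm (hmse ▸ iInf₂_le b hmem) (le_iInf₂ fun k hk => ?_)
    obtain ⟨hkL, hkm⟩ := (mem_L2span_iff h hk.1).1 hk
    rw [mse_eq ha hf hg h hk.1 hkL]
    refine ENNReal.ofReal_le_ofReal ?_
    have hpi : (0 : ℝ) ≤ 1 / (2 * Real.pi) := by have := Real.pi_pos; positivity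
    gcongr
    rw [← polySpace_inv_orthogonal h hG hfin] at hkm
    -- the projection of `k - target` onto the space of the residual is minus the residual
    have hproj : (polySpace h.memLp_inv G).starProjection (h.target ha - hkL.toLp) =
        h.residual ha G := by
      rw [map_sub, (Submodule.starProjection_apply_eq_zero_iff _).2 hkm, sub_zero]
      rfl
    rw [← hproj, norm_sub_rev hkL.toLp]
    exact Submodule.norm_starProjection_apply_le _ _
  exact ⟨⟨hmem, by rw [hmse, hmin]⟩, hmin⟩

/-- The image under the inverse square root of an element of the Hilbert space. -/
theorem exists_preimage (h : IsRoot f g S) (z : VecL2 T) :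
    ∃ b : VecFun T, AEStronglyMeasurable b freq ∧
      ∃ hL : IsL2 (fun x => b x ᵥ* S x), hL.toLp = z := by
  obtain ⟨c, hc, rfl⟩ := exists_isL2_toLp_eq z
  have hae : ∀ᵐ x ∂freq, c x ᵥ* (S x)⁻¹ ᵥ* S x = c x := by
    filter_upwards [h.isUnit] with x hx
    rw [vecMul_vecMul, nonsing_inv_mul _ hx, vecMul_one]
  have hL : IsL2 fun x => c x ᵥ* (S x)⁻¹ ᵥ* S x := fun ν =>
    (hc ν).ae_eq (hae.mono fun x hx => by simp only [hx])
  exact ⟨fun x => c x ᵥ* (S x)⁻¹, aestronglyMeasurable_pi.2 (aestronglyMeasurable_vecMul_apply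
    (fun ν => (hc ν).1) fun i j => (h.memLp_inv i j).1), hL, hL.toLp_congr hc hae⟩

/-- Under the minimality condition the objective is the error of the optimal estimate. -/
theorem isObjective_iff_minError (ha : Summable fun j => ‖a j‖) (hf : IsSpectralDensity f)
    (hg : IsSpectralDensity g) (hmin : Minimality f g) (hG : ∀ n : ℤ, 0 ≤ n → n ∈ G)
    (hfin : (G ∩ {n | n < 0}).Finite) :
    ∃ q₀ : ℝ, 0 ≤ q₀ ∧ minError a Gᶜ f g = ENNReal.ofReal q₀ ∧
      ∀ q, IsObjective a G f g q ↔ q = q₀ := by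
  obtain ⟨S, h⟩ := exists_isRoot hf hg hmin
  obtain ⟨b, hb, hL, heq⟩ := exists_preimage h (h.target ha - h.residual ha G)
  refine ⟨_, ?_, (isOptimal_of_toLp_eq ha hf hg h hG hfin hb hL heq).2,
    isObjective_iff ha h hG⟩
  have hnn : 0 ≤ noiseTerm a f g := h.noiseTerm_nonneg
  have := Real.pi_pos
  positivity

/-! ### The explicit spectral characteristic -/

/-- The coefficients of the approximating polynomials converge to the Fourier coefficients of the
residual. -/
theorem tendsto_coeff_residual (ha : Summable fun j => ‖a j‖) (h : IsRoot f g S)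
    {u : ℕ → G →₀ (Fin T → ℂ)}
    (hu : Tendsto (fun k => polyEmb h.memLp_inv (extendFin (u k))) atTop (𝓝 (h.residual ha G)))
    {y : VecFun T} (hy : IsL2 y) (hyr : hy.toLp = h.residual ha G) (n : ℤ) (ν : Fin T) :
    Tendsto (fun k => extendFin (u k) n ν) atTop
      (𝓝 ((1 / (2 * Real.pi) : ℂ) * ∫ x, (y x ᵥ* S x) ν * expI (-n) x ∂freq)) := by
  rw [← inner_polyEmb_single_one h.memLp h.isHermitian n ν hy, hyr]
  have h1 : Tendsto (fun k => inner ℂ (polyEmb h.memLp (Finsupp.single n (Pi.single ν 1)))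
      (polyEmb h.memLp_inv (extendFin (u k)))) atTop
      (𝓝 (inner ℂ (polyEmb h.memLp (Finsupp.single n (Pi.single ν 1))) (h.residual ha G))) :=
    tendsto_const_nhds.inner hu
  have h2 := h1.const_mul (1 / (2 * Real.pi) : ℂ)
  have hpi : (Real.pi : ℂ) ≠ 0 := by exact_mod_cast Real.pi_ne_zero
  refine h2.congr fun k => ?_
  rw [inner_polyEmb_polyEmb_inv h]
  field_simp

theorem formula_vecMul (h : IsRoot f g S) {b C y : VecFun T}
    (hb : ∀ᵐ x ∂freq, b x = (symbolA T a x ᵥ* f x - C x) ᵥ* (f x + g x)⁻¹)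
    (hC : ∀ᵐ x ∂freq, C x = y x ᵥ* S x) :
    ∀ᵐ x ∂freq, b x ᵥ* S x = symbolA T a x ᵥ* (f x * (S x)⁻¹) - y x := by
  filter_upwards [hb, hC, h.inv_mul_inv, h.isUnit] with x h1 h2 h3 h4
  rw [h1, h3, h2, vecMul_vecMul, mul_assoc, nonsing_inv_mul _ h4, mul_one, sub_vecMul,
    vecMul_vecMul, vecMul_vecMul, mul_nonsing_inv _ h4, vecMul_one]

theorem exists_isSpectralFormula (ha : Summable fun j => ‖a j‖) (h : IsRoot f g S)
    (hG : ∀ n : ℤ, 0 ≤ n → n ∈ G) : ∃ b : VecFun T, IsSpectralFormula a G f g b := by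
  obtain ⟨u, hu⟩ := exists_energySolution ha h hG
  obtain ⟨y, hy, hyr⟩ := exists_isL2_toLp_eq (h.residual ha G)
  have hlim := tendsto_coeff_residual ha h (hu.tendsto_residual ha h hG) hy hyr
  refine ⟨_, fun n ν => (1 / (2 * Real.pi) : ℂ) * ∫ x, (y x ᵥ* S x) ν * expI (-(n : ℤ)) x ∂freq,
    fun x => y x ᵥ* S x, ⟨u, hu, fun n => tendsto_pi_nhds.2 fun ν => ?_⟩,
    ⟨hy.integrable_vecMul h.memLp, fun n ν => ?_⟩, Eventually.of_forall fun x => rfl⟩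
  · simpa only [extendFin_apply_mem] using hlim n ν
  · simp only [expI_neg_eq]
    split_ifs with hn
    · rfl
    · refine tendsto_nhds_unique (hlim n ν) ?_
      simp only [extendFin_apply_notMem _ hn]
      exact tendsto_const_nhds

/-- A spectral characteristic given by the formula represents the target minus the residual. The
function `C` is determined by its Fourier coefficients, hence it represents the residual. -/
theorem IsSpectralFormula.toLp_eq (ha : Summable fun j => ‖a j‖) (hf : IsSpectralDensity f)
    (hg : IsSpectralDensity g) (h : IsRoot f g S) (hG : ∀ n : ℤ, 0 ≤ n → n ∈ G)
    {b : VecFun T} (hb : IsSpectralFormula a G f g b) :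
    AEStronglyMeasurable b freq ∧ ∃ hL : IsL2 (fun x => b x ᵥ* S x),
      hL.toLp = h.target ha - h.residual ha G := by
  obtain ⟨c, C, ⟨u, hu, huc⟩, ⟨hCi, hCc⟩, hbC⟩ := hb
  obtain ⟨y, hy, hyr⟩ := exists_isL2_toLp_eq (h.residual ha G)
  have hlim := tendsto_coeff_residual ha h (hu.tendsto_residual ha h hG) hy hyr
  have hyS := hy.integrable_vecMul h.memLp
  -- `C` and the residual have the same Fourier coefficients
  have hcoef (ν : Fin T) (n : ℤ) : ∫ x, C x ν * expI (-n) x ∂freq =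
      ∫ x, (y x ᵥ* S x) ν * expI (-n) x ∂freq := by
    have h1 := hCc n ν
    simp only [expI_neg_eq] at h1
    refine mul_left_cancel₀ pi_factor_ne_zero (h1.trans ?_)
    split_ifs with hn
    · refine tendsto_nhds_unique (tendsto_pi_nhds.1 (huc ⟨n, hn⟩) ν) ?_
      have := hlim n ν
      simpa only [extendFin_apply_mem _ (⟨n, hn⟩ : G)] using
        (this.congr fun k => by rw [← extendFin_apply_mem (u k) ⟨n, hn⟩])
    · refine (tendsto_nhds_unique (hlim n ν) ?_).symm
      simp only [extendFin_apply_notMem _ hn]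
      exact tendsto_const_nhds
  have hCy : ∀ᵐ x ∂freq, C x = y x ᵥ* S x := by
    have hν (ν : Fin T) : (fun x => C x ν - (y x ᵥ* S x) ν) =ᵐ[freq] 0 := by
      refine ae_eq_zero_of_fourier_eq_zero ((hCi ν).sub (hyS ν)) fun n => ?_
      simp_rw [sub_mul]
      rw [integral_sub (Integrable.mul_expI (hCi ν) n) (Integrable.mul_expI (hyS ν) n)]
      have := hcoef ν (-n)
      rw [neg_neg] at this
      rw [this, sub_self]
    filter_upwards [ae_all_iff.2 hν] with x hx
    ext ν
    exact sub_eq_zero.1 (hx ν)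
  have hae := formula_vecMul h hbC hCy
  have hbm : AEStronglyMeasurable b freq := by
    refine AEStronglyMeasurable.congr (aestronglyMeasurable_pi.2
      (aestronglyMeasurable_vecMul_apply (b := fun x => symbolA T a x ᵥ* f x - C x)
        (fun ν => ?_) (aestronglyMeasurable_inv_apply fun i j => ?_))) 
      (hbC.mono fun x hx => hx.symm)
    · exact (aestronglyMeasurable_vecMul_apply (aestronglyMeasurable_symbolA ha)
        (fun i j => (hf.integrable i j).1) ν).sub (hCi ν).1
    · exact (hf.integrable i j).1.add (hg.integrable i j).1
  have hsub := (isL2_target ha h).sub hy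
  have hL : IsL2 fun x => b x ᵥ* S x := fun ν =>
    (hsub ν).ae_eq (hae.mono fun x hx => by simp only [hx])
  refine ⟨hbm, hL, ?_⟩
  rw [hL.toLp_congr hsub hae, IsL2.toLp_sub (isL2_target ha h) hy, hyr]
  rfl

/-- The error of an arbitrary estimate exceeds the minimal error by the squared distance to the
spectral characteristic given by the formula. -/
theorem mse_eq_minError_add (ha : Summable fun j => ‖a j‖) (hf : IsSpectralDensity f)
    (hg : IsSpectralDensity g) (h : IsRoot f g S) (hG : ∀ n : ℤ, 0 ≤ n → n ∈ G)
    (hfin : (G ∩ {n | n < 0}).Finite) {b k : VecFun T} (hb : IsSpectralFormula a G f g b)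
    (hk : k ∈ L2span Gᶜ (f + g)) :
    mse a k f g = minError a Gᶜ f g +
      ENNReal.ofReal (1 / (2 * Real.pi)) * weightedSq (f + g) (fun x => k x - b x) := by
  obtain ⟨hbm, hL, heq⟩ := hb.toLp_eq ha hf hg h hG
  obtain ⟨hkL, hkm⟩ := (mem_L2span_iff h hk.1).1 hk
  have hw : weightedSq (f + g) (fun x => k x - b x) =
      ENNReal.ofReal (‖hkL.toLp - hL.toLp‖ ^ 2) := by
    rw [weightedSq_eq h, ← IsL2.toLp_sub, ← IsL2.lintegral_norm_sq]
    simp_rw [sub_vecMul]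
  have hpi : (0 : ℝ) ≤ 1 / (2 * Real.pi) := by have := Real.pi_pos; positivity
  have hnn : 0 ≤ noiseTerm a f g := h.noiseTerm_nonneg
  rw [(isOptimal_of_toLp_eq ha hf hg h hG hfin hbm hL heq).2, hw, ← ENNReal.ofReal_mul hpi,
    ← ENNReal.ofReal_add (by positivity) (by positivity), mse_eq ha hf hg h hk.1 hkL]
  congr 1
  have horth : hkL.toLp - hL.toLp ∈ (polySpace h.memLp_inv G)ᗮ := by
    refine Submodule.sub_mem _ ?_ (heq ▸ h.target_sub_residual_mem ha)
    rwa [polySpace_inv_orthogonal h hG hfin]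
  have h0 : inner ℂ (h.residual ha G) (hkL.toLp - hL.toLp) = 0 :=
    (Submodule.mem_orthogonal _ _).1 horth _ (h.residual_mem ha)
  have hsplit : hkL.toLp - h.target ha = hkL.toLp - hL.toLp - h.residual ha G := by
    rw [heq]; abel
  rw [hsplit, @norm_sub_sq ℂ, inner_eq_zero_symm.1 h0]
  simp only [map_zero, mul_zero, sub_zero]
  ring

theorem IsSpectralFormula.isOptimal (ha : Summable fun j => ‖a j‖) (hf : IsSpectralDensity f)
    (hg : IsSpectralDensity g) (hmin : Minimality f g) (hG : ∀ n : ℤ, 0 ≤ n → n ∈ G)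
    (hfin : (G ∩ {n | n < 0}).Finite) {b : VecFun T} (hb : IsSpectralFormula a G f g b) :
    IsOptimal a Gᶜ f g b := by
  obtain ⟨S, h⟩ := exists_isRoot hf hg hmin
  obtain ⟨hbm, hL, heq⟩ := hb.toLp_eq ha hf hg h hG
  exact (isOptimal_of_toLp_eq ha hf hg h hG hfin hbm hL heq).1

end Energy

/-! ### Approximation by trigonometric polynomials and convexity -/

section Convexity

variable {T : ℕ} {a : ℕ → ℂ}

theorem IsSpectralDensity.aesm {f : MatFun T} (hf : IsSpectralDensity f) (i j : Fin T) :
    AEStronglyMeasurable (fun x => f x i j) freq := (hf.integrable i j).1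

theorem weightedSq_lt_top {F : MatFun T} (hF : ∀ i j, Integrable (fun x => F x i j) freq)
    {b : VecFun T} {c : ℝ} (hb : ∀ x ν, ‖b x ν‖ ≤ c) : weightedSq F b < ∞ := by
  have hi : Integrable (fun x => ∑ i, ∑ j, c * (‖F x i j‖ * c)) freq :=
    integrable_finsetSum _ fun i _ => integrable_finsetSum _ fun j _ =>
      ((hF i j).norm.mul_const c).const_mul c
  refine lt_of_le_of_lt (lintegral_mono fun x => ENNReal.ofReal_le_ofReal ?_)
    hi.lintegral_lt_top
  refine (Complex.re_le_norm _).trans ?_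
  rw [quad, dotProduct]
  refine (norm_sum_le _ _).trans (Finset.sum_le_sum fun i _ => ?_)
  rw [norm_mul, ← Finset.mul_sum]
  refine mul_le_mul (hb x i) ?_ (norm_nonneg _) ((norm_nonneg _).trans (hb x i))
  rw [mulVec, dotProduct]
  refine (norm_sum_le _ _).trans (Finset.sum_le_sum fun j _ => ?_)
  rw [norm_mul, Pi.star_apply, norm_star]
  exact mul_le_mul_of_nonneg_left (hb x j) (norm_nonneg _)

theorem weightedSq_add_left {F G : MatFun T} (hF : IsSpectralDensity F)
    (hG : IsSpectralDensity G) {b : VecFun T}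
    (hb : ∀ ν, AEStronglyMeasurable (fun x => b x ν) freq) :
    weightedSq (F + G) b = weightedSq F b + weightedSq G b := by
  rw [weightedSq, weightedSq, weightedSq, ← lintegral_add_left' (aemeasurable_quad hF.aesm hb)]
  refine lintegral_congr_ae ?_
  filter_upwards [hF.posSemidef, hG.posSemidef] with x h1 h2
  rw [Pi.add_apply, quad_add_left, Complex.add_re,
    ENNReal.ofReal_add (quad_re_nonneg h1 _) (quad_re_nonneg h2 _)]

theorem weightedSq_smul_left {F : MatFun T} {t : ℝ} (ht : 0 ≤ t) (b : VecFun T) :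
    weightedSq (t • F) b = ENNReal.ofReal t * weightedSq F b := by
  rw [weightedSq, weightedSq, ← lintegral_const_mul' _ _ ENNReal.ofReal_ne_top]
  refine lintegral_congr fun x => ?_
  rw [Pi.smul_apply, quad_smul_left, Complex.smul_re, smul_eq_mul, ENNReal.ofReal_mul ht]

theorem IsSpectralDensity.smul {F : MatFun T} (hF : IsSpectralDensity F) {t : ℝ} (ht : 0 ≤ t) :
    IsSpectralDensity (t • F) where
  integrable i j := (hF.integrable i j).smul t
  posSemidef := by
    filter_upwards [hF.posSemidef] with x hx
    exact hx.smul ht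

theorem IsSpectralDensity.add {F G : MatFun T} (hF : IsSpectralDensity F)
    (hG : IsSpectralDensity G) : IsSpectralDensity (F + G) where
  integrable i j := (hF.integrable i j).add (hG.integrable i j)
  posSemidef := by
    filter_upwards [hF.posSemidef, hG.posSemidef] with x h1 h2
    exact h1.add h2

theorem weightedSq_combo {F G : MatFun T} (hF : IsSpectralDensity F) (hG : IsSpectralDensity G)
    {α β : ℝ} (hα : 0 ≤ α) (hβ : 0 ≤ β) {b : VecFun T}
    (hb : ∀ ν, AEStronglyMeasurable (fun x => b x ν) freq) :
    weightedSq (α • F + β • G) b =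
      ENNReal.ofReal α * weightedSq F b + ENNReal.ofReal β * weightedSq G b := by
  rw [weightedSq_add_left (hF.smul hα) (hG.smul hβ) hb, weightedSq_smul_left hα,
    weightedSq_smul_left hβ]

/-- The mean square error of a fixed estimate is affine in the pair of spectral densities. -/
theorem mse_combo (ha : Summable fun j => ‖a j‖) {f₀ g₀ f g : MatFun T}
    (hf₀ : IsSpectralDensity f₀) (hg₀ : IsSpectralDensity g₀)
    (hf : IsSpectralDensity f) (hg : IsSpectralDensity g) {α β : ℝ} (hα : 0 ≤ α) (hβ : 0 ≤ β)
    {b : VecFun T} (hb : ∀ ν, AEStronglyMeasurable (fun x => b x ν) freq) :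
    mse a b (α • f₀ + β • f) (α • g₀ + β • g) =
      ENNReal.ofReal α * mse a b f₀ g₀ + ENNReal.ofReal β * mse a b f g := by
  rw [mse, mse, mse, weightedSq_combo hg₀ hg hα hβ hb, weightedSq_combo hf₀ hf hα hβ
    (b := fun x => symbolA T a x - b x)
    fun ν => (aestronglyMeasurable_symbolA ha ν).sub (hb ν)]
  ring

theorem trigPoly_mem_L2span {F : MatFun T} (hF : IsSpectralDensity F) {O : Set ℤ}
    {p : ℤ →₀ (Fin T → ℂ)} (hp : ∀ n ∈ p.support, n ∈ O) : trigPoly p ∈ L2span O F := by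
  refine ⟨(continuous_trigPoly p).aestronglyMeasurable,
    weightedSq_lt_top hF.integrable (norm_trigPoly_le p), fun ε hε => ⟨p, hp, ?_⟩⟩
  have : weightedSq F (fun x => trigPoly p x - trigPoly p x) = 0 := by
    simp [weightedSq, quad]
  rwa [this]

theorem weightedSq_add_le {F : MatFun T} (hF : IsSpectralDensity F) {b c : VecFun T}
    (hb : ∀ ν, AEStronglyMeasurable (fun x => b x ν) freq) {t : ℝ} (ht : 0 < t) :
    weightedSq F (fun x => b x + c x) ≤
      ENNReal.ofReal (1 + t) * weightedSq F b + ENNReal.ofReal (1 + t⁻¹) * weightedSq F c := by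
  rw [weightedSq, weightedSq, weightedSq, ← lintegral_const_mul' _ _ ENNReal.ofReal_ne_top,
    ← lintegral_const_mul' _ _ ENNReal.ofReal_ne_top,
    ← lintegral_add_left' ((aemeasurable_quad hF.aesm hb).const_mul _)]
  refine lintegral_mono_ae ?_
  filter_upwards [hF.posSemidef] with x hx
  have ht' : 0 < t⁻¹ := inv_pos.2 ht
  rw [← ENNReal.ofReal_mul (by positivity), ← ENNReal.ofReal_mul (by positivity),
    ← ENNReal.ofReal_add (mul_nonneg (by positivity) (quad_re_nonneg hx _))
      (mul_nonneg (by positivity) (quad_re_nonneg hx _))]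
  exact ENNReal.ofReal_le_ofReal (quad_re_add_le hx _ _ ht)

theorem weightedSq_neg (F : MatFun T) (b : VecFun T) :
    weightedSq F (fun x => -b x) = weightedSq F b := by
  simp [weightedSq, quad, mulVec_neg]

/-- The error of an element of `L₂ˢ(f + g)` can be approached by trigonometric polynomials. -/
theorem exists_trigPoly_mse_lt (ha : Summable fun j => ‖a j‖) {f g : MatFun T}
    (hf : IsSpectralDensity f) (hg : IsSpectralDensity g) {O : Set ℤ} {e : ℝ≥0∞}
    (he : minError a O f g < e) :
    ∃ p : ℤ →₀ (Fin T → ℂ), (∀ n ∈ p.support, n ∈ O) ∧ mse a (trigPoly p) f g < e := by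
  obtain ⟨b, hb, hbe⟩ : ∃ b ∈ L2span O (f + g), mse a b f g < e := by
    simpa only [minError, iInf_lt_iff, exists_prop] using he
  have hbm := aestronglyMeasurable_pi.1 hb.1
  obtain ⟨e', h1, h2⟩ := exists_between hbe
  have he' : e' ≠ ∞ := h2.ne_top
  have hm : mse a b f g ≠ ∞ := h1.ne_top
  set m := (mse a b f g).toReal with hmdef
  have hmof : mse a b f g = ENNReal.ofReal m := (ENNReal.ofReal_toReal hm).symm
  have hm0 : 0 ≤ m := ENNReal.toReal_nonneg
  have hlt : m < e'.toReal := (ENNReal.toReal_lt_toReal hm he').2 h1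
  -- `(1 + t) m ≤ e'`
  set t : ℝ := (e'.toReal - m) / (m + 1) with ht
  have htpos : 0 < t := div_pos (by linarith) (by linarith)
  have htm : (1 + t) * m ≤ e'.toReal := by
    have : t * (m + 1) = e'.toReal - m := by rw [ht]; field_simp
    nlinarith
  set κ : ℝ≥0∞ := ENNReal.ofReal (1 + t⁻¹) * ENNReal.ofReal (1 / (2 * Real.pi)) with hκ
  have hκtop : κ ≠ ∞ := ENNReal.mul_ne_top ENNReal.ofReal_ne_top ENNReal.ofReal_ne_top
  have hdiff : e - e' ≠ 0 := (tsub_pos_of_lt h2).ne'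
  obtain ⟨p, hp, hpw⟩ := hb.2.2 ((e - e') / κ) (ENNReal.div_pos hdiff hκtop)
  refine ⟨p, hp, ?_⟩
  have hw := ENNReal.mul_lt_of_lt_div' hpw
  have hdm : ∀ ν, AEStronglyMeasurable (fun x => (b x - trigPoly p x) ν) freq := fun ν =>
    (hbm ν).sub (aestronglyMeasurable_trigPoly p ν)
  have hf1 : weightedSq f (fun x => symbolA T a x - trigPoly p x) ≤
      ENNReal.ofReal (1 + t) * weightedSq f (fun x => symbolA T a x - b x) +
        ENNReal.ofReal (1 + t⁻¹) * weightedSq f (fun x => b x - trigPoly p x) := by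
    have := weightedSq_add_le hf (b := fun x => symbolA T a x - b x)
      (c := fun x => b x - trigPoly p x)
      (fun ν => (aestronglyMeasurable_symbolA ha ν).sub (hbm ν)) htpos
    simpa only [sub_add_sub_cancel] using this
  have hg1 : weightedSq g (trigPoly p) ≤ ENNReal.ofReal (1 + t) * weightedSq g b +
      ENNReal.ofReal (1 + t⁻¹) * weightedSq g (fun x => b x - trigPoly p x) := by
    have := weightedSq_add_le hg (b := b) (c := fun x => -(b x - trigPoly p x)) hbm htpos
    rw [weightedSq_neg g (fun x => b x - trigPoly p x)] at this
    simpa only [neg_sub, add_sub_cancel] using this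
  calc mse a (trigPoly p) f g
      ≤ ENNReal.ofReal (1 / (2 * Real.pi)) *
          (ENNReal.ofReal (1 + t) * weightedSq f (fun x => symbolA T a x - b x) +
            ENNReal.ofReal (1 + t⁻¹) * weightedSq f (fun x => b x - trigPoly p x)) +
        ENNReal.ofReal (1 / (2 * Real.pi)) * (ENNReal.ofReal (1 + t) * weightedSq g b +
          ENNReal.ofReal (1 + t⁻¹) * weightedSq g (fun x => b x - trigPoly p x)) := by
        rw [mse]; gcongr
    _ = ENNReal.ofReal (1 + t) * mse a b f g +
          κ * weightedSq (f + g) (fun x => b x - trigPoly p x) := by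
        rw [weightedSq_add_left hf hg hdm, mse, hκ]; ring
    _ ≤ e' + κ * weightedSq (f + g) (fun x => b x - trigPoly p x) := by
        gcongr
        rw [hmof, ← ENNReal.ofReal_mul (by positivity), ← ENNReal.ofReal_toReal he']
        exact ENNReal.ofReal_le_ofReal htm
    _ < e' + (e - e') := ENNReal.add_lt_add_left he' hw
    _ = e := add_tsub_cancel_of_le h2.le

theorem mse_trigPoly_ne_top (ha : Summable fun j => ‖a j‖) {f g : MatFun T}
    (hf : IsSpectralDensity f) (hg : IsSpectralDensity g) (p : ℤ →₀ (Fin T → ℂ)) :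
    mse a (trigPoly p) f g ≠ ∞ := by
  refine ENNReal.add_ne_top.2 ⟨ENNReal.mul_ne_top ENNReal.ofReal_ne_top
    (weightedSq_lt_top hf.integrable (c := ∑' j, ‖blockCoeff T a j‖ + ∑ n ∈ p.support, ‖p n‖)
      fun x ν => ?_).ne, ENNReal.mul_ne_top ENNReal.ofReal_ne_top
    (weightedSq_lt_top hg.integrable (norm_trigPoly_le p)).ne⟩
  exact (norm_sub_le _ _).trans (add_le_add (norm_symbolA_le ha x ν) (norm_trigPoly_le p x ν))

theorem minError_le_mse_trigPoly {f g : MatFun T} (hf : IsSpectralDensity f)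
    (hg : IsSpectralDensity g) {O : Set ℤ} {p : ℤ →₀ (Fin T → ℂ)}
    (hp : ∀ n ∈ p.support, n ∈ O) : minError a O f g ≤ mse a (trigPoly p) f g :=
  iInf₂_le _ (trigPoly_mem_L2span (hf.add hg) hp)

/-- The minimal error is concave in the pair of spectral densities. -/
theorem minError_concave (ha : Summable fun j => ‖a j‖) {f₀ g₀ f g : MatFun T}
    (hf₀ : IsSpectralDensity f₀) (hg₀ : IsSpectralDensity g₀)
    (hf : IsSpectralDensity f) (hg : IsSpectralDensity g) (O : Set ℤ) {α β : ℝ} (hα : 0 ≤ α)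
    (hβ : 0 ≤ β) :
    ENNReal.ofReal α * minError a O f₀ g₀ + ENNReal.ofReal β * minError a O f g ≤
      minError a O (α • f₀ + β • f) (α • g₀ + β • g) := by
  refine le_of_forall_gt fun e he => ?_
  obtain ⟨p, hp, hpe⟩ := exists_trigPoly_mse_lt ha ((hf₀.smul hα).add (hf.smul hβ))
    ((hg₀.smul hα).add (hg.smul hβ)) he
  refine lt_of_le_of_lt ?_ hpe
  rw [mse_combo ha hf₀ hg₀ hf hg hα hβ (aestronglyMeasurable_trigPoly p)]
  gcongr
  · exact minError_le_mse_trigPoly hf₀ hg₀ hp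
  · exact minError_le_mse_trigPoly hf hg hp

theorem quad_vecMul_inv {F : Matrix (Fin T) (Fin T) ℂ} (hF : F.IsHermitian) (hu : IsUnit F.det)
    (v : Fin T → ℂ) : quad F (v ᵥ* F⁻¹) = quad F⁻¹ v := by
  rw [quad, quad, star_vecMul, hF.inv.eq, mulVec_mulVec, mul_nonsing_inv _ hu, one_mulVec,
    ← dotProduct_mulVec]

/-- The inverse is antitone: adding a positive semidefinite matrix decreases the inverse. -/
theorem quad_add_inv_le {f g : Matrix (Fin T) (Fin T) ℂ} (hf : f.PosSemidef) (hg : g.PosSemidef)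
    (huf : IsUnit f.det) (hu : IsUnit (f + g).det) (v : Fin T → ℂ) :
    (quad (f + g)⁻¹ v).re ≤ (quad f⁻¹ v).re := by
  have h := congrArg Complex.re
    (quad_sub_add_quad hf.isHermitian hg.isHermitian hu (-(v ᵥ* f⁻¹)) 0)
  have h0 : quad g (0 : Fin T → ℂ) = 0 := by simp [quad]
  have hneg (F : Matrix (Fin T) (Fin T) ℂ) (w : Fin T → ℂ) : quad F (-w) = quad F w := by
    simp [quad, mulVec_neg]
  rw [sub_zero, h0, add_zero, hneg, quad_vecMul_inv hf.isHermitian huf, zero_sub, neg_vecMul,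
    neg_neg, vecMul_vecMul, ← mul_assoc, nonsing_inv_mul _ huf, one_mul,
    quad_vecMul_inv (hf.add hg).isHermitian hu, Complex.add_re] at h
  linarith [(Complex.nonneg_iff.1 (quad_parallel_nonneg hf hg hu (-(v ᵥ* f⁻¹)))).1]

/-- The minimality condition passes to combinations with a positive share of a pair that
satisfies it. -/
theorem Minimality.combo {f₀ g₀ f g : MatFun T} (hmin : Minimality f₀ g₀)
    (hf₀ : IsSpectralDensity f₀) (hg₀ : IsSpectralDensity g₀)
    (hf : IsSpectralDensity f) (hg : IsSpectralDensity g) {α β : ℝ} (hα : 0 < α) (hβ : 0 ≤ β) :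
    Minimality (α • f₀ + β • f) (α • g₀ + β • g) := by
  have hF : ∀ x, (α • f₀ + β • f) x + (α • g₀ + β • g) x =
      α • (f₀ x + g₀ x) + β • (f x + g x) := fun x => by
    simp only [Pi.add_apply, Pi.smul_apply, smul_add]; abel
  have hpos : ∀ᵐ x ∂freq, (α • (f₀ x + g₀ x)).PosSemidef ∧ (β • (f x + g x)).PosSemidef ∧
      IsUnit (α • (f₀ x + g₀ x)).det ∧ IsUnit (α • (f₀ x + g₀ x) + β • (f x + g x)).det := by
    filter_upwards [hf₀.posSemidef, hg₀.posSemidef, hf.posSemidef, hg.posSemidef, hmin.1]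
      with x h1 h2 h3 h4 h5
    have hp0 : (f₀ x + g₀ x).PosDef := by
      rw [(h1.add h2).posDef_iff_det_ne_zero]; exact h5.ne_zero
    have hp1 : (α • (f₀ x + g₀ x)).PosDef := hp0.smul hα
    have hp2 : (β • (f x + g x)).PosSemidef := (h3.add h4).smul hβ
    exact ⟨hp1.posSemidef, hp2, (isUnit_iff_isUnit_det _).1 hp1.isUnit,
      (isUnit_iff_isUnit_det _).1 (hp1.add_posSemidef hp2).isUnit⟩
  refine ⟨hpos.mono fun x hx => by rw [hF]; exact hx.2.2.2, ?_⟩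
  have hm := aestronglyMeasurable_inv_apply (M := fun x =>
    (α • f₀ + β • f) x + (α • g₀ + β • g) x) fun i j =>
      (((hf₀.smul hα.le).add (hf.smul hβ)).add ((hg₀.smul hα.le).add (hg.smul hβ))).aesm i j
  refine (hmin.2.re.const_mul α⁻¹).mono' ?_ ?_
  · exact Finset.aestronglyMeasurable_fun_sum _ fun i _ => hm i i
  · filter_upwards [hpos, hmin.1] with x ⟨h1, h2, h3, h4⟩ h5
    have hinv : (α • (f₀ x + g₀ x))⁻¹ = α⁻¹ • (f₀ x + g₀ x)⁻¹ := by
      refine inv_eq_right_inv ?_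
      rw [smul_mul_smul_comm, mul_inv_cancel₀ hα.ne', mul_nonsing_inv _ h5, one_smul]
    rw [hF, trace, trace]
    refine (norm_sum_le _ _).trans ?_
    rw [map_sum, Finset.mul_sum]
    refine Finset.sum_le_sum fun i _ => ?_
    rw [diag_apply, diag_apply, ← quad_single (α • (f₀ x + g₀ x) + β • (f x + g x))⁻¹,
      ← quad_single (f₀ x + g₀ x)⁻¹]
    have hnn := quad_nonneg (h1.add h2).inv (Pi.single i 1)
    have hle := quad_add_inv_le h1 h2 h3 h4 (Pi.single i 1)
    rw [hinv, quad_smul_left, Complex.smul_re, smul_eq_mul] at hle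
    rw [← Complex.re_eq_norm.2 hnn]
    exact hle

/-! ### Least favorable densities and minimax estimates -/

/-- Lower semicontinuity of the mean square error under almost everywhere convergence. -/
theorem mse_le_of_tendsto (ha : Summable fun j => ‖a j‖) {f g : MatFun T}
    (hf : IsSpectralDensity f) (hg : IsSpectralDensity g) {b : ℕ → VecFun T} {b₀ : VecFun T}
    (hb : ∀ k ν, AEStronglyMeasurable (fun x => b k x ν) freq)
    (hlim : ∀ᵐ x ∂freq, Tendsto (fun k => b k x) atTop (𝓝 (b₀ x))) {c : ℕ → ℝ≥0∞} {c₀ : ℝ≥0∞}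
    (hc : Tendsto c atTop (𝓝 c₀)) (hle : ∀ k, mse a (b k) f g ≤ c k) : mse a b₀ f g ≤ c₀ := by
  set I : VecFun T → ℝ → ℝ≥0∞ := fun b x => ENNReal.ofReal (1 / (2 * Real.pi)) *
    (ENNReal.ofReal (quad (f x) (symbolA T a x - b x)).re +
      ENNReal.ofReal (quad (g x) (b x)).re) with hI
  have hb₀ : ∀ ν, AEStronglyMeasurable (fun x => b₀ x ν) freq := fun ν =>
    aestronglyMeasurable_of_tendsto_ae atTop (fun k => hb k ν)
      (hlim.mono fun x hx => tendsto_pi_nhds.1 hx ν)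
  have hmse (b : VecFun T) (hb : ∀ ν, AEStronglyMeasurable (fun x => b x ν) freq) :
      mse a b f g = ∫⁻ x, I b x ∂freq := by
    rw [mse, ← mul_add, weightedSq, weightedSq, ← lintegral_add_right' _
      (aemeasurable_quad hg.aesm hb), lintegral_const_mul' _ _ ENNReal.ofReal_ne_top]
  have hIm (k : ℕ) : AEMeasurable (I (b k)) freq :=
    ((aemeasurable_quad hf.aesm (b := fun x => symbolA T a x - b k x) fun ν =>
      (aestronglyMeasurable_symbolA ha ν).sub (hb k ν)).add
        (aemeasurable_quad hg.aesm (hb k))).const_mul _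
  have hIlim : ∀ᵐ x ∂freq, Tendsto (fun k => I (b k) x) atTop (𝓝 (I b₀ x)) := by
    filter_upwards [hlim] with x hx
    have hq (F : Matrix (Fin T) (Fin T) ℂ) : Continuous fun v : Fin T → ℂ =>
        ENNReal.ofReal (quad F v).re := by
      have : Continuous fun v : Fin T → ℂ => (quad F v).re := by
        unfold quad
        fun_prop
      exact ENNReal.continuous_ofReal.comp this
    refine ENNReal.Tendsto.const_mul ?_ (Or.inr ENNReal.ofReal_ne_top)
    exact (((hq (f x)).tendsto _).comp (tendsto_const_nhds.sub hx)).add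
      (((hq (g x)).tendsto _).comp hx)
  rw [hmse b₀ hb₀]
  calc ∫⁻ x, I b₀ x ∂freq = ∫⁻ x, liminf (fun k => I (b k) x) atTop ∂freq :=
        lintegral_congr_ae (hIlim.mono fun x hx => hx.liminf_eq.symm)
    _ ≤ liminf (fun k => ∫⁻ x, I (b k) x ∂freq) atTop := lintegral_liminf_le' hIm
    _ ≤ liminf c atTop := liminf_le_liminf (Eventually.of_forall fun k => by
        rw [← hmse _ (hb k)]; exact hle k)
    _ = c₀ := hc.liminf_eq

/-- Convergence in the weighted space yields almost everywhere convergence of a subsequence. -/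
theorem exists_subseq_tendsto_ae {f g S : MatFun T} (h : IsRoot f g S) {b : ℕ → VecFun T}
    {b₀ : VecFun T} (hb : ∀ k ν, AEStronglyMeasurable (fun x => b k x ν) freq)
    (hb₀ : ∀ ν, AEStronglyMeasurable (fun x => b₀ x ν) freq)
    (hlim : Tendsto (fun k => weightedSq (f + g) (fun x => b k x - b₀ x)) atTop (𝓝 0)) :
    ∃ ns : ℕ → ℕ, StrictMono ns ∧
      ∀ᵐ x ∂freq, Tendsto (fun k => b (ns k) x) atTop (𝓝 (b₀ x)) := by
  have hm (k : ℕ) : AEStronglyMeasurable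
      (fun x => WithLp.toLp 2 ((b k x - b₀ x) ᵥ* S x)) freq :=
    (PiLp.continuous_toLp 2 _).comp_aestronglyMeasurable (aestronglyMeasurable_pi.2
      (aestronglyMeasurable_vecMul_apply (b := fun x => b k x - b₀ x)
        (fun ν => (hb k ν).sub (hb₀ ν)) fun i j => (h.memLp i j).1))
  have hmeas : TendstoInMeasure freq
      (fun k x => ‖WithLp.toLp 2 ((b k x - b₀ x) ᵥ* S x)‖ ^ 2) atTop (fun _ => 0) := by
    refine tendstoInMeasure_of_tendsto_eLpNorm (p := 1) one_ne_zero
      (fun k => (hm k).norm.pow 2) aestronglyMeasurable_const ?_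
    refine hlim.congr fun k => ?_
    rw [weightedSq_eq h, eLpNorm_one_eq_lintegral_enorm]
    refine lintegral_congr fun x => ?_
    rw [Pi.sub_apply, sub_zero, Real.enorm_of_nonneg (sq_nonneg _)]
  obtain ⟨ns, hns, hae⟩ := hmeas.exists_seq_tendsto_ae
  refine ⟨ns, hns, ?_⟩
  filter_upwards [hae, h.isUnit] with x hx hu
  have h1 : Tendsto (fun k => WithLp.toLp 2 ((b (ns k) x - b₀ x) ᵥ* S x)) atTop (𝓝 0) := by
    rw [tendsto_zero_iff_norm_tendsto_zero]
    have := (Real.continuous_sqrt.tendsto 0).comp hx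
    simpa [Function.comp_def, Real.sqrt_sq] using this
  have h2 : Tendsto (fun k => (b (ns k) x - b₀ x) ᵥ* S x) atTop (𝓝 0) :=
    ((PiLp.continuous_ofLp 2 _).tendsto 0).comp h1
  have hcont : Continuous fun v : Fin T → ℂ => v ᵥ* (S x)⁻¹ + b₀ x := by fun_prop
  have h3 := (hcont.tendsto 0).comp h2
  simpa [Function.comp_def, vecMul_vecMul, mul_nonsing_inv _ hu] using h3

variable {G : Set ℤ} {Df Dg : Set (MatFun T)} {f₀ g₀ : MatFun T}

theorem minError_le_of_solvesMaxProblem (ha : Summable fun j => ‖a j‖)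
    (hG : ∀ n : ℤ, 0 ≤ n → n ∈ G) (hfin : (G ∩ {n | n < 0}).Finite)
    (hDf : ∀ f ∈ Df, IsSpectralDensity f) (hDg : ∀ g ∈ Dg, IsSpectralDensity g)
    (hf₀ : f₀ ∈ Df) (hg₀ : g₀ ∈ Dg) (hmin : Minimality f₀ g₀)
    (hmax : SolvesMaxProblem a G Df Dg f₀ g₀) {f g : MatFun T} (hf : f ∈ Df) (hg : g ∈ Dg)
    (hfg : Minimality f g) : minError a Gᶜ f g ≤ minError a Gᶜ f₀ g₀ := by
  obtain ⟨q, -, hq, hqi⟩ := isObjective_iff_minError ha (hDf f hf) (hDg g hg) hfg hG hfin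
  obtain ⟨q₀, -, hq₀, hqi₀⟩ := isObjective_iff_minError ha (hDf _ hf₀) (hDg _ hg₀) hmin hG hfin
  obtain ⟨q', hq', hle⟩ := hmax
  rw [hq, hq₀, ← (hqi₀ q').1 hq']
  exact ENNReal.ofReal_le_ofReal (hle f hf g hg hfg q ((hqi q).2 rfl))

theorem minError_ne_top (ha : Summable fun j => ‖a j‖) {f g : MatFun T}
    (hf : IsSpectralDensity f) (hg : IsSpectralDensity g) (O : Set ℤ) :
    minError a O f g ≠ ∞ :=
  ne_top_of_le_ne_top (mse_trigPoly_ne_top ha hf hg 0)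
    (minError_le_mse_trigPoly hf hg (by simp))

theorem minError_le_of_convex (ha : Summable fun j => ‖a j‖)
    (hG : ∀ n : ℤ, 0 ≤ n → n ∈ G) (hfin : (G ∩ {n | n < 0}).Finite)
    (hDf : ∀ f ∈ Df, IsSpectralDensity f) (hDg : ∀ g ∈ Dg, IsSpectralDensity g)
    (hf₀ : f₀ ∈ Df) (hg₀ : g₀ ∈ Dg) (hmin : Minimality f₀ g₀)
    (hmax : SolvesMaxProblem a G Df Dg f₀ g₀) (hcf : Convex ℝ Df) (hcg : Convex ℝ Dg)
    {f g : MatFun T} (hf : f ∈ Df) (hg : g ∈ Dg) :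
    minError a Gᶜ f g ≤ minError a Gᶜ f₀ g₀ := by
  have hhalf : (0 : ℝ) < 1 / 2 := by norm_num
  -- the midpoint with `(f₀, g₀)` satisfies the minimality condition
  have h1 := minError_le_of_solvesMaxProblem ha hG hfin hDf hDg hf₀ hg₀ hmin hmax
    (hcf hf₀ hf hhalf.le hhalf.le (by norm_num)) (hcg hg₀ hg hhalf.le hhalf.le (by norm_num))
    (hmin.combo (hDf _ hf₀) (hDg _ hg₀) (hDf f hf) (hDg g hg) hhalf hhalf.le)
  have h2 := (minError_concave ha (hDf _ hf₀) (hDg _ hg₀) (hDf f hf) (hDg g hg) Gᶜ hhalf.le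
    hhalf.le).trans h1
  have hn₀ := minError_ne_top ha (hDf _ hf₀) (hDg _ hg₀) Gᶜ
  have hn := minError_ne_top ha (hDf f hf) (hDg g hg) Gᶜ
  rw [← ENNReal.ofReal_toReal hn₀, ← ENNReal.ofReal_toReal hn, ← ENNReal.ofReal_mul hhalf.le,
    ← ENNReal.ofReal_mul hhalf.le, ← ENNReal.ofReal_add (by positivity) (by positivity),
    ENNReal.ofReal_le_ofReal_iff ENNReal.toReal_nonneg] at h2
  rw [← ENNReal.toReal_le_toReal hn hn₀]
  linarith

/-- For convex sets of densities the optimal estimate for the least favorable pair has no larger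
error at any other pair. Near-optimal polynomials for `(1 - t) (f₀, g₀) + t (f, g)` have error at
most about the minimal one at `(f, g)`, and converge to the optimal estimate as `t → 0`. -/
theorem mse_le_minError_of_convex (ha : Summable fun j => ‖a j‖)
    (hG : ∀ n : ℤ, 0 ≤ n → n ∈ G) (hfin : (G ∩ {n | n < 0}).Finite)
    (hDf : ∀ f ∈ Df, IsSpectralDensity f) (hDg : ∀ g ∈ Dg, IsSpectralDensity g)
    (hf₀ : f₀ ∈ Df) (hg₀ : g₀ ∈ Dg) (hmin : Minimality f₀ g₀)
    (hmax : SolvesMaxProblem a G Df Dg f₀ g₀) (hcf : Convex ℝ Df) (hcg : Convex ℝ Dg)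
    {h₀ : VecFun T} (hh₀ : IsSpectralFormula a G f₀ g₀ h₀) {f g : MatFun T} (hf : f ∈ Df)
    (hg : g ∈ Dg) : mse a h₀ f g ≤ minError a Gᶜ f₀ g₀ := by
  obtain ⟨S, hS⟩ := exists_isRoot (hDf _ hf₀) (hDg _ hg₀) hmin
  have hh₀m := (hh₀.toLp_eq ha (hDf _ hf₀) (hDg _ hg₀) hS hG).1
  set e₀ := minError a Gᶜ f₀ g₀ with he₀
  have he₀top : e₀ ≠ ∞ := minError_ne_top ha (hDf _ hf₀) (hDg _ hg₀) Gᶜ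
  set t : ℕ → ℝ := fun k => 1 / ((k : ℝ) + 1) * (1 / 2) with ht
  have ht0 (k : ℕ) : 0 < t k := by positivity
  have ht1 (k : ℕ) : t k ≤ 1 / 2 := by
    have : 1 / ((k : ℝ) + 1) ≤ 1 := by
      rw [div_le_one (by positivity)]; linarith [k.cast_nonneg (α := ℝ)]
    simp only [ht]; linarith
  have htlim : Tendsto t atTop (𝓝 0) := by
    simpa [ht] using (tendsto_one_div_add_atTop_nhds_zero_nat (𝕜 := ℝ)).mul_const (1 / 2 : ℝ)
  have hex (k : ℕ) : ∃ p : ℤ →₀ (Fin T → ℂ), (∀ n ∈ p.support, n ∈ Gᶜ) ∧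
      ENNReal.ofReal (1 - t k) * mse a (trigPoly p) f₀ g₀ +
        ENNReal.ofReal (t k) * mse a (trigPoly p) f g < e₀ + ENNReal.ofReal (t k ^ 2) := by
    have hα : 0 ≤ 1 - t k := by linarith [ht1 k]
    have hle := minError_le_of_convex ha hG hfin hDf hDg hf₀ hg₀ hmin hmax hcf hcg
      (hcf hf₀ hf hα (ht0 k).le (by ring)) (hcg hg₀ hg hα (ht0 k).le (by ring))
    have hlt := hle.trans_lt (ENNReal.lt_add_right he₀top
      (ENNReal.ofReal_pos.2 (pow_pos (ht0 k) 2)).ne')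
    obtain ⟨p, hp, hpe⟩ := exists_trigPoly_mse_lt ha
      (((hDf _ hf₀).smul hα).add ((hDf f hf).smul (ht0 k).le))
      (((hDg _ hg₀).smul hα).add ((hDg g hg).smul (ht0 k).le)) hlt
    rw [mse_combo ha (hDf _ hf₀) (hDg _ hg₀) (hDf f hf) (hDg g hg) hα (ht0 k).le
      (aestronglyMeasurable_trigPoly p)] at hpe
    exact ⟨p, hp, hpe⟩
  choose p hp hpe using hex
  -- the squared distance of the polynomials to `h₀`
  set d : ℕ → ℝ≥0∞ := fun k => ENNReal.ofReal (1 / (2 * Real.pi)) *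
    weightedSq (f₀ + g₀) (fun x => trigPoly (p k) x - h₀ x) with hd
  have hpyth (k : ℕ) : mse a (trigPoly (p k)) f₀ g₀ = e₀ + d k :=
    mse_eq_minError_add ha (hDf _ hf₀) (hDg _ hg₀) hS hG hfin hh₀
      (trigPoly_mem_L2span ((hDf _ hf₀).add (hDg _ hg₀)) (hp k))
  have hdtop (k : ℕ) : d k ≠ ∞ := by
    have := mse_trigPoly_ne_top ha (hDf _ hf₀) (hDg _ hg₀) (p k)
    rw [hpyth] at this
    exact (ENNReal.add_ne_top.1 this).2
  have hreal (k : ℕ) : (1 - t k) * (e₀.toReal + (d k).toReal) +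
      t k * (mse a (trigPoly (p k)) f g).toReal ≤ e₀.toReal + t k ^ 2 := by
    have hα : 0 ≤ 1 - t k := by linarith [ht1 k]
    have h1 := (hpe k).le
    have h2 := mse_trigPoly_ne_top ha (hDf f hf) (hDg g hg) (p k)
    rw [hpyth, ← ENNReal.ofReal_toReal he₀top, ← ENNReal.ofReal_toReal (hdtop k),
      ← ENNReal.ofReal_toReal h2, ← ENNReal.ofReal_add (by positivity) (by positivity),
      ← ENNReal.ofReal_add (by positivity) (by positivity), ← ENNReal.ofReal_mul hα,
      ← ENNReal.ofReal_mul (ht0 k).le,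
      ← ENNReal.ofReal_add (by positivity) (mul_nonneg (ht0 k).le (by positivity)),
      ENNReal.ofReal_le_ofReal_iff (by positivity)] at h1
    exact h1
  have hm (k : ℕ) : mse a (trigPoly (p k)) f g ≤ e₀ + ENNReal.ofReal (t k) := by
    have hm0 : 0 ≤ (mse a (trigPoly (p k)) f g).toReal := ENNReal.toReal_nonneg
    have hd0 : 0 ≤ (d k).toReal := ENNReal.toReal_nonneg
    have h1 : t k * (mse a (trigPoly (p k)) f g).toReal ≤ t k * (e₀.toReal + t k) := by
      nlinarith [hreal k, mul_nonneg (show 0 ≤ 1 - t k by linarith [ht1 k]) hd0]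
    have h2 := le_of_mul_le_mul_left h1 (ht0 k)
    rw [← ENNReal.ofReal_toReal (mse_trigPoly_ne_top ha (hDf f hf) (hDg g hg) (p k)),
      ← ENNReal.ofReal_toReal he₀top, ← ENNReal.ofReal_add (by positivity) (ht0 k).le]
    exact ENNReal.ofReal_le_ofReal h2
  have hdle (k : ℕ) : d k ≤ ENNReal.ofReal (2 * (t k * e₀.toReal + t k ^ 2)) := by
    have hm0 : 0 ≤ (mse a (trigPoly (p k)) f g).toReal := ENNReal.toReal_nonneg
    have hd0 : 0 ≤ (d k).toReal := ENNReal.toReal_nonneg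
    rw [← ENNReal.ofReal_toReal (hdtop k)]
    refine ENNReal.ofReal_le_ofReal ?_
    nlinarith [hreal k, mul_nonneg (ht0 k).le hm0,
      mul_le_mul_of_nonneg_right (show 1 / 2 ≤ 1 - t k by linarith [ht1 k]) hd0]
  have hdlim : Tendsto d atTop (𝓝 0) := by
    have h1 : Tendsto (fun k => 2 * (t k * e₀.toReal + t k ^ 2)) atTop (𝓝 0) := by
      simpa using ((htlim.mul_const e₀.toReal).add (htlim.pow 2)).const_mul 2
    have h2 := ENNReal.tendsto_ofReal h1
    rw [ENNReal.ofReal_zero] at h2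
    exact tendsto_of_tendsto_of_tendsto_of_le_of_le tendsto_const_nhds h2 (fun _ => zero_le) hdle
  have hpi : ENNReal.ofReal (1 / (2 * Real.pi)) ≠ 0 := by
    have := Real.pi_pos
    exact (ENNReal.ofReal_pos.2 (by positivity)).ne'
  have hwlim : Tendsto (fun k => weightedSq (f₀ + g₀) (fun x => trigPoly (p k) x - h₀ x)) atTop
      (𝓝 0) := by
    have h1 := ENNReal.Tendsto.const_mul (a := (ENNReal.ofReal (1 / (2 * Real.pi)))⁻¹) hdlim
      (Or.inr (ENNReal.inv_ne_top.2 hpi))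
    rw [mul_zero] at h1
    refine h1.congr fun k => ?_
    rw [hd, ← mul_assoc, ENNReal.inv_mul_cancel hpi ENNReal.ofReal_ne_top, one_mul]
  obtain ⟨ns, hns, hae⟩ := exists_subseq_tendsto_ae hS
    (fun k => aestronglyMeasurable_trigPoly (p k)) (aestronglyMeasurable_pi.1 hh₀m) hwlim
  refine mse_le_of_tendsto ha (hDf f hf) (hDg g hg)
    (fun k => aestronglyMeasurable_trigPoly (p (ns k))) hae
    (c := fun k => e₀ + ENNReal.ofReal (t (ns k))) ?_ fun k => hm (ns k)
  have h1 := ENNReal.tendsto_ofReal (htlim.comp hns.tendsto_atTop)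
  rw [ENNReal.ofReal_zero] at h1
  simpa using h1.const_add e₀

end Convexity

end PCExtrapolation

end

theorem mainTheorem4 (T : ℕ) (hT : 0 < T) (s : ℕ) (N K : ℕ → ℕ)
    (a : ℕ → ℂ) (ha : Summable fun j => ‖a j‖)
    (Df Dg : Set (MatFun T))
    (hDf : ∀ f ∈ Df, IsSpectralDensity f) (hDg : ∀ g ∈ Dg, IsSpectralDensity g)
    (f₀ g₀ : MatFun T) (hf₀ : f₀ ∈ Df) (hg₀ : g₀ ∈ Dg)
    (hmin : Minimality f₀ g₀)
    (hmax : SolvesMaxProblem a (unobserved s N K) Df Dg f₀ g₀) :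
    ((Convex ℝ Df ∧ Convex ℝ Dg) ∨ (∀ f ∈ Df, ∀ g ∈ Dg, Minimality f g) →
      IsLeastFavorable a (observed s N K) Df Dg f₀ g₀) ∧
    (∃ h₀ : VecFun T, IsSpectralFormula a (unobserved s N K) f₀ g₀ h₀) ∧
    ∀ h₀ : VecFun T, IsSpectralFormula a (unobserved s N K) f₀ g₀ h₀ →
      IsOptimal a (observed s N K) f₀ g₀ h₀ ∧
      (Convex ℝ Df → Convex ℝ Dg → h₀ ∈ commonSpace (observed s N K) Df Dg →
        IsMinimax a (observed s N K) Df Dg h₀) := by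
  have hG : ∀ n : ℤ, 0 ≤ n → n ∈ unobserved s N K := fun n hn => unobserved_of_nonneg hn
  have hfin := finite_unobserved_neg s N K
  rw [observed_eq_compl]
  refine ⟨fun hcase => ⟨hf₀, hg₀, fun f hf g hg => ?_⟩, ?_, fun h₀ hh₀ => ?_⟩
  · rcases hcase with ⟨hcf, hcg⟩ | hall
    · exact minError_le_of_convex ha hG hfin hDf hDg hf₀ hg₀ hmin hmax hcf hcg hf hg
    · exact minError_le_of_solvesMaxProblem ha hG hfin hDf hDg hf₀ hg₀ hmin hmax hf hg
        (hall f hf g hg)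
  · obtain ⟨S, hS⟩ := exists_isRoot (hDf _ hf₀) (hDg _ hg₀) hmin
    exact exists_isSpectralFormula ha hS hG
  · have hopt := hh₀.isOptimal ha (hDf _ hf₀) (hDg _ hg₀) hmin hG hfin
    refine ⟨hopt, fun hcf hcg hcommon => ⟨hcommon, mse a h₀ f₀ g₀,
      ⟨⟨f₀, hf₀, g₀, hg₀, rfl⟩, ?_⟩, fun h hh => ?_⟩⟩
    · rintro _ ⟨f, hf, g, hg, rfl⟩
      rw [hopt.2]
      exact mse_le_minError_of_convex ha hG hfin hDf hDg hf₀ hg₀ hmin hmax hcf hcg hh₀ hf hg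
    · rw [hopt.2]
      refine le_trans (iInf₂_le h (hh f₀ hf₀ g₀ hg₀)) ?_
      exact le_iSup₂_of_le f₀ hf₀ (le_iSup₂_of_le g₀ hg₀ le_rfl)
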